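/- Let $\mathcal H$ be a complex separable Hilbert space, and assume: (i) $A_-$ is a self-adjoint operator in $\mathcal H$ with domain $\operatorname{dom}(A_-)$. (ii) $B(t)$, $t\in\mathbb R$, are closed symmetric operators in $\mathcal H$ with $\operatorname{dom}(B(t))\supseteq\operatorname{dom}(A_-)$. (iii) $B'(t)$, $t\in\mathbb R$, are closed symmetric operators in $\mathcal H$ with $\operatorname{dom}(B'(t))\supseteq\operatorname{dom}(A_-)$; for all $g,h\in\mathcal H$ the function $t\mapsto (g,B(t)(|A_-|+I)^{-1}h)$ is locally absolutely continuous on $\mathbb R$, with $$\frac{d}{dt}\,(g,B(t)(|A_-|+I)^{-1}h)=(g,B'(t)(|A_-|+I)^{-1}h)\quad\text{for a.e. } t\in\mathbb R,$$ and it is normalized by $\lim_{t\to-\infty}(g,B(t)(|A_-|+I)^{-1}h)=0$. (iv) $B'(t)(|A_-|+I)^{-1}$ is of trace class for all $t\in\mathbb R$, and $\int_{\mathbb R}\|B'(t)(|A_-|+I)^{-1}\|_{\mathcal B_1(\mathcal H)}\,dt<\infty$. (v) The families $(|B(t)|^2+I)^{-1}$ and $(|B'(t)|^2+I)^{-1}$,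 $t\in\mathbb R$, are weakly (Lebesgue) measurable. Put $A(t)=A_-+B(t)$ on $\operatorname{dom}(A(t))=\operatorname{dom}(A_-)$. In $L^2(\mathbb R;\mathcal H)$ let $\boldsymbol A$ be the operator $(\boldsymbol A f)(t)=A(t)f(t)$, whose domain consists of all $f\in L^2(\mathbb R;\mathcal H)$ with $f(t)\in\operatorname{dom}(A(t))$ for a.e. $t$ and $t\mapsto A(t)f(t)$ in $L^2(\mathbb R;\mathcal H)$; let $\boldsymbol A_-$ be defined in the same way with $A_-$ in place of $A(t)$; let $d/dt$ have as domain the locally absolutely continuous $f\in L^2(\mathbb R;\mathcal H)$ (i.e. primitives of locally Bochner integrable functions $f'$) with $f'\in L^2(\mathbb R;\mathcal H)$; and let $$\boldsymbol D_{\boldsymbol A}=\frac{d}{dt}+\boldsymbol A,\qquad \operatorname{dom}(\boldsymbol D_{\boldsymbol A})=\operatorname{dom}(d/dt)\cap\operatorname{dom}(\boldsymbol A_-).$$ A densely defined closed operator $T$ is called upper-semi-Fredholm if $\operatorname{ran}(T)$ is closed and $\dim\ker T<\infty$, lower-semi-Fredholm if $\operatorname{ran}(T)$ is closed and $\dim\ker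 T^*<\infty$, and Fredholm if $\operatorname{ran}(T)$ is closed and $\dim\ker T+\dim\ker T^*<\infty$. Then the operators $A(t)$ are self-adjoint, $\boldsymbol D_{\boldsymbol A}$ is well defined on the stated domain (that is, $\operatorname{dom}(d/dt)\cap\operatorname{dom}(\boldsymbol A_-)\subseteq\operatorname{dom}(\boldsymbol A)$), densely defined and closed in $L^2(\mathbb R;\mathcal H)$, one has $(A(t)-zI)^{-1}\to(A_--zI)^{-1}$ in operator norm as $t\to-\infty$ for all $z\in\mathbb C\setminus\mathbb R$, and there is a self-adjoint operator $A_+$ in $\mathcal H$ with $\operatorname{dom}(A_+)=\operatorname{dom}(A_-)$ and $(A(t)-zI)^{-1}\to(A_+-zI)^{-1}$ in operator norm as $t\to+\infty$ for all $z\in\mathbb C\setminus\mathbb R$ (which determines $A_+$), such that: 1. $\boldsymbol D_{\boldsymbol A}$ is Fredholm if and only if $0\in\rho(A_+)\cap\rho(A_-)$; 2. if $0\in\sigma(A_+)$ or $0\in\sigma(A_-)$, then $\boldsymbol D_{\boldsymbol A}$ is neither upper-semi-Fredholm nor lower-semi-Fredholm. -/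

import Mathlib

open MeasureTheory Filter Topology
open scoped ENNReal LinearPMap

noncomputable section

namespace ModelOperator

/-! ### Unbounded operators in a Hilbert space

An unbounded operator in `E` is a `LinearPMap`, written `E →ₗ.[ℂ] E`.  Adjoints, closedness and
self-adjointness (which includes density of the domain) are those of Mathlib. -/

section Unbounded

variable {E : Type*} [NormedAddCommGroup E] [InnerProductSpace ℂ E] [CompleteSpace E]

/-- The operator `T + c I`, with domain `dom T`. -/
def addScalar (T : E →ₗ.[ℂ] E) (c : ℂ) : E →ₗ.[ℂ] E :=
  (c • (LinearMap.id : E →ₗ[ℂ] E)) +ᵥ T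

/-- The product `S T`, with its natural domain `{x ∈ dom T | T x ∈ dom S}`. -/
def mulOp (S T : E →ₗ.[ℂ] E) : E →ₗ.[ℂ] E :=
  S.comp (T.domRestrict ((S.domain.comap T.toFun).map T.domain.subtype)) (by
    rintro ⟨x, hx⟩
    obtain ⟨⟨y, hy, hyx⟩, hxT⟩ := Submodule.mem_inf.1 hx
    have h : T.domRestrict ((S.domain.comap T.toFun).map T.domain.subtype) ⟨x, hx⟩ = T y :=
      LinearPMap.domRestrict_apply (by simpa using hyx.symm)
    rw [h]
    exact hy)

/-- The graph of a product is the composition of the graphs. -/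
theorem mem_graph_mulOp (S T : E →ₗ.[ℂ] E) (x z : E) :
    (x, z) ∈ (mulOp S T).graph ↔ ∃ y, (x, y) ∈ T.graph ∧ (y, z) ∈ S.graph := by
  simp only [LinearPMap.mem_graph_iff]
  constructor
  · rintro ⟨⟨u, hu⟩, rfl, rfl⟩
    obtain ⟨⟨y, hy, hyx⟩, hxT⟩ := Submodule.mem_inf.1 hu
    refine ⟨T ⟨u, hxT⟩, ⟨⟨u, hxT⟩, rfl, rfl⟩, ?_⟩
    have hm : T ⟨u, hxT⟩ ∈ S.domain := by
      have : y = ⟨u, hxT⟩ := Subtype.ext hyx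
      rw [← this]; exact hy
    exact ⟨⟨_, hm⟩, rfl, rfl⟩
  · rintro ⟨y, ⟨⟨u, hu⟩, rfl, rfl⟩, ⟨⟨v, hv⟩, hv1, rfl⟩⟩
    have hv1 : v = T ⟨u, hu⟩ := hv1
    subst hv1
    exact ⟨⟨u, Submodule.mem_inf.2 ⟨⟨⟨u, hu⟩, hv, rfl⟩, hu⟩⟩, rfl, rfl⟩

/-- A bounded operator, seen as an unbounded operator with domain the whole space. -/
def ofBounded (R : E →L[ℂ] E) : E →ₗ.[ℂ] E :=
  (R : E →ₗ[ℂ] E).toPMap ⊤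

open Classical in
/-- The bounded operator given by an everywhere defined, bounded `T`
(and `0` if `T` is not of this kind). -/
def toBounded (T : E →ₗ.[ℂ] E) : E →L[ℂ] E :=
  if h : ∃ R : E →L[ℂ] E, T = ofBounded R then h.choose else 0

/-- `R` is the bounded, everywhere defined, two-sided inverse of `T`. -/
def IsBoundedInverse (T : E →ₗ.[ℂ] E) (R : E →L[ℂ] E) : Prop :=
  (∀ x, ∃ h : R x ∈ T.domain, T ⟨R x, h⟩ = x) ∧ ∀ y : T.domain, R (T y) = y

open Classical in
/-- The bounded inverse `T⁻¹` of a boundedly invertible `T`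
(and `0` if `T` is not boundedly invertible). -/
def boundedInverse (T : E →ₗ.[ℂ] E) : E →L[ℂ] E :=
  if h : ∃ R, IsBoundedInverse T R then h.choose else 0

/-- The resolvent set `ρ(T)`. -/
def resolventSet (T : E →ₗ.[ℂ] E) : Set ℂ :=
  {z | ∃ R, IsBoundedInverse (addScalar T (-z)) R}

/-- The spectrum `σ(T)`. -/
def spectrum (T : E →ₗ.[ℂ] E) : Set ℂ :=
  (resolventSet T)ᶜ

/-- The resolvent `(T - z I)⁻¹`. -/
def resolventOp (T : E →ₗ.[ℂ] E) (z : ℂ) : E →L[ℂ] E :=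
  boundedInverse (addScalar T (-z))

/-- `T` is symmetric: `⟪T x, y⟫ = ⟪x, T y⟫` on `dom T`. -/
def IsSymm (T : E →ₗ.[ℂ] E) : Prop :=
  T.IsFormalAdjoint T

/-- `S = |T| = (T* T)^{1/2}`: the nonnegative self-adjoint operator with `S² = T* T`,
equality of domains included. -/
def IsAbs (T S : E →ₗ.[ℂ] E) : Prop :=
  IsSelfAdjoint S ∧ (∀ x : S.domain, 0 ≤ (inner ℂ (x : E) (S x)).re) ∧
    mulOp S S = mulOp T† T

open Classical in
/-- The absolute value `|T|` of a densely defined closed operator. For such `T` the operator of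
`IsAbs` exists and is unique; the value is `0` for other `T` without absolute value. -/
def absOp (T : E →ₗ.[ℂ] E) : E →ₗ.[ℂ] E :=
  if h : ∃ S, IsAbs T S then h.choose else 0

/-- The bounded operator `(|T| + I)⁻¹`. -/
def absInv (T : E →ₗ.[ℂ] E) : E →L[ℂ] E :=
  boundedInverse (addScalar (absOp T) 1)

/-- The bounded operator `(|T|² + I)⁻¹ = (T* T + I)⁻¹`. -/
def absSqInv (T : E →ₗ.[ℂ] E) : E →L[ℂ] E :=
  boundedInverse (addScalar (mulOp T† T) 1)

/-- The operator `T (|A| + I)⁻¹`. It is bounded and everywhere defined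
if `A` is self-adjoint, `T` is closed and `dom A ⊆ dom T`. -/
def relOp (A T : E →ₗ.[ℂ] E) : E →L[ℂ] E :=
  toBounded (mulOp T (ofBounded (absInv A)))

/-- The trace norm `‖K‖₁ = tr |K|` of a bounded operator: the supremum of `∑ᵢ ⟪eᵢ, |K| eᵢ⟫` over
all finite orthonormal families, which is the value `∑ᵢ ⟪eᵢ, |K| eᵢ⟫` for any orthonormal basis. -/
def traceNorm (K : E →L[ℂ] E) : ℝ≥0∞ :=
  ⨆ (n : ℕ) (e : Fin n → E) (_ : Orthonormal ℂ e),
    ∑ i, ENNReal.ofReal (inner ℂ (e i) (CFC.abs K (e i))).re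

/-- `K` belongs to the trace class. -/
def IsTraceClass (K : E →L[ℂ] E) : Prop :=
  traceNorm K < ∞

/-- The range of `T` is closed. -/
def HasClosedRange (T : E →ₗ.[ℂ] E) : Prop :=
  IsClosed (LinearMap.range T.toFun : Set E)

/-- `T` is upper-semi-Fredholm: closed range and `dim ker T < ∞`. -/
def IsUpperSemiFredholm (T : E →ₗ.[ℂ] E) : Prop :=
  HasClosedRange T ∧ FiniteDimensional ℂ (LinearMap.ker T.toFun)

/-- `T` is lower-semi-Fredholm: closed range and `dim ker T* < ∞`. -/
def IsLowerSemiFredholm (T : E →ₗ.[ℂ] E) : Prop :=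
  HasClosedRange T ∧ FiniteDimensional ℂ (LinearMap.ker (T†).toFun)

/-- `T` is Fredholm: closed range, `dim ker T < ∞` and `dim ker T* < ∞`. -/
def IsFredholm (T : E →ₗ.[ℂ] E) : Prop :=
  HasClosedRange T ∧ FiniteDimensional ℂ (LinearMap.ker T.toFun) ∧
    FiniteDimensional ℂ (LinearMap.ker (T†).toFun)

end Unbounded

/-! ### Operators in `L²(ℝ; H)` -/

section L2

variable {H : Type*} [NormedAddCommGroup H] [InnerProductSpace ℂ H]

/-- The Hilbert space `L²(ℝ; H)`. -/
abbrev L2 (H : Type*) [NormedAddCommGroup H] [InnerProductSpace ℂ H] : Type _ :=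
  Lp H 2 (volume : Measure ℝ)

/-- The graph of the operator with fibers `A t`: all pairs `(f, g)` in `L²(ℝ; H)` such that
`f t ∈ dom (A t)` and `A t (f t) = g t` for a.e. `t`. -/
def fiberGraph (A : ℝ → H →ₗ.[ℂ] H) : Submodule ℂ (L2 H × L2 H) where
  carrier := {p | ∀ᵐ t, ∃ h : p.1 t ∈ (A t).domain, A t ⟨p.1 t, h⟩ = p.2 t}
  zero_mem' := by
    filter_upwards [Lp.coeFn_zero H 2 (volume : Measure ℝ)] with t ht
    refine ⟨by simp, ?_⟩
    have h0 : ∀ h, A t ⟨(0 : L2 H × L2 H).1 t, h⟩ = 0 := fun h => by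
      have : (⟨(0 : L2 H × L2 H).1 t, h⟩ : (A t).domain) = 0 := Subtype.ext (by simp)
      rw [this, LinearPMap.map_zero]
    rw [h0]
    simp
  add_mem' := by
    intro p q hp hq
    filter_upwards [hp, hq, Lp.coeFn_add p.1 q.1, Lp.coeFn_add p.2 q.2] with t h1 h2 e1 e2
    obtain ⟨h1, k1⟩ := h1
    obtain ⟨h2, k2⟩ := h2
    have e1' : (p + q).1 t = p.1 t + q.1 t := by simpa using e1
    have e2' : (p + q).2 t = p.2 t + q.2 t := by simpa using e2
    have hm : (p + q).1 t ∈ (A t).domain := by rw [e1']; exact add_mem h1 h2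
    refine ⟨hm, ?_⟩
    have : (⟨(p + q).1 t, hm⟩ : (A t).domain) = ⟨p.1 t, h1⟩ + ⟨q.1 t, h2⟩ := Subtype.ext e1'
    rw [this, LinearPMap.map_add, k1, k2, e2']
  smul_mem' := by
    intro c p hp
    filter_upwards [hp, Lp.coeFn_smul c p.1, Lp.coeFn_smul c p.2] with t h1 e1 e2
    obtain ⟨h1, k1⟩ := h1
    have e1' : (c • p).1 t = c • p.1 t := by simpa using e1
    have e2' : (c • p).2 t = c • p.2 t := by simpa using e2
    have hm : (c • p).1 t ∈ (A t).domain := by rw [e1']; exact Submodule.smul_mem _ _ h1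
    refine ⟨hm, ?_⟩
    have : (⟨(c • p).1 t, hm⟩ : (A t).domain) = c • ⟨p.1 t, h1⟩ := Subtype.ext e1'
    rw [this, LinearPMap.map_smul, k1, e2']

/-- The operator in `L²(ℝ; H)` with fibers `A t`: its domain consists of the `f` such that
`f t ∈ dom (A t)` for a.e. `t` and `t ↦ A t (f t)` is (a.e. equal to) an element of `L²(ℝ; H)`,
and it maps `f` to that element. -/
def fiberOp (A : ℝ → H →ₗ.[ℂ] H) : L2 H →ₗ.[ℂ] L2 H :=
  (fiberGraph A).toLinearPMap

/-- `fiberGraph A` is the graph of `fiberOp A`. -/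
theorem graph_fiberOp (A : ℝ → H →ₗ.[ℂ] H) : (fiberOp A).graph = fiberGraph A := by
  refine Submodule.toLinearPMap_graph_eq _ ?_
  rintro ⟨f, g⟩ hp hf
  have hf : f = 0 := hf
  subst hf
  refine Lp.ext ?_
  have hp : ∀ᵐ t, ∃ h : (0 : L2 H) t ∈ (A t).domain, A t ⟨(0 : L2 H) t, h⟩ = g t := hp
  filter_upwards [hp, Lp.coeFn_zero H 2 (volume : Measure ℝ)] with t h1 h2
  obtain ⟨h1, k1⟩ := h1
  have : (⟨(0 : L2 H) t, h1⟩ : (A t).domain) = 0 := Subtype.ext (by simp)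
  rw [this, LinearPMap.map_zero] at k1
  rw [← k1, h2]
  rfl

/-- An element of `L²(ℝ; H)` is integrable over every bounded interval. -/
theorem intervalIntegrable_L2 (g : L2 H) (s t : ℝ) :
    IntervalIntegrable (fun x => g x) volume s t :=
  (LocallyIntegrable.integrableOn_isCompact
    ((Lp.memLp g).locallyIntegrable (by norm_num)) isCompact_uIcc).intervalIntegrable

variable [CompleteSpace H]

/-- The graph of `d/dt`: all pairs `(f, g)` in `L²(ℝ; H)` such that `f` has a locally absolutely
continuous representative `u` with a.e. derivative `g`, that is, with
`u t = u s + ∫ x in s..t, g x` (Bochner integral) for all `s`, `t`. -/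
def ddtGraph (H : Type*) [NormedAddCommGroup H] [InnerProductSpace ℂ H] [CompleteSpace H] :
    Submodule ℂ (L2 H × L2 H) where
  carrier := {p | ∃ u : ℝ → H, p.1 =ᵐ[volume] u ∧
    ∀ s t : ℝ, u t = u s + ∫ x in s..t, p.2 x}
  zero_mem' := by
    refine ⟨0, Lp.coeFn_zero H 2 (volume : Measure ℝ), fun s t => ?_⟩
    have : ∫ x in s..t, (0 : L2 H × L2 H).2 x = ∫ x in s..t, (0 : H) := by
      refine intervalIntegral.integral_congr_ae ?_
      filter_upwards [Lp.coeFn_zero H 2 (volume : Measure ℝ)] with x hx _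
      exact hx
    rw [this]
    simp
  add_mem' := by
    rintro p q ⟨u, hu, hu'⟩ ⟨v, hv, hv'⟩
    refine ⟨u + v, (Lp.coeFn_add p.1 q.1).trans (hu.add hv), fun s t => ?_⟩
    have : ∫ x in s..t, (p + q).2 x = ∫ x in s..t, (p.2 x + q.2 x) := by
      refine intervalIntegral.integral_congr_ae ?_
      filter_upwards [Lp.coeFn_add p.2 q.2] with x hx _
      exact hx
    rw [this, intervalIntegral.integral_add (intervalIntegrable_L2 _ _ _)
      (intervalIntegrable_L2 _ _ _), Pi.add_apply, Pi.add_apply, hu' s t, hv' s t]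
    abel
  smul_mem' := by
    rintro c p ⟨u, hu, hu'⟩
    refine ⟨c • u, (Lp.coeFn_smul c p.1).trans (hu.const_smul c), fun s t => ?_⟩
    have : ∫ x in s..t, (c • p).2 x = ∫ x in s..t, c • p.2 x := by
      refine intervalIntegral.integral_congr_ae ?_
      filter_upwards [Lp.coeFn_smul c p.2] with x hx _
      exact hx
    rw [this, intervalIntegral.integral_smul, Pi.smul_apply, Pi.smul_apply, hu' s t, smul_add]

/-- The operator `d/dt` in `L²(ℝ; H)`, on the locally absolutely continuous functions in
`L²(ℝ; H)` with derivative in `L²(ℝ; H)`. -/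
def ddt (H : Type*) [NormedAddCommGroup H] [InnerProductSpace ℂ H] [CompleteSpace H] :
    L2 H →ₗ.[ℂ] L2 H :=
  (ddtGraph H).toLinearPMap

/-- `ddtGraph H` is the graph of `ddt H`. -/
theorem graph_ddt : (ddt H).graph = ddtGraph H := by
  refine Submodule.toLinearPMap_graph_eq _ ?_
  rintro ⟨f, g⟩ ⟨u, hu, hu'⟩ hf
  have hf : f = 0 := hf
  subst hf
  have hu : (0 : L2 H) =ᵐ[volume] u := hu
  have hu' : ∀ s t : ℝ, u t = u s + ∫ x in s..t, g x := hu'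
  have hd := LocallyIntegrable.ae_hasDerivAt_integral
    ((Lp.memLp g).locallyIntegrable (by norm_num))
  have hcont : Continuous u := by
    have : u = fun t => u 0 + ∫ x in (0 : ℝ)..t, g x := funext fun t => hu' 0 t
    rw [this]
    exact continuous_const.add
      (intervalIntegral.continuous_primitive (fun a b => intervalIntegrable_L2 g a b) 0)
  have hu0 : u = 0 := by
    refine (Continuous.ae_eq_iff_eq volume hcont continuous_const).1 ?_
    exact hu.symm.trans (Lp.coeFn_zero H 2 (volume : Measure ℝ))
  have hint : (fun t => ∫ x in (0 : ℝ)..t, g x) = fun _ => (0 : H) := by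
    funext t
    have := hu' 0 t
    simpa [hu0] using this.symm
  refine Lp.ext ?_
  filter_upwards [hd, Lp.coeFn_zero H 2 (volume : Measure ℝ)] with t ht h0
  have h1 := ht 0
  rw [hint] at h1
  rw [h1.unique (hasDerivAt_const t (0 : H))]
  exact h0.symm

/-- The family `A(t) = A₋ + B(t)`, with domain `dom A₋ ∩ dom B(t)`. -/
def familyOp (A : H →ₗ.[ℂ] H) (B : ℝ → H →ₗ.[ℂ] H) (t : ℝ) : H →ₗ.[ℂ] H :=
  A + B t

/-- The operator `D = d/dt + 𝐀` in `L²(ℝ; H)`, where `𝐀` has the fibers `A(t) = A₋ + B(t)`,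
on the elements of `dom (d/dt) ∩ dom 𝐀₋`, where `𝐀₋` has the constant fiber `A₋`. (The sum also
asks for membership in `dom 𝐀`.) -/
def modelOp (A : H →ₗ.[ℂ] H) (B : ℝ → H →ₗ.[ℂ] H) : L2 H →ₗ.[ℂ] L2 H :=
  (ddt H + fiberOp (familyOp A B)).domRestrict (fiberOp fun _ => A).domain

/-- The standing assumptions on `A₋ = A` and on the families `B`, `B'`. -/
structure RelTraceClassPath (A : H →ₗ.[ℂ] H) (B B' : ℝ → H →ₗ.[ℂ] H) : Prop where
  selfAdjoint : IsSelfAdjoint A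
  closed : ∀ t, (B t).IsClosed
  symm : ∀ t, IsSymm (B t)
  domain_le : ∀ t, A.domain ≤ (B t).domain
  closed' : ∀ t, (B' t).IsClosed
  symm' : ∀ t, IsSymm (B' t)
  domain_le' : ∀ t, A.domain ≤ (B' t).domain
  /-- `B(t)(|A₋| + I)⁻¹` is weakly locally absolutely continuous. -/
  absCont : ∀ (g h : H) (a b : ℝ),
    AbsolutelyContinuousOnInterval (fun t => inner ℂ g (relOp A (B t) h)) a b
  /-- Its weak derivative is `B'(t)(|A₋| + I)⁻¹` almost everywhere. -/
  deriv : ∀ g h : H, ∀ᵐ t : ℝ,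
    HasDerivAt (fun s => inner ℂ g (relOp A (B s) h)) (inner ℂ g (relOp A (B' t) h)) t
  /-- The normalization `B₋ = 0`: `B(t)(|A₋| + I)⁻¹` tends weakly to `0` as `t → -∞`. -/
  tendsto_atBot : ∀ g h : H, Tendsto (fun t => inner ℂ g (relOp A (B t) h)) atBot (𝓝 0)
  traceClass : ∀ t, IsTraceClass (relOp A (B' t))
  integrable : ∫⁻ t : ℝ, traceNorm (relOp A (B' t)) < ∞
  measurable : ∀ g h : H, AEMeasurable (fun t => inner ℂ g (absSqInv (B t) h)) volume
  measurable' : ∀ g h : H, AEMeasurable (fun t => inner ℂ g (absSqInv (B' t) h)) volume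

end L2

end ModelOperator

end

open MeasureTheory Filter Topology
open scoped ENNReal LinearPMap InnerProductSpace

set_option linter.unusedSectionVars false

noncomputable section

namespace ModelOperator

/-! ### Symmetric operators, self-adjointness and bounded inverses in terms of graphs. -/

section Abstract

variable {E : Type*} [NormedAddCommGroup E] [InnerProductSpace ℂ E]

/-! Everything is expressed through C(t) = B(t)(A₋ - i)⁻¹, so that A(t) = A₋ + C(t)(A₋ - i).
Integrability of the trace norm of the derivative makes B(t)(|A₋| + I)⁻¹, and hence C, a norm
continuous path with norm limits 0 at -∞ and C₊ at +∞ (`path_of_traceNorm`). The path is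
approximated by finite rank operators, on one finite dimensional space for all t. Therefore C(t)(A₋
- i)(A₋ - iμ)⁻¹ tends to 0 in norm as |μ| → ∞, uniformly in t
(`RelTraceClassPath.exists_relCompactPath`). The perturbations thus have relative bound zero: this
gives self-adjointness by a Neumann series, and norm resolvent convergence by the second resolvent
identity, with A₊ = A₋ + C₊(A₋ - i).

In L²(ℝ; H) the operator d/dt is skew and commutes with the resolvents of the constant fiber
operator A₋, so ‖f' + A₋f‖² = ‖f'‖² + ‖A₋f‖² (`norm_sq_ddt_add_fiber`). Hence the graph norm of D
controls f' and A₋f separately, and D is closed. The same identity inverts d/dt + T for every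
self-adjoint T with 0 ∈ ρ(T) (`exists_isBoundedInverse_modelOp`).

If 0 ∈ ρ(A₊) ∩ ρ(A₋), let L and P be the inverses of d/dt + A₋ and d/dt + A₊, and let φ be a slowly
varying step from 0 to 1. Then (1 - φ)L + φP is a right inverse of D up to φ'(P - L), which is
small, and up to terms containing (1 - φ)C and φ(C - C₊). These functions vanish at both ends and
have compact values, so a local Rellich argument (`finApprox_mulL2_comp`) makes the corresponding
terms norm limits of finite rank operators. The range is therefore closed of finite codimension; a
mirrored identity on the kernel makes the kernel finite dimensional.

If 0 ∈ σ(A₊) or 0 ∈ σ(A₋), multiply an approximate null vector of that limit operator by a long flat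
bump and translate towards the corresponding end. Both D and D* are small on such functions, since
D* contains -d/dt + 𝐀, and translates far out are almost orthogonal to any finite set. Neither
semi-Fredholm property allows this (`not_semiFredholm_of_approx`). -/

theorem isSymm_iff {T : E →ₗ.[ℂ] E} :
    IsSymm T ↔ ∀ x y x' y', (x, y) ∈ T.graph → (x', y') ∈ T.graph → ⟪y, x'⟫_ℂ = ⟪x, y'⟫_ℂ := by
  constructor
  · intro h x y x' y' h1 h2
    obtain ⟨⟨x, hx⟩, rfl, rfl⟩ := (LinearPMap.mem_graph_iff T).1 h1
    obtain ⟨⟨x', hx'⟩, rfl, rfl⟩ := (LinearPMap.mem_graph_iff T).1 h2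
    exact h ⟨x, hx⟩ ⟨x', hx'⟩
  · intro h x y
    exact h _ _ _ _ (T.mem_graph x) (T.mem_graph y)

theorem mem_graph_addScalar {T : E →ₗ.[ℂ] E} {c : ℂ} {x y : E} :
    (x, y) ∈ (addScalar T c).graph ↔ (x, y - c • x) ∈ T.graph := by
  simp only [LinearPMap.mem_graph_iff]
  constructor
  · rintro ⟨⟨u, hu⟩, rfl, rfl⟩
    refine ⟨⟨u, hu⟩, rfl, ?_⟩
    simp [addScalar]
  · rintro ⟨⟨u, hu⟩, rfl, h⟩
    refine ⟨⟨u, hu⟩, rfl, ?_⟩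
    simp only at h
    have : (addScalar T c) ⟨u, hu⟩ = c • u + T ⟨u, hu⟩ := rfl
    rw [this, h]
    simp

theorem mem_graph_add {S T : E →ₗ.[ℂ] E} {x y : E} :
    (x, y) ∈ (S + T).graph ↔ ∃ a b, (x, a) ∈ S.graph ∧ (x, b) ∈ T.graph ∧ y = a + b := by
  simp only [LinearPMap.mem_graph_iff]
  constructor
  · rintro ⟨⟨u, hu⟩, rfl, rfl⟩
    exact ⟨_, _, ⟨⟨u, hu.1⟩, rfl, rfl⟩, ⟨⟨u, hu.2⟩, rfl, rfl⟩, rfl⟩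
  · rintro ⟨_, _, ⟨⟨u, hu⟩, rfl, rfl⟩, ⟨⟨v, hv⟩, hvu, rfl⟩, rfl⟩
    have hvu : v = u := hvu
    subst hvu
    exact ⟨⟨v, ⟨hu, hv⟩⟩, rfl, rfl⟩

theorem mem_graph_ofBounded {R : E →L[ℂ] E} {x y : E} :
    (x, y) ∈ (ofBounded R).graph ↔ y = R x := by
  simp only [LinearPMap.mem_graph_iff]
  constructor
  · rintro ⟨⟨u, hu⟩, rfl, rfl⟩
    rfl
  · rintro rfl
    exact ⟨⟨x, trivial⟩, rfl, rfl⟩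

theorem isBoundedInverse_iff {T : E →ₗ.[ℂ] E} {R : E →L[ℂ] E} :
    IsBoundedInverse T R ↔ (∀ x, (R x, x) ∈ T.graph) ∧ ∀ x y, (x, y) ∈ T.graph → R y = x := by
  constructor
  · rintro ⟨h1, h2⟩
    refine ⟨fun x => ?_, fun x y h => ?_⟩
    · obtain ⟨h, e⟩ := h1 x
      exact (LinearPMap.mem_graph_iff T).2 ⟨⟨R x, h⟩, rfl, e⟩
    · obtain ⟨u, rfl, rfl⟩ := (LinearPMap.mem_graph_iff T).1 h
      exact h2 u
  · rintro ⟨h1, h2⟩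
    refine ⟨fun x => ?_, fun y => h2 _ _ (T.mem_graph y)⟩
    obtain ⟨u, hu, e⟩ := (LinearPMap.mem_graph_iff T).1 (h1 x)
    have hu : (u : E) = R x := hu
    have e : T u = x := e
    have hm : R x ∈ T.domain := hu ▸ u.2
    have : u = ⟨R x, hm⟩ := Subtype.ext hu
    exact ⟨hm, by rw [← this, e]⟩

theorem IsBoundedInverse.eq {T : E →ₗ.[ℂ] E} {R R' : E →L[ℂ] E} (h : IsBoundedInverse T R)
    (h' : IsBoundedInverse T R') : R = R' := by
  ext x
  exact ((isBoundedInverse_iff.1 h).2 _ _ ((isBoundedInverse_iff.1 h').1 x))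

variable [CompleteSpace E]

theorem isBoundedInverse_boundedInverse {T : E →ₗ.[ℂ] E} (h : ∃ R, IsBoundedInverse T R) :
    IsBoundedInverse T (boundedInverse T) := by
  unfold boundedInverse
  rw [dif_pos h]
  exact h.choose_spec

theorem mem_graph_iff_of_isSelfAdjoint {A : E →ₗ.[ℂ] E} (hA : IsSelfAdjoint A) {x y : E} :
    (x, y) ∈ A.graph ↔ ∀ u v, (u, v) ∈ A.graph → ⟪v, x⟫_ℂ = ⟪u, y⟫_ℂ := by
  have h := A.adjoint_graph_eq_graph_adjoint hA.dense_domain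
  rw [show A† = A from hA] at h
  have h' := Submodule.mem_adjoint_iff A.graph (x, y)
  rw [← h] at h'
  simpa only [sub_eq_zero] using h'

theorem isSymm_of_isSelfAdjoint {A : E →ₗ.[ℂ] E} (hA : IsSelfAdjoint A) : IsSymm A :=
  isSymm_iff.2 fun _ _ _ _ h1 h2 => (mem_graph_iff_of_isSelfAdjoint hA).1 h2 _ _ h1

/-- Symmetry makes ⟪x, y⟫ real, whereas the orthogonality makes it equal to i c ‖x‖². -/
theorem eq_zero_of_im_eq {x y : E} {c : ℝ} (hc : c ≠ 0) (h : ⟪y, x⟫_ℂ = ⟪x, y⟫_ℂ)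
    (h0 : ⟪x, y - (c * Complex.I) • x⟫_ℂ = 0) : x = 0 := by
  rw [inner_sub_right, inner_smul_right, sub_eq_zero] at h0
  have h1 : (⟪x, y⟫_ℂ).im = 0 := by
    have h3 := congrArg Complex.im h
    have h4 := congrArg Complex.im (inner_conj_symm (𝕜 := ℂ) y x)
    rw [Complex.conj_im] at h4
    linarith
  have h2 : ⟪x, x⟫_ℂ = ((‖x‖ ^ 2 : ℝ) : ℂ) := by
    rw [inner_self_eq_norm_sq_to_K]; norm_cast
  rw [h0, h2] at h1
  have h3 : c * ‖x‖ ^ 2 = 0 := by simpa [pow_two] using h1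
  simpa [hc] using h3

/-- A symmetric operator `T` for which `T ± i c` are onto is self-adjoint (with dense domain). -/
theorem isSelfAdjoint_of_surjective {T : E →ₗ.[ℂ] E} (hT : IsSymm T) {c : ℝ} (hc : c ≠ 0)
    (h1 : ∀ w, ∃ x y, (x, y) ∈ T.graph ∧ y - (c * Complex.I) • x = w)
    (h2 : ∀ w, ∃ x y, (x, y) ∈ T.graph ∧ y + (c * Complex.I) • x = w) : IsSelfAdjoint T := by
  rw [isSymm_iff] at hT
  have hd : Dense (T.domain : Set E) := by
    rw [Submodule.dense_iff_topologicalClosure_eq_top, Submodule.topologicalClosure_eq_top_iff,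
      Submodule.eq_bot_iff]
    -- A vector g orthogonal to the domain has the form y - i c x with x in the domain;
    -- orthogonality to x itself forces x = 0, and then y = 0.
    intro g hg
    obtain ⟨x, y, hxy, rfl⟩ := h1 g
    have hx : x = 0 := eq_zero_of_im_eq hc (hT _ _ _ _ hxy hxy)
      ((Submodule.mem_orthogonal _ _).1 hg x (LinearPMap.mem_domain_of_mem_graph hxy))
    subst hx
    have : y = 0 := LinearPMap.graph_fst_eq_zero_snd T hxy rfl
    simp [this]
  refine LinearPMap.eq_of_eq_graph ?_
  change T†.graph = T.graph
  rw [T.adjoint_graph_eq_graph_adjoint hd]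
  ext ⟨x, y⟩
  rw [Submodule.mem_adjoint_iff]
  constructor
  · intro h
    -- For (x, y) in the adjoint graph, take u in dom T with the same image under T - i c. Then x -
    -- u is orthogonal to the range of T + i c, which is everything, so x = u.
    obtain ⟨u, v, huv, e⟩ := h1 (y - (c * Complex.I) • x)
    obtain ⟨p, q, hpq, e'⟩ := h2 (x - u)
    have k1 := h p q hpq
    have k2 := hT _ _ _ _ hpq huv
    have ev : y - v = (c * Complex.I) • (x - u) := by
      rw [smul_sub, sub_eq_sub_iff_sub_eq_sub, ← e]
    have k3 : ⟪q + (c * Complex.I) • p, x - u⟫_ℂ = 0 := by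
      have : ⟪(c * Complex.I) • p, x - u⟫_ℂ = - ⟪p, y - v⟫_ℂ := by
        rw [ev, inner_smul_left, inner_smul_right]
        simp
      rw [inner_add_left, this, inner_sub_right, inner_sub_right, k2]
      simp only at k1
      linear_combination k1
    rw [e', inner_self_eq_zero, sub_eq_zero] at k3
    subst k3
    have : y = v := by simpa [sub_eq_zero] using ev
    rwa [this]
  · intro h a b hab
    rw [sub_eq_zero]
    exact hT _ _ _ _ hab h

/-- A closed operator which is bounded below and has dense range is boundedly invertible. -/
theorem exists_isBoundedInverse {T : E →ₗ.[ℂ] E} (hT : T.IsClosed) {c : ℝ}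
    (hb : ∀ x y, (x, y) ∈ T.graph → ‖x‖ ≤ c * ‖y‖)
    (hr : ∀ w, (∀ x y, (x, y) ∈ T.graph → ⟪y, w⟫_ℂ = 0) → w = 0) :
    ∃ R : E →L[ℂ] E, IsBoundedInverse T R ∧ ∀ x, ‖R x‖ ≤ c * ‖x‖ := by
  have hG : IsClosed (T.graph : Set (E × E)) := hT
  have : CompleteSpace T.graph := hG.completeSpace_coe
  -- The graph is a Banach space in the sup norm, which is why `max c 1` appears. The lower bound
  -- makes the projection to the second coordinate antilipschitz, so its range is closed; being
  -- dense, it is everything.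
  let π : T.graph →L[ℂ] E := (ContinuousLinearMap.snd ℂ E E).comp T.graph.subtypeL
  have hπ : ∀ p : T.graph, ‖p‖ ≤ max c 1 * ‖π p‖ := by
    rintro ⟨⟨x, y⟩, hp⟩
    have h1 := hb x y hp
    change ‖(x, y)‖ ≤ max c 1 * ‖y‖
    rw [Prod.norm_def]
    refine max_le (h1.trans ?_) ?_
    · gcongr; exact le_max_left _ _
    · calc ‖y‖ = 1 * ‖y‖ := (one_mul _).symm
        _ ≤ _ := by gcongr; exact le_max_right _ _
  have hanti : AntilipschitzWith (Real.toNNReal (max c 1)) π :=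
    ContinuousLinearMap.antilipschitz_of_bound π (by
      intro p; rw [Real.coe_toNNReal _ (by positivity)]; exact hπ p)
  have hcl : IsClosed (LinearMap.range (π : T.graph →ₗ[ℂ] E) : Set E) :=
    hanti.isClosed_range π.uniformContinuous
  have htop : LinearMap.range (π : T.graph →ₗ[ℂ] E) = ⊤ := by
    rw [← hcl.submodule_topologicalClosure_eq, Submodule.topologicalClosure_eq_top_iff,
      Submodule.eq_bot_iff]
    intro w hw
    refine hr w fun x y hxy => ?_
    exact (Submodule.mem_orthogonal _ _).1 hw y ⟨⟨(x, y), hxy⟩, rfl⟩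
  let e : T.graph ≃ₗ[ℂ] E := LinearEquiv.ofBijective (π : T.graph →ₗ[ℂ] E)
    ⟨hanti.injective, LinearMap.range_eq_top.1 htop⟩
  have he : ∀ p : T.graph, e p = (p : E × E).2 := fun p => rfl
  have hbd : ∀ x, ‖((LinearMap.fst ℂ E E).comp (T.graph.subtype.comp
      (e.symm : E →ₗ[ℂ] T.graph))) x‖ ≤ c * ‖x‖ := by
    intro x
    have h1 := hb (e.symm x : E × E).1 (e.symm x : E × E).2 (e.symm x).2
    rw [← he, LinearEquiv.apply_symm_apply] at h1
    exact h1
  refine ⟨LinearMap.mkContinuous _ c hbd, isBoundedInverse_iff.2 ⟨fun x => ?_, fun x y h => ?_⟩,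
    hbd⟩
  · change ((e.symm x : E × E).1, x) ∈ T.graph
    have : ((e.symm x : E × E).1, x) = (e.symm x : E × E) := by
      refine Prod.ext rfl ?_
      rw [← he, LinearEquiv.apply_symm_apply]
    rw [this]
    exact (e.symm x).2
  · change (e.symm y : E × E).1 = x
    have : e ⟨(x, y), h⟩ = y := rfl
    rw [← this, LinearEquiv.symm_apply_apply]

theorem isClosed_addScalar {T : E →ₗ.[ℂ] E} (hT : T.IsClosed) (c : ℂ) :
    (addScalar T c).IsClosed := by
  have h : ((addScalar T c).graph : Set (E × E)) = (fun p : E × E => (p.1, p.2 - c • p.1)) ⁻¹'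
      (T.graph : Set (E × E)) := by
    ext ⟨x, y⟩
    exact mem_graph_addScalar
  have hT' : IsClosed (T.graph : Set (E × E)) := hT
  change IsClosed ((addScalar T c).graph : Set (E × E))
  rw [h]
  exact hT'.preimage (by fun_prop)

end Abstract

/-! ### Resolvents of a self-adjoint operator far along the imaginary axis. -/

section Resolvent

variable {E : Type*} [NormedAddCommGroup E] [InnerProductSpace ℂ E] [CompleteSpace E]
variable {A : E →ₗ.[ℂ] E}

/-- Since ⟪x, y⟫ is real, the imaginary part of ⟪x, y - z x⟫ is -Im z ‖x‖²; then apply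
Cauchy–Schwarz. -/
theorem norm_le_of_mem_graph (hA : IsSelfAdjoint A) {z : ℂ} (hz : z.im ≠ 0) {x y : E}
    (h : (x, y) ∈ A.graph) : ‖x‖ ≤ |z.im|⁻¹ * ‖y - z • x‖ := by
  have hs := isSymm_iff.1 (isSymm_of_isSelfAdjoint hA) _ _ _ _ h h
  have h1 : (⟪x, y⟫_ℂ).im = 0 := by
    have h3 := congrArg Complex.im hs
    have h4 := congrArg Complex.im (inner_conj_symm (𝕜 := ℂ) y x)
    rw [Complex.conj_im] at h4
    linarith
  have h2 : ⟪x, x⟫_ℂ = ((‖x‖ ^ 2 : ℝ) : ℂ) := by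
    rw [inner_self_eq_norm_sq_to_K]; norm_cast
  have h3 : (⟪x, y - z • x⟫_ℂ).im = - (z.im * ‖x‖ ^ 2) := by
    rw [inner_sub_right, inner_smul_right, h2, Complex.sub_im, h1, Complex.im_mul_ofReal, zero_sub]
  have h4 : |z.im| * ‖x‖ ^ 2 ≤ ‖x‖ * ‖y - z • x‖ := by
    calc |z.im| * ‖x‖ ^ 2 = |(⟪x, y - z • x⟫_ℂ).im| := by
          rw [h3, abs_neg, abs_mul, abs_of_nonneg (sq_nonneg ‖x‖)]
      _ ≤ ‖⟪x, y - z • x⟫_ℂ‖ := Complex.abs_im_le_norm _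
      _ ≤ _ := norm_inner_le_norm _ _
  have hz' : 0 < |z.im| := abs_pos.2 hz
  rcases eq_or_ne x 0 with rfl | hx
  · simp only [norm_zero]; positivity
  · have hx' : 0 < ‖x‖ := norm_pos_iff.2 hx
    rw [inv_mul_eq_div, le_div_iff₀ hz']
    nlinarith

theorem exists_resolvent (hA : IsSelfAdjoint A) {z : ℂ} (hz : z.im ≠ 0) :
    ∃ R : E →L[ℂ] E, IsBoundedInverse (addScalar A (-z)) R ∧ ∀ x, ‖R x‖ ≤ |z.im|⁻¹ * ‖x‖ := by
  refine exists_isBoundedInverse (isClosed_addScalar hA.isClosed _) ?_ ?_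
  · intro x y h
    have := norm_le_of_mem_graph hA hz (mem_graph_addScalar.1 h)
    simpa using this
  · intro w hw
    -- A vector orthogonal to the range of A - z is an eigenvector of A* = A for the conjugate of z,
    -- which the lower bound excludes.
    have h1 : (w, (starRingEnd ℂ z) • w) ∈ A.graph := by
      rw [mem_graph_iff_of_isSelfAdjoint hA]
      intro u v huv
      have := hw u (v - z • u) (mem_graph_addScalar.2 (by simpa using huv))
      rw [inner_sub_left, inner_smul_left, sub_eq_zero] at this
      rw [this, inner_smul_right]
    have := norm_le_of_mem_graph hA (z := starRingEnd ℂ z) (by simpa using hz) h1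
    simpa using this

theorem isBoundedInverse_resolventOp (hA : IsSelfAdjoint A) {z : ℂ} (hz : z.im ≠ 0) :
    IsBoundedInverse (addScalar A (-z)) (resolventOp A z) := by
  obtain ⟨R, hR, -⟩ := exists_resolvent hA hz
  exact isBoundedInverse_boundedInverse ⟨R, hR⟩

theorem norm_resolventOp_apply_le (hA : IsSelfAdjoint A) {z : ℂ} (hz : z.im ≠ 0) (x : E) :
    ‖resolventOp A z x‖ ≤ |z.im|⁻¹ * ‖x‖ := by
  obtain ⟨R, hR, h⟩ := exists_resolvent hA hz
  rw [(isBoundedInverse_resolventOp hA hz).eq hR]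
  exact h x

theorem resolventOp_mem_graph (hA : IsSelfAdjoint A) {z : ℂ} (hz : z.im ≠ 0) (x : E) :
    (resolventOp A z x, x + z • resolventOp A z x) ∈ A.graph := by
  have := (isBoundedInverse_iff.1 (isBoundedInverse_resolventOp hA hz)).1 x
  simpa using mem_graph_addScalar.1 this

theorem resolventOp_apply (hA : IsSelfAdjoint A) {z : ℂ} (hz : z.im ≠ 0) {x y : E}
    (h : (x, y) ∈ A.graph) : resolventOp A z (y - z • x) = x :=
  (isBoundedInverse_iff.1 (isBoundedInverse_resolventOp hA hz)).2 _ _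
    (mem_graph_addScalar.2 (by simpa using h))

theorem resolventOp_comm_graph (hA : IsSelfAdjoint A) {z : ℂ} (hz : z.im ≠ 0) {x y : E}
    (h : (x, y) ∈ A.graph) : (resolventOp A z x, resolventOp A z y) ∈ A.graph := by
  have h1 := resolventOp_mem_graph hA hz x
  have h2 : resolventOp A z y = x + z • resolventOp A z x := by
    have := resolventOp_apply hA hz h
    rw [map_sub, map_smul, sub_eq_iff_eq_add] at this
    exact this
  rwa [h2]

theorem inner_resolventOp (hA : IsSelfAdjoint A) {z : ℂ} (hz : z.im ≠ 0) (x y : E) :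
    ⟪resolventOp A z x, y⟫_ℂ = ⟪x, resolventOp A (starRingEnd ℂ z) y⟫_ℂ := by
  have h1 := resolventOp_mem_graph hA hz x
  have h2 := resolventOp_mem_graph hA (z := starRingEnd ℂ z) (by simpa using hz) y
  have := isSymm_iff.1 (isSymm_of_isSelfAdjoint hA) _ _ _ _ h1 h2
  rw [inner_add_left, inner_add_right, inner_smul_left, inner_smul_right] at this
  linear_combination - this

/-- The cross term vanishes because ⟪y, x⟫ is real. Comparing the values at μ and at 1 shows that (A
- i)(A - iμ)⁻¹ is a contraction for |μ| ≥ 1. -/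
theorem norm_sq_sub_smul_I (hA : IsSymm A) (μ : ℝ) {x y : E} (h : (x, y) ∈ A.graph) :
    ‖y - ((μ : ℂ) * Complex.I) • x‖ ^ 2 = ‖y‖ ^ 2 + μ ^ 2 * ‖x‖ ^ 2 := by
  have hs := isSymm_iff.1 hA _ _ _ _ h h
  have h1 : (⟪y, x⟫_ℂ).im = 0 := by
    have h3 := congrArg Complex.im hs
    have h4 := congrArg Complex.im (inner_conj_symm (𝕜 := ℂ) y x)
    rw [Complex.conj_im] at h4
    linarith
  rw [@norm_sub_sq ℂ, inner_smul_right, norm_smul]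
  simp [h1, mul_pow]

/-- The operator `(A - i) (A - i μ)⁻¹`. -/
def cayleyOp (A : E →ₗ.[ℂ] E) (μ : ℝ) : E →L[ℂ] E :=
  1 + (((μ : ℂ) - 1) * Complex.I) • resolventOp A (μ * Complex.I)

/-- This moves the shift from i to iμ. The norm of C (A - i)(A - iμ)⁻¹ therefore acts as a relative
bound for C (A - i), at the cost of a multiple |μ| of ‖x‖. -/
theorem cayleyOp_apply (hA : IsSelfAdjoint A) {μ : ℝ} (hμ : μ ≠ 0) {x y : E}
    (h : (x, y) ∈ A.graph) :
    cayleyOp A μ (y - ((μ : ℂ) * Complex.I) • x) = y - Complex.I • x := by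
  have := resolventOp_apply hA (z := μ * Complex.I) (by simpa using hμ) h
  simp only [cayleyOp, add_apply, smul_apply, this,
    one_apply_eq_self]
  module

theorem norm_cayleyOp_apply_le (hA : IsSelfAdjoint A) {μ : ℝ} (hμ : 1 ≤ |μ|) (w : E) :
    ‖cayleyOp A μ w‖ ≤ ‖w‖ := by
  have hμ0 : μ ≠ 0 := by rintro rfl; simp at hμ; linarith
  have h := resolventOp_mem_graph hA (z := μ * Complex.I) (by simpa using hμ0) w
  have h1 := cayleyOp_apply hA hμ0 h
  have h2 := norm_sq_sub_smul_I (isSymm_of_isSelfAdjoint hA) μ h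
  have h3 := norm_sq_sub_smul_I (isSymm_of_isSelfAdjoint hA) 1 h
  rw [add_sub_cancel_right] at h1 h2
  rw [h1]
  have h4 : (1 : ℝ) ≤ μ ^ 2 := by rw [← sq_abs]; nlinarith
  simp only [Complex.ofReal_one, one_mul] at h3
  refine le_of_sq_le_sq ?_ (norm_nonneg _)
  rw [h3, h2]
  nlinarith [sq_nonneg ‖resolventOp A (μ * Complex.I) w‖]

theorem norm_cayleyOp_le (hA : IsSelfAdjoint A) {μ : ℝ} (hμ : 1 ≤ |μ|) : ‖cayleyOp A μ‖ ≤ 1 :=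
  ContinuousLinearMap.opNorm_le_bound _ zero_le_one fun w => by
    rw [one_mul]; exact norm_cayleyOp_apply_le hA hμ w

/-- The bounded approximation `-i μ (A - i μ)⁻¹` of the identity. -/
def yosidaOp (A : E →ₗ.[ℂ] E) (μ : ℝ) : E →L[ℂ] E :=
  (-((μ : ℂ) * Complex.I)) • resolventOp A (μ * Complex.I)

theorem norm_yosidaOp_apply_le (hA : IsSelfAdjoint A) {μ : ℝ} (hμ : μ ≠ 0) (w : E) :
    ‖yosidaOp A μ w‖ ≤ ‖w‖ := by
  have h := norm_resolventOp_apply_le hA (z := μ * Complex.I) (by simpa using hμ) w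
  simp only [yosidaOp, smul_apply, norm_smul]
  simp only [Complex.mul_im, Complex.ofReal_re, Complex.I_im, mul_one, Complex.ofReal_im,
    Complex.I_re, mul_zero, add_zero] at h
  simp only [norm_neg, norm_mul, Complex.norm_real, Real.norm_eq_abs, Complex.norm_I, mul_one]
  have : 0 < |μ| := abs_pos.2 hμ
  calc |μ| * _ ≤ |μ| * (|μ|⁻¹ * ‖w‖) := by gcongr
    _ = ‖w‖ := by field_simp

theorem yosidaOp_apply_sub (hA : IsSelfAdjoint A) {μ : ℝ} (hμ : μ ≠ 0) {x y : E}
    (h : (x, y) ∈ A.graph) : yosidaOp A μ x - x = - resolventOp A (μ * Complex.I) y := by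
  have := resolventOp_apply hA (z := μ * Complex.I) (by simpa using hμ) h
  rw [map_sub, map_smul] at this
  simp only [yosidaOp, smul_apply]
  rw [← sub_eq_zero] at this ⊢
  rw [← this]
  module

theorem tendsto_resolventOp (hA : IsSelfAdjoint A) (w : E) :
    Tendsto (fun μ : ℝ => resolventOp A (μ * Complex.I) w) (Bornology.cobounded ℝ) (𝓝 0) := by
  rw [tendsto_zero_iff_norm_tendsto_zero]
  have h1 : Tendsto (fun μ : ℝ => |μ|⁻¹ * ‖w‖) (Bornology.cobounded ℝ) (𝓝 0) := by
    have := (tendsto_inv_atTop_zero.comp (tendsto_norm_cobounded_atTop (E := ℝ))).mul_const ‖w‖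
    simpa using this
  refine squeeze_zero' (Eventually.of_forall fun _ => norm_nonneg _) ?_ h1
  filter_upwards [(tendsto_norm_cobounded_atTop (E := ℝ)).eventually (eventually_gt_atTop 0)]
    with μ hμ
  have := norm_resolventOp_apply_le hA (z := μ * Complex.I) (by simpa using hμ) w
  simpa using this

/-- On the domain the error is -(A - iμ)⁻¹ applied to A x, which tends to zero; density and the
uniform contraction bound extend this to every vector. -/
theorem tendsto_yosidaOp (hA : IsSelfAdjoint A) (w : E) :
    Tendsto (fun μ : ℝ => yosidaOp A μ w) (Bornology.cobounded ℝ) (𝓝 w) := by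
  have hne : ∀ᶠ μ : ℝ in Bornology.cobounded ℝ, μ ≠ 0 := by
    filter_upwards [(tendsto_norm_cobounded_atTop (E := ℝ)).eventually (eventually_gt_atTop 0)]
      with μ hμ
    simpa using hμ
  rw [Metric.tendsto_nhds]
  intro ε hε
  obtain ⟨x, hx, hxw⟩ := Metric.mem_closure_iff.1 (hA.dense_domain w) (ε / 3) (by positivity)
  obtain ⟨y, hxy⟩ := LinearPMap.mem_domain_iff.1 hx
  have h1 := Metric.tendsto_nhds.1 (tendsto_resolventOp hA y) (ε / 3) (by positivity)
  filter_upwards [h1, hne] with μ hμ hμ0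
  have e : yosidaOp A μ w - w = yosidaOp A μ (w - x) + (yosidaOp A μ x - x) - (w - x) := by
    rw [map_sub]; abel
  rw [dist_eq_norm] at hxw ⊢
  rw [e, yosidaOp_apply_sub hA hμ0 hxy]
  rw [dist_zero_right] at hμ
  calc _ ≤ ‖yosidaOp A μ (w - x)‖ + ‖- resolventOp A (μ * Complex.I) y‖ + ‖w - x‖ :=
        (norm_sub_le _ _).trans (by gcongr; exact norm_add_le _ _)
    _ < ε / 3 + ε / 3 + ε / 3 := by
        rw [norm_neg]
        gcongr
        exact (norm_yosidaOp_apply_le hA hμ0 _).trans_lt hxw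
    _ = ε := by ring

/-- The adjoint is 1 - Y + i (A + iμ)⁻¹ with Y = iμ (A + iμ)⁻¹ the Yosida approximation at -μ, and Y
tends strongly to 1. The convergence to zero is only strong; it becomes norm convergence after
composition with finite rank operators. -/
theorem tendsto_adjoint_cayleyOp (hA : IsSelfAdjoint A) (w : E) :
    Tendsto (fun μ : ℝ => ContinuousLinearMap.adjoint (cayleyOp A μ) w) (Bornology.cobounded ℝ)
      (𝓝 0) := by
  have hneg : Tendsto (fun μ : ℝ => -μ) (Bornology.cobounded ℝ) (Bornology.cobounded ℝ) :=
    tendsto_neg_cobounded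
  have h1 := (tendsto_yosidaOp hA w).comp hneg
  have h2 := (tendsto_resolventOp hA w).comp hneg
  have h3 : Tendsto (fun μ : ℝ => w - yosidaOp A (-μ) w +
      Complex.I • resolventOp A (((-μ : ℝ) : ℂ) * Complex.I) w) (Bornology.cobounded ℝ)
      (𝓝 (w - w + Complex.I • 0)) := (tendsto_const_nhds.sub h1).add (h2.const_smul _)
  rw [sub_self, smul_zero, add_zero] at h3
  refine h3.congr' ?_
  filter_upwards [(tendsto_norm_cobounded_atTop (E := ℝ)).eventually (eventually_gt_atTop 0)]
    with μ hμ
  have hμ0 : μ ≠ 0 := by simpa using hμ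
  refine ext_inner_left ℂ fun v => ?_
  rw [ContinuousLinearMap.adjoint_inner_right]
  have := inner_resolventOp hA (z := μ * Complex.I) (by simpa using hμ0) v w
  simp only [map_mul, Complex.conj_ofReal, Complex.conj_I] at this
  simp only [cayleyOp, yosidaOp, add_apply, smul_apply,
    one_apply_eq_self, inner_add_right, inner_sub_right, inner_smul_right,
    inner_add_left, inner_smul_left, this]
  simp only [map_mul, map_sub, Complex.conj_ofReal, Complex.conj_I, Complex.ofReal_neg, map_one,
    mul_neg, neg_mul, neg_neg]
  ring

end Resolvent

/-! ### Existence of |A|, equality of the domains of |A| and A, and the inverse of |A| + I. -/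

section AbsoluteValue

variable {E : Type*} [NormedAddCommGroup E] [InnerProductSpace ℂ E] [CompleteSpace E]
variable {A : E →ₗ.[ℂ] E}

theorem adjoint_resolventOp (hA : IsSelfAdjoint A) {z : ℂ} (hz : z.im ≠ 0) :
    star (resolventOp A z) = resolventOp A (starRingEnd ℂ z) := by
  ext y
  refine ext_inner_left ℂ fun x => ?_
  rw [ContinuousLinearMap.star_eq_adjoint, ContinuousLinearMap.adjoint_inner_right,
    inner_resolventOp hA hz]

/-- The operator `(A² + 1)⁻¹`. -/
def sqInv (A : E →ₗ.[ℂ] E) : E →L[ℂ] E :=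
  star (resolventOp A (-Complex.I)) * resolventOp A (-Complex.I)

theorem sqInv_apply (hA : IsSelfAdjoint A) (x : E) :
    sqInv A x = resolventOp A Complex.I (resolventOp A (-Complex.I) x) := by
  rw [sqInv, adjoint_resolventOp hA (by simp)]
  simp

theorem sqInv_nonneg : 0 ≤ sqInv A := star_mul_self_nonneg _

theorem inner_sqInv (x : E) : ⟪sqInv A x, x⟫_ℂ = ((‖resolventOp A (-Complex.I) x‖ ^ 2 : ℝ) : ℂ) := by
  rw [sqInv, ContinuousLinearMap.star_eq_adjoint, mul_apply_eq_comp,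
    ContinuousLinearMap.adjoint_inner_left, inner_self_eq_norm_sq_to_K]
  norm_cast

theorem sqInv_le_one (hA : IsSelfAdjoint A) : 0 ≤ 1 - sqInv A := by
  rw [ContinuousLinearMap.nonneg_iff_isPositive, ContinuousLinearMap.isPositive_def]
  refine ⟨(ContinuousLinearMap.isSelfAdjoint_iff_isSymmetric.1
    ((IsSelfAdjoint.one _).sub (IsSelfAdjoint.of_nonneg sqInv_nonneg))), fun x => ?_⟩
  have h := norm_resolventOp_apply_le hA (z := -Complex.I) (by simp) x
  simp only [ContinuousLinearMap.reApplyInnerSelf, sub_apply,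
    one_apply_eq_self, inner_sub_left, inner_sqInv, map_sub]
  rw [inner_self_eq_norm_sq]
  simp only [Complex.neg_im, Complex.I_im, abs_neg, abs_one, inv_one, one_mul] at h
  have : ‖resolventOp A (-Complex.I) x‖ ^ 2 ≤ ‖x‖ ^ 2 := by gcongr
  simpa [← Complex.ofReal_pow] using this

/-- Factor A² + 1 as (A + i)(A - i) and undo the factors one at a time. This turns the unbounded
relation z = A² x into an equation for the bounded operator (A² + 1)⁻¹. -/
theorem mem_graph_sq_iff (hA : IsSelfAdjoint A) {x z : E} :
    (∃ y, (x, y) ∈ A.graph ∧ (y, z) ∈ A.graph) ↔ x = sqInv A (x + z) := by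
  constructor
  · rintro ⟨w, h1, h2⟩
    have h3 := resolventOp_apply hA (z := Complex.I) (by simp) h1
    have h4 : (w - Complex.I • x, z - Complex.I • w) ∈ A.graph :=
      A.graph.sub_mem h2 (A.graph.smul_mem Complex.I h1)
    have h5 := resolventOp_apply hA (z := -Complex.I) (by simp) h4
    rw [sqInv_apply hA]
    have : z - Complex.I • w - -Complex.I • (w - Complex.I • x) = x + z := by
      rw [smul_sub, smul_smul]; simp; abel
    rw [← this, h5, h3]
  · intro h
    rw [sqInv_apply hA] at h
    set u := resolventOp A (-Complex.I) (x + z) with hu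
    have h1 := resolventOp_mem_graph hA (z := Complex.I) (by simp) u
    rw [← h] at h1
    have h2 := resolventOp_mem_graph hA (z := -Complex.I) (by simp) (x + z)
    rw [← hu] at h2
    refine ⟨_, h1, ?_⟩
    have := A.graph.add_mem h2 (A.graph.smul_mem Complex.I h1)
    have e : (u, x + z + -Complex.I • u) + Complex.I • (x, u + Complex.I • x) =
        (u + Complex.I • x, z) := by
      ext
      · simp
      · simp [smul_smul]
    rwa [e] at this

theorem sqInv_injective (hA : IsSelfAdjoint A) {x : E} (hx : sqInv A x = 0) : x = 0 := by
  have h1 := inner_sqInv (A := A) x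
  rw [hx, inner_zero_left] at h1
  have h2 : resolventOp A (-Complex.I) x = 0 := by
    have := Complex.ofReal_eq_zero.1 h1.symm
    simpa using this
  have h3 := resolventOp_mem_graph hA (z := -Complex.I) (by simp) x
  rw [h2, smul_zero, add_zero] at h3
  exact LinearPMap.graph_fst_eq_zero_snd A h3 rfl

/-- Every self-adjoint operator has an absolute value. -/
theorem exists_isAbs (hA : IsSelfAdjoint A) : ∃ S, IsAbs A S := by
  set P := sqInv A with hP
  set Q := CFC.sqrt P with hQ
  set N := CFC.sqrt (1 - P) with hN
  have hQQ : Q * Q = P := CFC.sqrt_mul_sqrt_self P sqInv_nonneg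
  have hNN : N * N = 1 - P := CFC.sqrt_mul_sqrt_self _ (sqInv_le_one hA)
  have hQ0 : 0 ≤ Q := CFC.sqrt_nonneg P
  have hN0 : 0 ≤ N := CFC.sqrt_nonneg _
  have hPN : Commute P N := by
    have : Commute (1 - P) P := (Commute.one_left P).sub_left (Commute.refl P)
    exact (this.cfcₙ_nnreal _).symm
  have hQN : Commute Q N := hPN.cfcₙ_nnreal _
  have sQ : ∀ x y, ⟪Q x, y⟫_ℂ = ⟪x, Q y⟫_ℂ :=
    ContinuousLinearMap.isSelfAdjoint_iff_isSymmetric.1 (IsSelfAdjoint.of_nonneg hQ0)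
  have sN : ∀ x y, ⟪N x, y⟫_ℂ = ⟪x, N y⟫_ℂ :=
    ContinuousLinearMap.isSelfAdjoint_iff_isSymmetric.1 (IsSelfAdjoint.of_nonneg hN0)
  have cQN : ∀ x, Q (N x) = N (Q x) := fun x => DFunLike.congr_fun hQN.eq x
  have eQQ : ∀ x, Q (Q x) = P x := fun x => DFunLike.congr_fun hQQ x
  have eNN : ∀ x, N (N x) = x - P x := fun x => DFunLike.congr_fun hNN x
  have injQ : ∀ x, Q x = 0 → x = 0 := fun x hx => sqInv_injective hA (by
    rw [← hP, ← eQQ, hx, map_zero])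
  -- Formally Q = (A² + 1)^(-1/2) and N = |A| (A² + 1)^(-1/2), so |A| = N Q⁻¹ has the graph of all
  -- pairs (Q v, N v). Only square roots of bounded positive operators are needed.
  let g : Submodule ℂ (E × E) := LinearMap.range ((Q.prod N : E →L[ℂ] E × E) : E →ₗ[ℂ] E × E)
  let S : E →ₗ.[ℂ] E := g.toLinearPMap
  have hS : S.graph = g := by
    refine Submodule.toLinearPMap_graph_eq _ ?_
    rintro _ ⟨x, rfl⟩ hx
    have : x = 0 := injQ x hx
    subst this
    simp
  have mS : ∀ x y, (x, y) ∈ S.graph ↔ ∃ v, Q v = x ∧ N v = y := by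
    intro x y
    rw [hS]
    constructor
    · rintro ⟨v, hv⟩
      exact ⟨v, congrArg Prod.fst hv, congrArg Prod.snd hv⟩
    · rintro ⟨v, rfl, rfl⟩
      exact ⟨v, rfl⟩
  refine ⟨S, ?_, ?_, ?_⟩
  · refine isSelfAdjoint_of_surjective (c := 1) ?_ one_ne_zero ?_ ?_
    · rw [isSymm_iff]
      intro x y x' y' h h'
      obtain ⟨v, rfl, rfl⟩ := (mS _ _).1 h
      obtain ⟨v', rfl, rfl⟩ := (mS _ _).1 h'
      rw [sN, sQ, cQN]
    · intro w
      -- As Q and N commute and Q² + N² = 1, the operator N + iQ inverts N - iQ; the conjugate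
      -- choice serves the other sign.
      refine ⟨_, _, (mS _ _).2 ⟨N w + Complex.I • Q w, rfl, rfl⟩, ?_⟩
      simp only [map_add, map_smul, eQQ, eNN, cQN, Complex.ofReal_one, one_mul, smul_add, smul_smul,
        Complex.I_mul_I]
      module
    · intro w
      refine ⟨_, _, (mS _ _).2 ⟨N w - Complex.I • Q w, rfl, rfl⟩, ?_⟩
      simp only [map_sub, map_smul, eQQ, eNN, cQN, Complex.ofReal_one, one_mul, smul_sub, smul_smul,
        Complex.I_mul_I]
      module
  · rintro x
    obtain ⟨v, hv1, hv2⟩ := (mS _ _).1 (S.mem_graph x)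
    rw [← hv1, ← hv2]
    -- A square root of Q is split off and moved across: ⟪Q v, N v⟫ = ⟪T v, N T v⟫ ≥ 0.
    set T := CFC.sqrt Q
    have hTT : ∀ x, T (T x) = Q x := fun x =>
      DFunLike.congr_fun (CFC.sqrt_mul_sqrt_self Q hQ0) x
    have sT : ∀ x y, ⟪T x, y⟫_ℂ = ⟪x, T y⟫_ℂ :=
      ContinuousLinearMap.isSelfAdjoint_iff_isSymmetric.1
        (IsSelfAdjoint.of_nonneg (CFC.sqrt_nonneg Q))
    have cTN : ∀ x, T (N x) = N (T x) := fun x => DFunLike.congr_fun (hQN.cfcₙ_nnreal _).eq x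
    rw [← hTT, sT, cTN]
    exact ((ContinuousLinearMap.nonneg_iff_isPositive N).1 hN0).re_inner_nonneg_right (T v)
  · refine LinearPMap.eq_of_eq_graph ?_
    rw [show A† = A from hA]
    ext ⟨x, z⟩
    rw [mem_graph_mulOp, mem_graph_mulOp, mem_graph_sq_iff hA, ← hP]
    constructor
    · rintro ⟨w, h1, h2⟩
      obtain ⟨y, rfl, rfl⟩ := (mS _ _).1 h1
      obtain ⟨y', h3, rfl⟩ := (mS _ _).1 h2
      have e1 : y = Q (Q y + N y') := by
        rw [map_add, eQQ, cQN, h3, eNN]; abel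
      rw [← eQQ, ← e1]
    · intro h
      refine ⟨N (Q (x + z)), (mS _ _).2 ⟨Q (x + z), ?_, rfl⟩, (mS _ _).2 ⟨N (x + z), cQN _, ?_⟩⟩
      · rw [eQQ, ← h]
      · rw [eNN, ← h]; abel

/-- On the domain of S² = T² one has ‖S u‖ = ‖T u‖, both squares being ⟪u, S² u⟫. For x in dom S the
Yosida regularizations J x lie in dom S², converge to x, and satisfy S J x = J S x → S x. Hence T J
x is a Cauchy sequence, and closedness of T puts x in dom T. -/
theorem domain_le_of_sq_eq {S T : E →ₗ.[ℂ] E} (hS : IsSelfAdjoint S) (hT : IsSelfAdjoint T)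
    (h : mulOp S S = mulOp T T) : S.domain ≤ T.domain := by
  intro x hx
  obtain ⟨y, hxy⟩ := LinearPMap.mem_domain_iff.1 hx
  let μ : ℕ → ℝ := fun n => n + 1
  have hμ : ∀ n, μ n ≠ 0 := fun n => by positivity
  have hlim : Tendsto μ atTop (Bornology.cobounded ℝ) := by
    rw [tendsto_norm_atTop_iff_cobounded.symm]
    refine tendsto_norm_atTop_atTop.comp ?_
    exact tendsto_atTop_add_const_right _ _ tendsto_natCast_atTop_atTop
  let J : ℕ → E → E := fun n v => yosidaOp S (μ n) (yosidaOp S (-μ n) v)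
  have hJ : ∀ v, Tendsto (fun n => J n v) atTop (𝓝 v) := by
    intro v
    have h1 := (tendsto_yosidaOp hS v).comp hlim
    have h2 := (tendsto_yosidaOp hS v).comp (tendsto_neg_cobounded.comp hlim)
    rw [tendsto_iff_norm_sub_tendsto_zero] at h1 h2 ⊢
    have h3 := h2.add h1
    rw [add_zero] at h3
    refine squeeze_zero (fun _ => norm_nonneg _) (fun n => ?_) h3
    have : J n v - v = yosidaOp S (μ n) (yosidaOp S (-μ n) v - v) +
        (yosidaOp S (μ n) v - v) := by
      simp only [J, map_sub]; abel
    rw [this]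
    exact (norm_add_le _ _).trans (add_le_add (norm_yosidaOp_apply_le hS (hμ n) _) le_rfl)
  have hsmul : ∀ (c : ℂ) {u v : E}, (u, v) ∈ S.graph → (c • u, c • v) ∈ S.graph :=
    fun c u v huv => S.graph.smul_mem c huv
  have hJS : ∀ n, (J n x, J n y) ∈ S.graph := by
    intro n
    have h1 := hsmul (-(((-μ n : ℝ) : ℂ) * Complex.I))
      (resolventOp_comm_graph hS (z := ((-μ n : ℝ) : ℂ) * Complex.I) (by simpa using hμ n) hxy)
    exact hsmul (-((μ n : ℂ) * Complex.I))
      (resolventOp_comm_graph hS (z := (μ n : ℂ) * Complex.I) (by simpa using hμ n) h1)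
  have hJS2 : ∀ n, ∃ q, (J n y, q) ∈ S.graph := by
    intro n
    exact ⟨_, hsmul (-((μ n : ℂ) * Complex.I))
      (resolventOp_mem_graph hS (z := (μ n : ℂ) * Complex.I) (by simpa using hμ n) _)⟩
  have key : ∀ d p q, (d, p) ∈ S.graph → (p, q) ∈ S.graph →
      ∃ p', (d, p') ∈ T.graph ∧ ‖p'‖ = ‖p‖ := by
    intro d p q h1 h2
    have h3 := (mem_graph_mulOp S S d q).2 ⟨p, h1, h2⟩
    rw [h, mem_graph_mulOp] at h3
    obtain ⟨p', h4, h5⟩ := h3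
    refine ⟨p', h4, ?_⟩
    have e1 := isSymm_iff.1 (isSymm_of_isSelfAdjoint hS) _ _ _ _ h1 h2
    have e2 := isSymm_iff.1 (isSymm_of_isSelfAdjoint hT) _ _ _ _ h4 h5
    rw [← e1, inner_self_eq_norm_sq_to_K, inner_self_eq_norm_sq_to_K] at e2
    have e3 : ‖p'‖ ^ 2 = ‖p‖ ^ 2 := by exact_mod_cast e2
    exact (sq_eq_sq₀ (norm_nonneg _) (norm_nonneg _)).1 e3
  have hex : ∀ n, ∃ p', (J n x, p') ∈ T.graph := fun n => by
    obtain ⟨q, hq⟩ := hJS2 n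
    obtain ⟨p', hp', -⟩ := key _ _ _ (hJS n) hq
    exact ⟨p', hp'⟩
  choose p hp using hex
  have hcau : CauchySeq p := by
    have hc := (hJ y).cauchySeq
    rw [Metric.cauchySeq_iff] at hc ⊢
    intro ε hε
    obtain ⟨n0, hn0⟩ := hc ε hε
    refine ⟨n0, fun m hm n hn => ?_⟩
    obtain ⟨q, hq⟩ := hJS2 m
    obtain ⟨q', hq'⟩ := hJS2 n
    obtain ⟨p', hp', he⟩ := key (J m x - J n x) (J m y - J n y) (q - q')
      (S.graph.sub_mem (hJS m) (hJS n)) (S.graph.sub_mem hq hq')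
    have : p' = p m - p n := T.mem_graph_snd_inj hp' (T.graph.sub_mem (hp m) (hp n)) rfl
    rw [dist_eq_norm, ← this, he, ← dist_eq_norm]
    exact hn0 m hm n hn
  obtain ⟨y', hy'⟩ := cauchySeq_tendsto_of_complete hcau
  have hcl : IsClosed (T.graph : Set (E × E)) := hT.isClosed
  have : (x, y') ∈ T.graph := hcl.mem_of_tendsto ((hJ x).prodMk_nhds hy')
    (Eventually.of_forall hp)
  exact LinearPMap.mem_domain_of_mem_graph this

theorem isAbs_absOp (hA : IsSelfAdjoint A) : IsAbs A (absOp A) := by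
  unfold absOp
  rw [dif_pos (exists_isAbs hA)]
  exact (exists_isAbs hA).choose_spec

theorem domain_absOp (hA : IsSelfAdjoint A) : (absOp A).domain = A.domain := by
  obtain ⟨h1, -, h2⟩ := isAbs_absOp hA
  rw [show A† = A from hA] at h2
  exact le_antisymm (domain_le_of_sq_eq h1 hA h2) (domain_le_of_sq_eq hA h1 h2.symm)

/-- Positivity of |A| gives ‖(|A| + 1) x‖ ≥ ‖x‖, and the same bound shows that -1 is not an
eigenvalue, so the range is dense. -/
theorem isBoundedInverse_absInv (hA : IsSelfAdjoint A) :
    IsBoundedInverse (addScalar (absOp A) 1) (absInv A) := by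
  obtain ⟨h1, h2, -⟩ := isAbs_absOp hA
  refine isBoundedInverse_boundedInverse ?_
  have hpos : ∀ x y, (x, y) ∈ (absOp A).graph → 0 ≤ (⟪x, y⟫_ℂ).re := by
    intro x y h
    obtain ⟨u, rfl, rfl⟩ := (LinearPMap.mem_graph_iff _).1 h
    exact h2 u
  have hb : ∀ x y, (x, y) ∈ (absOp A).graph → ‖x‖ ≤ ‖y + x‖ := by
    intro x y h
    have h3 := hpos x y h
    have h4 : ‖y + x‖ ^ 2 = ‖y‖ ^ 2 + 2 * (⟪x, y⟫_ℂ).re + ‖x‖ ^ 2 := by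
      have h5 := congrArg Complex.re (inner_conj_symm (𝕜 := ℂ) y x)
      rw [Complex.conj_re] at h5
      rw [@norm_add_sq ℂ, h5]
      rfl
    refine le_of_sq_le_sq ?_ (norm_nonneg _)
    nlinarith [sq_nonneg ‖y‖]
  obtain ⟨R, hR, -⟩ := exists_isBoundedInverse (c := 1) (isClosed_addScalar h1.isClosed 1)
    (fun x y h => by
      have := hb _ _ (mem_graph_addScalar.1 h)
      simpa using this)
    (fun w hw => by
      have h3 : (w, -w) ∈ (absOp A).graph := by
        rw [mem_graph_iff_of_isSelfAdjoint h1]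
        intro u v huv
        have := hw u (v + u) (mem_graph_addScalar.2 (by simpa using huv))
        rw [inner_add_left] at this
        rw [inner_neg_right]
        linear_combination this
      have := hb _ _ h3
      simpa using this)
  exact ⟨R, hR⟩

end AbsoluteValue

/-! ### Norm limits of finite rank operators, in the role of the compact operators. -/

section FinApprox

variable {E F G : Type*} [NormedAddCommGroup E] [NormedSpace ℂ E]
  [NormedAddCommGroup F] [NormedSpace ℂ F] [NormedAddCommGroup G] [NormedSpace ℂ G]

/-- `T` is a norm limit of bounded operators of finite rank. -/
def FinApprox (T : E →L[ℂ] F) : Prop :=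
  ∀ ε > 0, ∃ S : E →L[ℂ] F, FiniteDimensional ℂ (LinearMap.range (S : E →ₗ[ℂ] F)) ∧ ‖T - S‖ ≤ ε

theorem finApprox_of_finite (S : E →L[ℂ] F)
    (h : FiniteDimensional ℂ (LinearMap.range (S : E →ₗ[ℂ] F))) : FinApprox S :=
  fun ε hε => ⟨S, h, by simpa using hε.le⟩

theorem FinApprox.zero : FinApprox (0 : E →L[ℂ] F) := by
  refine finApprox_of_finite _ ?_
  rw [ContinuousLinearMap.toLinearMap_zero, LinearMap.range_zero]
  infer_instance

theorem FinApprox.add {S T : E →L[ℂ] F} (hS : FinApprox S) (hT : FinApprox T) :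
    FinApprox (S + T) := by
  intro ε hε
  obtain ⟨S', hS', h1⟩ := hS (ε / 2) (by positivity)
  obtain ⟨T', hT', h2⟩ := hT (ε / 2) (by positivity)
  refine ⟨S' + T', ?_, ?_⟩
  · refine Submodule.finiteDimensional_of_le (S₂ := LinearMap.range (S' : E →ₗ[ℂ] F) ⊔
      LinearMap.range (T' : E →ₗ[ℂ] F)) ?_
    rintro _ ⟨x, rfl⟩
    exact Submodule.add_mem_sup ⟨x, rfl⟩ ⟨x, rfl⟩
  · have : S + T - (S' + T') = (S - S') + (T - T') := by abel
    rw [this]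
    exact (norm_add_le _ _).trans (by linarith)

theorem FinApprox.clm_comp {T : E →L[ℂ] F} (hT : FinApprox T) (S : F →L[ℂ] G) :
    FinApprox (S.comp T) := by
  intro ε hε
  obtain ⟨T', hT', h⟩ := hT (ε / (‖S‖ + 1)) (by positivity)
  refine ⟨S.comp T', ?_, ?_⟩
  · have : LinearMap.range ((S.comp T' : E →L[ℂ] G) : E →ₗ[ℂ] G) =
        (LinearMap.range (T' : E →ₗ[ℂ] F)).map (S : F →ₗ[ℂ] G) := by
      rw [← LinearMap.range_comp]; rfl
    rw [this]
    infer_instance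
  · rw [← ContinuousLinearMap.comp_sub]
    calc _ ≤ ‖S‖ * (ε / (‖S‖ + 1)) := (ContinuousLinearMap.opNorm_comp_le _ _).trans (by gcongr)
      _ ≤ (‖S‖ + 1) * (ε / (‖S‖ + 1)) := by gcongr; linarith
      _ = ε := by field_simp

theorem FinApprox.comp_clm {S : F →L[ℂ] G} (hS : FinApprox S) (T : E →L[ℂ] F) :
    FinApprox (S.comp T) := by
  intro ε hε
  obtain ⟨S', hS', h⟩ := hS (ε / (‖T‖ + 1)) (by positivity)
  refine ⟨S'.comp T, ?_, ?_⟩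
  · refine Submodule.finiteDimensional_of_le (S₂ := LinearMap.range (S' : F →ₗ[ℂ] G)) ?_
    rintro _ ⟨x, rfl⟩
    exact ⟨T x, rfl⟩
  · rw [← ContinuousLinearMap.sub_comp]
    calc _ ≤ (ε / (‖T‖ + 1)) * ‖T‖ := (ContinuousLinearMap.opNorm_comp_le _ _).trans (by gcongr)
      _ ≤ (ε / (‖T‖ + 1)) * (‖T‖ + 1) := by gcongr; linarith
      _ = ε := by field_simp

theorem FinApprox.smul {T : E →L[ℂ] F} (hT : FinApprox T) (c : ℂ) : FinApprox (c • T) := by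
  have : c • T = (c • ContinuousLinearMap.id ℂ F).comp T := by ext; simp
  rw [this]
  exact hT.clm_comp _

theorem FinApprox.neg {T : E →L[ℂ] F} (hT : FinApprox T) : FinApprox (-T) := by
  have := hT.smul (-1)
  rwa [neg_one_smul] at this

theorem FinApprox.sub {S T : E →L[ℂ] F} (hS : FinApprox S) (hT : FinApprox T) :
    FinApprox (S - T) := by
  rw [sub_eq_add_neg]
  exact hS.add hT.neg

theorem FinApprox.sum {ι : Type*} (s : Finset ι) {T : ι → E →L[ℂ] F}
    (h : ∀ i ∈ s, FinApprox (T i)) : FinApprox (∑ i ∈ s, T i) := by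
  classical
  induction s using Finset.induction_on with
  | empty => simpa using FinApprox.zero
  | insert i s hi ih =>
    rw [Finset.sum_insert hi]
    exact (h i (Finset.mem_insert_self _ _)).add
      (ih fun j hj => h j (Finset.mem_insert_of_mem hj))

theorem finApprox_of_forall {T : E →L[ℂ] F}
    (h : ∀ ε > 0, ∃ S : E →L[ℂ] F, FinApprox S ∧ ‖T - S‖ ≤ ε) : FinApprox T := by
  intro ε hε
  obtain ⟨S, hS, h1⟩ := h (ε / 2) (by positivity)
  obtain ⟨S', hS', h2⟩ := hS (ε / 2) (by positivity)
  refine ⟨S', hS', ?_⟩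
  have : T - S' = (T - S) + (S - S') := by abel
  rw [this]
  exact (norm_add_le _ _).trans (by linarith)

end FinApprox

/-! ### Trace class operators: domination of the norm and approximation by projections. -/

section TraceClass

variable {H : Type*} [NormedAddCommGroup H] [InnerProductSpace ℂ H] [CompleteSpace H]

theorem norm_le_of_re_inner_le {T : H →L[ℂ] H} {M : ℝ} (hM : 0 ≤ M)
    (h : ∀ g x, (⟪g, T x⟫_ℂ).re ≤ M * ‖g‖ * ‖x‖) : ‖T‖ ≤ M := by
  refine ContinuousLinearMap.opNorm_le_bound _ hM fun x => ?_
  have h1 := h (T x) x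
  have h2 : (⟪T x, T x⟫_ℂ).re = ‖T x‖ * ‖T x‖ := by
    rw [← pow_two]
    exact inner_self_eq_norm_sq (𝕜 := ℂ) (T x)
  rw [h2] at h1
  rcases (norm_nonneg (T x)).eq_or_lt with h0 | h0
  · rw [← h0]; positivity
  · nlinarith

/-- With T = |K|^(1/2), testing the trace on a single unit vector bounds ‖T x‖², and ‖K‖ = ‖T T‖ ≤
‖T‖². -/
theorem ofReal_norm_le_traceNorm (K : H →L[ℂ] H) : ENNReal.ofReal ‖K‖ ≤ traceNorm K := by
  rcases eq_or_ne (traceNorm K) ∞ with htop | htop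
  · rw [htop]; exact le_top
  set T := CFC.sqrt (CFC.abs K) with hT
  have hTT : T * T = CFC.abs K := CFC.sqrt_mul_sqrt_self _ (CFC.abs_nonneg K)
  have sT : ∀ x y, ⟪T x, y⟫_ℂ = ⟪x, T y⟫_ℂ :=
    ContinuousLinearMap.isSelfAdjoint_iff_isSymmetric.1
      (IsSelfAdjoint.of_nonneg (CFC.sqrt_nonneg _))
  have hTn : ∀ x, ‖x‖ = 1 → ‖T x‖ ^ 2 ≤ (traceNorm K).toReal := by
    intro x hx
    have h1 : ENNReal.ofReal (inner ℂ x (CFC.abs K x)).re ≤ traceNorm K := by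
      unfold traceNorm
      refine le_iSup_of_le 1 (le_iSup_of_le (fun _ => x) (le_iSup_of_le ?_ ?_))
      · exact ⟨fun _ => hx, fun i j hij => (hij (Subsingleton.elim _ _)).elim⟩
      · simp
    have h2 : (inner ℂ x (CFC.abs K x)).re = ‖T x‖ ^ 2 := by
      rw [← hTT]
      change (inner ℂ x (T (T x))).re = _
      rw [← sT]
      exact inner_self_eq_norm_sq (𝕜 := ℂ) (T x)
    rw [h2] at h1
    exact (ENNReal.ofReal_le_iff_le_toReal htop).1 h1
  have hT2 : ‖T‖ ^ 2 ≤ (traceNorm K).toReal := by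
    have : ‖T‖ ≤ Real.sqrt (traceNorm K).toReal := by
      refine ContinuousLinearMap.opNorm_le_of_unit_norm (by positivity) fun x hx => ?_
      exact Real.le_sqrt_of_sq_le (hTn x hx)
    calc ‖T‖ ^ 2 ≤ Real.sqrt (traceNorm K).toReal ^ 2 := by gcongr
      _ = _ := Real.sq_sqrt ENNReal.toReal_nonneg
  refine ENNReal.ofReal_le_of_le_toReal ?_
  rw [← CFC.norm_abs, ← hTT]
  calc ‖T * T‖ ≤ ‖T‖ * ‖T‖ := norm_mul_le _ _
    _ = ‖T‖ ^ 2 := (pow_two _).symm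
    _ ≤ _ := hT2

/-- The orthogonal projection onto the span of finitely many vectors of a Hilbert basis. -/
def basisProj {ι : Type*} (b : HilbertBasis ι ℂ H) (s : Finset ι) : H →L[ℂ] H :=
  ∑ i ∈ s, (innerSL ℂ (b i)).smulRight (b i)

variable {ι : Type*} (b : HilbertBasis ι ℂ H)

theorem basisProj_apply (s : Finset ι) (x : H) :
    basisProj b s x = ∑ i ∈ s, ⟪b i, x⟫_ℂ • b i := by
  simp [basisProj]

theorem finite_range_basisProj (s : Finset ι) :
    FiniteDimensional ℂ (LinearMap.range (basisProj b s : H →ₗ[ℂ] H)) := by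
  have h : FiniteDimensional ℂ (Submodule.span ℂ (b '' (s : Set ι))) :=
    FiniteDimensional.span_of_finite ℂ (s.finite_toSet.image b)
  refine Submodule.finiteDimensional_of_le (S₂ := Submodule.span ℂ (b '' (s : Set ι))) ?_
  rintro _ ⟨x, rfl⟩
  change basisProj b s x ∈ _
  rw [basisProj_apply]
  exact Submodule.sum_mem _ fun i hi =>
    Submodule.smul_mem _ _ (Submodule.subset_span ⟨i, hi, rfl⟩)

theorem norm_sub_basisProj_sq (s : Finset ι) (x : H) :
    ‖x - basisProj b s x‖ ^ 2 = ‖x‖ ^ 2 - ∑ i ∈ s, ‖⟪b i, x⟫_ℂ‖ ^ 2 := by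
  set p := basisProj b s x with hp
  have h1 : ∀ j ∈ s, ⟪b j, p⟫_ℂ = ⟪b j, x⟫_ℂ := by
    intro j hj
    rw [hp, basisProj_apply]
    exact b.orthonormal.inner_right_sum (fun i => ⟪b i, x⟫_ℂ) hj
  have h2 : ∀ y, ⟪p, y⟫_ℂ = ∑ i ∈ s, ⟪x, b i⟫_ℂ * ⟪b i, y⟫_ℂ := by
    intro y
    rw [hp, basisProj_apply, sum_inner]
    refine Finset.sum_congr rfl fun i _ => ?_
    rw [inner_smul_left, inner_conj_symm]
  have h3 : ⟪p, x - p⟫_ℂ = 0 := by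
    rw [inner_sub_right, h2 x, h2 p, sub_eq_zero]
    exact Finset.sum_congr rfl fun i hi => by rw [h1 i hi]
  have h4 : ‖p‖ ^ 2 = ∑ i ∈ s, ‖⟪b i, x⟫_ℂ‖ ^ 2 := by
    have h5 : ((‖p‖ ^ 2 : ℝ) : ℂ) = ((∑ i ∈ s, ‖⟪b i, x⟫_ℂ‖ ^ 2 : ℝ) : ℂ) := by
      have h6 : ⟪p, p⟫_ℂ = ((‖p‖ ^ 2 : ℝ) : ℂ) := by
        rw [inner_self_eq_norm_sq_to_K]; norm_cast
      rw [← h6, h2 p]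
      push_cast
      refine Finset.sum_congr rfl fun i hi => ?_
      rw [h1 i hi, ← inner_conj_symm, mul_comm, Complex.mul_conj']
    exact_mod_cast h5
  have h7 : ‖x‖ ^ 2 = ‖p‖ ^ 2 + ‖x - p‖ ^ 2 := by
    have := norm_add_sq_eq_norm_sq_add_norm_sq_of_inner_eq_zero p (x - p) h3
    rw [add_sub_cancel] at this
    nlinarith
  rw [← h4]
  linarith

theorem norm_one_sub_basisProj_le (s : Finset ι) : ‖1 - basisProj b s‖ ≤ 1 := by
  refine ContinuousLinearMap.opNorm_le_bound _ zero_le_one fun x => ?_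
  have h := norm_sub_basisProj_sq b s x
  have h2 : 0 ≤ ∑ i ∈ s, ‖⟪b i, x⟫_ℂ‖ ^ 2 := Finset.sum_nonneg fun _ _ => by positivity
  rw [one_mul]
  refine le_of_sq_le_sq ?_ (norm_nonneg _)
  change ‖x - basisProj b s x‖ ^ 2 ≤ _
  rw [h]
  linarith

theorem star_basisProj (s : Finset ι) : star (basisProj b s) = basisProj b s := by
  ext y
  refine ext_inner_left ℂ fun x => ?_
  rw [ContinuousLinearMap.star_eq_adjoint, ContinuousLinearMap.adjoint_inner_right,
    basisProj_apply, basisProj_apply, sum_inner, inner_sum]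
  refine Finset.sum_congr rfl fun i _ => ?_
  rw [inner_smul_left, inner_smul_right, inner_conj_symm, mul_comm]

/-- The operator T = |K|^(1/2) is Hilbert–Schmidt, since the sum of ‖T bᵢ‖² is at most the trace
norm. By Parseval, the norm of (1 - P) T is at most the square root of the tail of that sum. Taking
adjoints gives T (1 - P), and ‖K x‖ = ‖T T x‖ passes from T to K. -/
theorem tendsto_mul_one_sub_basisProj {K : H →L[ℂ] H} (hK : traceNorm K ≠ ∞) :
    Tendsto (fun s => ‖K * (1 - basisProj b s)‖) atTop (𝓝 0) := by
  set T := CFC.sqrt (CFC.abs K) with hT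
  have hTT : T * T = CFC.abs K := CFC.sqrt_mul_sqrt_self _ (CFC.abs_nonneg K)
  have hTs : IsSelfAdjoint T := IsSelfAdjoint.of_nonneg (CFC.sqrt_nonneg _)
  have sT : ∀ x y, ⟪T x, y⟫_ℂ = ⟪x, T y⟫_ℂ :=
    ContinuousLinearMap.isSelfAdjoint_iff_isSymmetric.1 hTs
  have hsum : ∀ s : Finset ι, ∑ i ∈ s, ‖T (b i)‖ ^ 2 ≤ (traceNorm K).toReal := by
    intro s
    have h1 : ∑ j : Fin s.card, ENNReal.ofReal
        (inner ℂ (b (s.equivFin.symm j)) (CFC.abs K (b (s.equivFin.symm j)))).re ≤ traceNorm K := by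
      unfold traceNorm
      refine le_iSup_of_le s.card (le_iSup_of_le (fun j => b (s.equivFin.symm j))
        (le_iSup_of_le ?_ le_rfl))
      exact b.orthonormal.comp _ (Subtype.val_injective.comp s.equivFin.symm.injective)
    have h2 : ∀ x, (inner ℂ x (CFC.abs K x)).re = ‖T x‖ ^ 2 := by
      intro x
      rw [← hTT]
      change (inner ℂ x (T (T x))).re = _
      rw [← sT]
      exact inner_self_eq_norm_sq (𝕜 := ℂ) (T x)
    simp only [h2] at h1
    rw [Equiv.sum_comp s.equivFin.symm (fun i : s => ENNReal.ofReal (‖T (b i)‖ ^ 2)),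
      Finset.sum_coe_sort s (fun i => ENNReal.ofReal (‖T (b i)‖ ^ 2)),
      ← ENNReal.ofReal_sum_of_nonneg (fun _ _ => by positivity)] at h1
    exact (ENNReal.ofReal_le_iff_le_toReal hK).1 h1
  have hs : Summable fun i => ‖T (b i)‖ ^ 2 :=
    summable_of_sum_le (fun _ => by positivity) hsum
  set a := ∑' i, ‖T (b i)‖ ^ 2 with ha
  have hlim : Tendsto (fun s : Finset ι => a - ∑ i ∈ s, ‖T (b i)‖ ^ 2) atTop (𝓝 0) := by
    have := (tendsto_const_nhds (x := a)).sub hs.hasSum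
    rwa [sub_self] at this
  have hlim2 : Tendsto (fun s : Finset ι => ‖T‖ * Real.sqrt (a - ∑ i ∈ s, ‖T (b i)‖ ^ 2))
      atTop (𝓝 0) := by
    have := (hlim.sqrt).const_mul ‖T‖
    simpa using this
  refine squeeze_zero (fun _ => norm_nonneg _) (fun s => ?_) hlim2
  have key : ‖(1 - basisProj b s) * T‖ ≤ Real.sqrt (a - ∑ i ∈ s, ‖T (b i)‖ ^ 2) := by
    refine ContinuousLinearMap.opNorm_le_bound _ (by positivity) fun x => ?_
    have h1 : HasSum (fun i => ‖⟪b i, T x⟫_ℂ‖ ^ 2) (‖T x‖ ^ 2) := by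
      have h2 := b.hasSum_inner_mul_inner (T x) (T x)
      have h3 := Complex.hasSum_re h2
      have h4 : (⟪T x, T x⟫_ℂ).re = ‖T x‖ ^ 2 := inner_self_eq_norm_sq (𝕜 := ℂ) (T x)
      rw [h4] at h3
      convert h3 using 2 with i
      rw [← inner_conj_symm (T x) (b i), mul_comm, Complex.mul_conj']
      norm_cast
    have h5 := (hs.hasSum.mul_right (‖x‖ ^ 2)).sub h1
    have h6 : ∀ i, 0 ≤ ‖T (b i)‖ ^ 2 * ‖x‖ ^ 2 - ‖⟪b i, T x⟫_ℂ‖ ^ 2 := by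
      intro i
      rw [← sT, sub_nonneg, ← mul_pow]
      gcongr
      exact norm_inner_le_norm _ _
    have h7 := sum_le_hasSum s (fun i _ => h6 i) h5
    rw [Finset.sum_sub_distrib, ← Finset.sum_mul] at h7
    have h8 := norm_sub_basisProj_sq b s (T x)
    have h9 : ‖T x - basisProj b s (T x)‖ ^ 2 ≤ (a - ∑ i ∈ s, ‖T (b i)‖ ^ 2) * ‖x‖ ^ 2 := by
      rw [h8]; linarith
    have h10 := Real.sqrt_le_sqrt h9
    rw [Real.sqrt_sq (norm_nonneg _), Real.sqrt_mul' _ (sq_nonneg _), Real.sqrt_sq (norm_nonneg _)]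
      at h10
    exact h10
  have key2 : ‖T * (1 - basisProj b s)‖ ≤ Real.sqrt (a - ∑ i ∈ s, ‖T (b i)‖ ^ 2) := by
    rw [← norm_star, star_mul, star_sub, star_one, star_basisProj, hTs.star_eq]
    exact key
  have hKn : ∀ x, ‖K x‖ = ‖CFC.abs K x‖ := by
    intro x
    have h1 := CFC.abs_mul_abs K
    have sA : ∀ x y, ⟪CFC.abs K x, y⟫_ℂ = ⟪x, CFC.abs K y⟫_ℂ :=
      ContinuousLinearMap.isSelfAdjoint_iff_isSymmetric.1
        (IsSelfAdjoint.of_nonneg (CFC.abs_nonneg K))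
    have h2 : ⟪CFC.abs K x, CFC.abs K x⟫_ℂ = ⟪K x, K x⟫_ℂ := by
      rw [sA]
      change ⟪x, (CFC.abs K * CFC.abs K) x⟫_ℂ = _
      rw [h1, ContinuousLinearMap.star_eq_adjoint]
      exact ContinuousLinearMap.adjoint_inner_right K x (K x)
    rw [inner_self_eq_norm_sq_to_K, inner_self_eq_norm_sq_to_K] at h2
    have e3 : ‖CFC.abs K x‖ ^ 2 = ‖K x‖ ^ 2 := by exact_mod_cast h2
    exact ((sq_eq_sq₀ (norm_nonneg _) (norm_nonneg _)).1 e3).symm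
  refine (ContinuousLinearMap.opNorm_le_bound _ (by positivity) fun x => ?_)
  change ‖K ((1 - basisProj b s) x)‖ ≤ _
  rw [hKn, ← hTT]
  calc ‖T ((T * (1 - basisProj b s)) x)‖ ≤ ‖T‖ * (‖T * (1 - basisProj b s)‖ * ‖x‖) :=
        (T.le_opNorm _).trans (by gcongr; exact ContinuousLinearMap.le_opNorm _ _)
    _ ≤ _ := by rw [mul_assoc]; gcongr

end TraceClass

/-- Two uses: passing from a complex function to its real part, and from an indefinite integral to a
function whose increments it dominates. -/
theorem absolutelyContinuousOnInterval_of_dist_le {X Y : Type*} [PseudoMetricSpace X]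
    [PseudoMetricSpace Y] {F : ℝ → X} {G : ℝ → Y} {a b C : ℝ} (hC : 0 ≤ C)
    (hG : AbsolutelyContinuousOnInterval G a b)
    (h : ∀ x ∈ Set.uIcc a b, ∀ y ∈ Set.uIcc a b, dist (F x) (F y) ≤ C * dist (G x) (G y)) :
    AbsolutelyContinuousOnInterval F a b := by
  rw [absolutelyContinuousOnInterval_iff] at hG ⊢
  intro ε hε
  obtain ⟨δ, hδ, hE⟩ := hG (ε / (C + 1)) (by positivity)
  refine ⟨δ, hδ, fun E hE1 hE2 => ?_⟩
  have h1 := hE E hE1 hE2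
  calc _ ≤ ∑ i ∈ Finset.range E.1, C * dist (G (E.2 i).1) (G (E.2 i).2) :=
        Finset.sum_le_sum fun i hi => h _ (hE1.1 i hi).1 _ (hE1.1 i hi).2
    _ = C * ∑ i ∈ Finset.range E.1, dist (G (E.2 i).1) (G (E.2 i).2) := (Finset.mul_sum _ _ _).symm
    _ ≤ (C + 1) * ∑ i ∈ Finset.range E.1, dist (G (E.2 i).1) (G (E.2 i).2) := by
        gcongr
        linarith
    _ < (C + 1) * (ε / (C + 1)) := by gcongr
    _ = ε := by field_simp

/-! ### Operator paths whose derivative has integrable trace norm. -/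

section Path

variable {H : Type*} [NormedAddCommGroup H] [InnerProductSpace ℂ H] [CompleteSpace H]
  [TopologicalSpace.SeparableSpace H]

/-- Operator norms of weakly measurable families in a separable Hilbert space are measurable. -/
theorem aemeasurable_norm_of_weak {L : ℝ → H →L[ℂ] H}
    (hL : ∀ g h, AEMeasurable (fun t => ⟪g, L t h⟫_ℂ) volume) :
    AEMeasurable (fun t => ‖L t‖) volume := by
  let d := TopologicalSpace.denseSeq H
  have hd : DenseRange d := TopologicalSpace.denseRange_denseSeq H
  let u : ℕ → H := fun n => ((‖d n‖⁻¹ : ℝ) : ℂ) • d n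
  have hu : ∀ n, ‖u n‖ ≤ 1 := by
    intro n
    simp only [u, norm_smul, Complex.norm_real, norm_inv, norm_norm]
    exact inv_mul_le_one
  -- Separability makes the operator norm a countable supremum of matrix elements, each measurable
  -- by assumption.
  have key : ∀ t, ENNReal.ofReal ‖L t‖ = ⨆ p : ℕ × ℕ, ENNReal.ofReal ‖⟪u p.1, L t (u p.2)⟫_ℂ‖ := by
    intro t
    apply le_antisymm
    · set M := ⨆ p : ℕ × ℕ, ENNReal.ofReal ‖⟪u p.1, L t (u p.2)⟫_ℂ‖ with hM
      rcases eq_or_ne M ∞ with htop | htop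
      · rw [htop]; exact le_top
      have h1 : ∀ i j, ‖⟪d i, L t (d j)⟫_ℂ‖ ≤ M.toReal * ‖d i‖ * ‖d j‖ := by
        intro i j
        have h2 : ENNReal.ofReal ‖⟪u i, L t (u j)⟫_ℂ‖ ≤ M :=
          le_iSup (fun p : ℕ × ℕ => ENNReal.ofReal ‖⟪u p.1, L t (u p.2)⟫_ℂ‖) (i, j)
        rw [ENNReal.ofReal_le_iff_le_toReal htop] at h2
        have h3 : ∀ n, d n = ((‖d n‖ : ℝ) : ℂ) • u n := by
          intro n
          rcases eq_or_ne (d n) 0 with h0 | h0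
          · simp [u, h0]
          · have : ‖d n‖ ≠ 0 := norm_ne_zero_iff.2 h0
            simp only [u, smul_smul]
            rw [← Complex.ofReal_mul, mul_inv_cancel₀ this]
            simp
        rw [h3 i, h3 j, map_smul, inner_smul_left, inner_smul_right, ← h3 i, ← h3 j]
        simp only [norm_mul, Complex.conj_ofReal, Complex.norm_real, norm_norm]
        calc ‖d i‖ * (‖d j‖ * ‖⟪u i, L t (u j)⟫_ℂ‖) ≤ ‖d i‖ * (‖d j‖ * M.toReal) := by gcongr
          _ = _ := by ring
      have h4 : ∀ x y, ‖⟪x, L t y⟫_ℂ‖ ≤ M.toReal * ‖x‖ * ‖y‖ := by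
        intro x y
        refine hd.induction_on₂ (p := fun x y => ‖⟪x, L t y⟫_ℂ‖ ≤ M.toReal * ‖x‖ * ‖y‖) ?_ h1 x y
        exact isClosed_le (by fun_prop) (by fun_prop)
      refine ENNReal.ofReal_le_of_le_toReal ?_
      exact norm_le_of_re_inner_le ENNReal.toReal_nonneg fun g x =>
        (Complex.re_le_norm _).trans (h4 g x)
    · refine iSup_le fun p => ENNReal.ofReal_le_ofReal ?_
      calc _ ≤ ‖u p.1‖ * (‖L t‖ * ‖u p.2‖) :=
            (norm_inner_le_norm _ _).trans (by gcongr; exact (L t).le_opNorm _)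
        _ ≤ 1 * (‖L t‖ * 1) := by gcongr <;> exact hu _
        _ = _ := by ring
  have h1 : AEMeasurable (fun t => ⨆ p : ℕ × ℕ, ENNReal.ofReal ‖⟪u p.1, L t (u p.2)⟫_ℂ‖) volume :=
    AEMeasurable.iSup fun p => (hL _ _).norm.ennreal_ofReal
  have h2 := h1.ennreal_toReal
  refine h2.congr (Eventually.of_forall fun t => ?_)
  simp only
  rw [← key, ENNReal.toReal_ofReal (norm_nonneg _)]

variable {K K' : ℝ → H →L[ℂ] H}

theorem re_inner_path_sub (hac : ∀ g h a b, AbsolutelyContinuousOnInterval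
      (fun t => ⟪g, K t h⟫_ℂ) a b)
    (hd : ∀ g h, ∀ᵐ t, HasDerivAt (fun s => ⟪g, K s h⟫_ℂ) ⟪g, K' t h⟫_ℂ t) (g h : H) (s t : ℝ) :
    ∫ r in s..t, (⟪g, K' r h⟫_ℂ).re = (⟪g, K t h⟫_ℂ).re - (⟪g, K s h⟫_ℂ).re := by
  have h1 : AbsolutelyContinuousOnInterval (fun t => (⟪g, K t h⟫_ℂ).re) s t := by
    refine absolutelyContinuousOnInterval_of_dist_le zero_le_one (hac g h s t) fun x _ y _ => ?_
    rw [one_mul, dist_eq_norm, dist_eq_norm, ← Complex.sub_re]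
    exact Complex.abs_re_le_norm _
  rw [← h1.integral_deriv_eq_sub]
  refine intervalIntegral.integral_congr_ae ?_
  filter_upwards [hd g h] with r hr _
  have := (Complex.reCLM.hasFDerivAt.comp_hasDerivAt r hr).deriv
  exact this.symm

theorem aemeasurable_weak_deriv
    (hd : ∀ g h, ∀ᵐ t, HasDerivAt (fun s => ⟪g, K s h⟫_ℂ) ⟪g, K' t h⟫_ℂ t) (g h : H) :
    AEMeasurable (fun t => ⟪g, K' t h⟫_ℂ) volume := by
  refine (measurable_deriv (fun s => ⟪g, K s h⟫_ℂ)).aemeasurable.congr ?_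
  filter_upwards [hd g h] with t ht
  exact ht.deriv

/-- A weakly absolutely continuous path of operators whose derivative has integrable trace norm. -/
theorem path_of_traceNorm (hac : ∀ g h a b, AbsolutelyContinuousOnInterval
      (fun t => ⟪g, K t h⟫_ℂ) a b)
    (hd : ∀ g h, ∀ᵐ t, HasDerivAt (fun s => ⟪g, K s h⟫_ℂ) ⟪g, K' t h⟫_ℂ t)
    (hbot : ∀ g h, Tendsto (fun t => ⟪g, K t h⟫_ℂ) atBot (𝓝 0))
    (htc : ∀ t, traceNorm (K' t) < ∞) (hint : ∫⁻ t, traceNorm (K' t) < ∞) :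
    Continuous K ∧ Tendsto K atBot (𝓝 0) ∧ (∃ Kp, Tendsto K atTop (𝓝 Kp)) ∧
      (∃ M, ∀ t, ‖K t‖ ≤ M) ∧ ∀ ε > 0, ∃ (w : Set H) (b : HilbertBasis w ℂ H) (s : Finset w),
        ∀ t, ‖K t * (1 - basisProj b s)‖ ≤ ε := by
  have hmeas : ∀ G : H →L[ℂ] H, AEMeasurable (fun t => ‖K' t * G‖) volume := fun G =>
    aemeasurable_norm_of_weak fun g h => aemeasurable_weak_deriv hd g (G h)
  have hint1 : Integrable (fun t => ‖K' t‖) volume := by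
    have h1 := (hmeas 1).aestronglyMeasurable
    simp only [mul_one] at h1
    refine ⟨h1, ?_⟩
    rw [hasFiniteIntegral_iff_norm]
    refine lt_of_le_of_lt (lintegral_mono fun t => ?_) hint
    rw [norm_norm]
    exact ofReal_norm_le_traceNorm _
  have hintG : ∀ G : H →L[ℂ] H, Integrable (fun t => ‖K' t * G‖) volume := fun G => by
    refine (hint1.mul_const ‖G‖).mono' (hmeas G).aestronglyMeasurable
      (Eventually.of_forall fun t => ?_)
    rw [norm_norm]
    exact norm_mul_le _ _
  have hsub : ∀ (G : H →L[ℂ] H) g h s t, |(⟪g, (K t * G) h⟫_ℂ).re - (⟪g, (K s * G) h⟫_ℂ).re| ≤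
      |∫ r in s..t, ‖K' r * G‖| * ‖g‖ * ‖h‖ := by
    intro G g h s t
    have h1 := re_inner_path_sub hac hd g (G h) s t
    have h2 : ‖∫ r in s..t, (⟪g, K' r (G h)⟫_ℂ).re‖ ≤ |∫ r in s..t, ‖K' r * G‖ * (‖g‖ * ‖h‖)| := by
      refine intervalIntegral.norm_integral_le_abs_of_norm_le (Eventually.of_forall fun r => ?_)
        ((hintG G).mul_const _).intervalIntegrable
      calc ‖(⟪g, K' r (G h)⟫_ℂ).re‖ ≤ ‖⟪g, (K' r * G) h⟫_ℂ‖ := Complex.abs_re_le_norm _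
        _ ≤ ‖g‖ * (‖K' r * G‖ * ‖h‖) :=
            (norm_inner_le_norm _ _).trans (by gcongr; exact ContinuousLinearMap.le_opNorm _ _)
        _ = _ := by ring
    rw [h1, intervalIntegral.integral_mul_const, abs_mul, Real.norm_eq_abs,
      abs_of_nonneg (by positivity : 0 ≤ ‖g‖ * ‖h‖)] at h2
    rw [mul_assoc]
    exact h2
  have hdiff : ∀ s t, ‖K t - K s‖ ≤ |∫ r in s..t, ‖K' r‖| := by
    intro s t
    refine norm_le_of_re_inner_le (abs_nonneg _) fun g h => ?_
    have := hsub 1 g h s t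
    simp only [mul_one] at this
    rw [sub_apply, inner_sub_right, Complex.sub_re]
    exact (le_abs_self _).trans this
  -- Let s → -∞ in the increment estimate; the normalization removes the value at s. With G = 1 this
  -- bounds the path, with G = 1 - P it bounds its tail uniformly in t.
  have hbound : ∀ (G : H →L[ℂ] H) t, ‖K t * G‖ ≤ ∫ r in Set.Iic t, ‖K' r * G‖ := by
    intro G t
    refine norm_le_of_re_inner_le (integral_nonneg fun _ => norm_nonneg _) fun g h => ?_
    have h1 : Tendsto (fun s => |∫ r in s..t, ‖K' r * G‖| * ‖g‖ * ‖h‖) atBot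
        (𝓝 (|∫ r in Set.Iic t, ‖K' r * G‖| * ‖g‖ * ‖h‖)) :=
      (((intervalIntegral_tendsto_integral_Iic t (hintG G).integrableOn tendsto_id).abs.mul_const
        _).mul_const _)
    have h2 : Tendsto (fun s => |(⟪g, (K t * G) h⟫_ℂ).re - (⟪g, (K s * G) h⟫_ℂ).re|) atBot
        (𝓝 (|(⟪g, (K t * G) h⟫_ℂ).re - (0 : ℂ).re|)) :=
      (((Complex.continuous_re.tendsto _).comp (hbot g (G h))).const_sub _).abs
    have h3 := le_of_tendsto_of_tendsto' h2 h1 fun s => hsub G g h s t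
    rw [Complex.zero_re, sub_zero, abs_of_nonneg (integral_nonneg fun _ => norm_nonneg _)] at h3
    exact (le_abs_self _).trans h3
  let F : ℝ → ℝ := fun t => ∫ r in Set.Iic t, ‖K' r‖
  have hF : ∀ s t, ‖K t - K s‖ ≤ |F t - F s| := by
    intro s t
    have := intervalIntegral.integral_Iic_sub_Iic (a := s) (b := t) hint1.integrableOn
      hint1.integrableOn
    simp only [F]
    rw [this]
    exact hdiff s t
  have hFc : Continuous F := by
    have : F = fun t => F 0 + ∫ r in (0 : ℝ)..t, ‖K' r‖ := by
      funext t
      have := intervalIntegral.integral_Iic_sub_Iic (a := 0) (b := t) hint1.integrableOn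
        hint1.integrableOn
      simp only [F]
      linarith
    rw [this]
    exact continuous_const.add
      (intervalIntegral.continuous_primitive (fun _ _ => hint1.intervalIntegrable) 0)
  have hFbot : Tendsto F atBot (𝓝 0) := tendsto_integral_Iic_zero tendsto_id
  have hFtop : Tendsto F atTop (𝓝 (∫ r, ‖K' r‖)) :=
    (aecover_Iic tendsto_id).integral_tendsto_of_countably_generated hint1
  refine ⟨?_, ?_, ?_, ⟨∫ r, ‖K' r‖, fun t => ?_⟩, ?_⟩
  · rw [continuous_iff_continuousAt]
    intro s
    rw [ContinuousAt, tendsto_iff_norm_sub_tendsto_zero]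
    have h1 : Tendsto (fun t => |F t - F s|) (𝓝 s) (𝓝 0) := by
      have := ((hFc.tendsto s).sub_const (F s)).abs
      simpa using this
    exact squeeze_zero (fun _ => norm_nonneg _) (fun t => hF s t) h1
  · rw [tendsto_zero_iff_norm_tendsto_zero]
    refine squeeze_zero (fun _ => norm_nonneg _) (fun t => ?_) hFbot
    have := hbound 1 t
    simpa only [mul_one] using this
  · refine cauchy_map_iff_exists_tendsto.1 ?_
    have hc : Cauchy (map F atTop) := hFtop.cauchy_map
    rw [Metric.cauchy_iff] at hc ⊢
    refine ⟨inferInstance, fun ε hε => ?_⟩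
    obtain ⟨t, ht, h2⟩ := hc.2 ε hε
    refine ⟨K '' (F ⁻¹' t), image_mem_map ht, ?_⟩
    rintro _ ⟨x, hx, rfl⟩ _ ⟨y, hy, rfl⟩
    rw [dist_eq_norm]
    refine (hF y x).trans_lt ?_
    have := h2 _ hx _ hy
    rwa [Real.dist_eq] at this
  · have := hbound 1 t
    simp only [mul_one] at this
    exact this.trans (setIntegral_le_integral hint1 (Eventually.of_forall fun _ => norm_nonneg _))
  · intro ε hε
    obtain ⟨w, b, hb⟩ := exists_hilbertBasis ℂ H
    -- Dominated convergence requires a countably generated filter, so the finite subsets of the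
    -- basis must be countable. Orthonormal vectors have distance √2, hence their balls of radius
    -- 1/2 are disjoint open sets.
    have : Countable w := by
      refine Pairwise.countable_of_isOpen_disjoint (s := fun i : w => Metric.ball (b i) (1 / 2))
        ?_ (fun _ => Metric.isOpen_ball) (fun i => ⟨b i, Metric.mem_ball_self (by norm_num)⟩)
      intro i j hij
      refine Metric.ball_disjoint_ball ?_
      have h1 : ‖b i - b j‖ ^ 2 = 2 := by
        rw [@norm_sub_sq ℂ, b.orthonormal.2 hij, b.orthonormal.1 i, b.orthonormal.1 j]
        norm_num
      rw [dist_eq_norm]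
      nlinarith [norm_nonneg (b i - b j)]
    -- The trace class property gives pointwise convergence, and ‖K'‖ dominates. The resulting
    -- projection is the same for all t.
    have hlim : Tendsto (fun s => ∫ r, ‖K' r * (1 - basisProj b s)‖) atTop (𝓝 (∫ _ : ℝ, (0 : ℝ))) := by
      refine tendsto_integral_filter_of_dominated_convergence (fun r => ‖K' r‖)
        (Eventually.of_forall fun s => (hintG _).aestronglyMeasurable)
        (Eventually.of_forall fun s => Eventually.of_forall fun r => ?_) hint1
        (Eventually.of_forall fun r => tendsto_mul_one_sub_basisProj b (htc r).ne)
      rw [norm_norm]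
      calc _ ≤ ‖K' r‖ * ‖1 - basisProj b s‖ := norm_mul_le _ _
        _ ≤ ‖K' r‖ * 1 := by gcongr; exact norm_one_sub_basisProj_le b s
        _ = _ := mul_one _
    rw [integral_zero] at hlim
    obtain ⟨s, hs⟩ := (hlim.eventually (gt_mem_nhds hε)).exists
    refine ⟨w, b, s, fun t => ?_⟩
    refine ((hbound _ t).trans ?_).trans hs.le
    exact setIntegral_le_integral (hintG _) (Eventually.of_forall fun _ => norm_nonneg _)

end Path

/-! ### From the hypotheses to a relatively compact path C(t) = B(t)(A₋ - i)⁻¹. -/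

section Extraction

variable {H : Type*} [NormedAddCommGroup H] [InnerProductSpace ℂ H] [CompleteSpace H]

/-- By the closed graph theorem, `T R` is bounded if `T` is closed and `ran R ⊆ dom T`. -/
theorem exists_bounded_comp {T : H →ₗ.[ℂ] H} (hT : T.IsClosed) (R : H →L[ℂ] H)
    (h : ∀ x, R x ∈ T.domain) : ∃ V : H →L[ℂ] H, ∀ x, (R x, V x) ∈ T.graph := by
  let f : H →ₗ[ℂ] H := T.toFun.comp ((R : H →ₗ[ℂ] H).codRestrict T.domain h)
  have hf : ∀ x, (R x, f x) ∈ T.graph := fun x => T.mem_graph ⟨R x, h x⟩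
  have hG : IsClosed (f.graph : Set (H × H)) := by
    have : (f.graph : Set (H × H)) = (fun p : H × H => (R p.1, p.2)) ⁻¹' (T.graph : Set (H × H)) := by
      ext ⟨x, y⟩
      simp only [SetLike.mem_coe, LinearMap.mem_graph_iff, Set.mem_preimage]
      constructor
      · rintro rfl
        exact hf x
      · intro hxy
        exact T.mem_graph_snd_inj hxy (hf x) rfl
    rw [this]
    have hT' : IsClosed (T.graph : Set (H × H)) := hT
    exact hT'.preimage (by fun_prop)
  exact ⟨ContinuousLinearMap.ofIsClosedGraph hG, hf⟩

theorem absInv_mem_domain {A : H →ₗ.[ℂ] H} (hA : IsSelfAdjoint A) (x : H) :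
    absInv A x ∈ A.domain := by
  have := (isBoundedInverse_iff.1 (isBoundedInverse_absInv hA)).1 x
  rw [← domain_absOp hA]
  exact LinearPMap.mem_domain_of_mem_graph (mem_graph_addScalar.1 this)

/-- The closed graph theorem guarantees that the default value in `toBounded` is not taken, so
`relOp A T` really is T (|A| + I)⁻¹. -/
theorem relOp_mem_graph {A T : H →ₗ.[ℂ] H} (hA : IsSelfAdjoint A) (hT : T.IsClosed)
    (hAT : A.domain ≤ T.domain) (x : H) : (absInv A x, relOp A T x) ∈ T.graph := by
  obtain ⟨V, hV⟩ := exists_bounded_comp hT (absInv A) fun x => hAT (absInv_mem_domain hA x)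
  have h1 : mulOp T (ofBounded (absInv A)) = ofBounded V := by
    refine LinearPMap.eq_of_eq_graph ?_
    ext ⟨x, z⟩
    rw [mem_graph_mulOp, mem_graph_ofBounded]
    simp only [mem_graph_ofBounded, exists_eq_left]
    constructor
    · intro h
      exact T.mem_graph_snd_inj h (hV x) rfl
    · rintro rfl
      exact hV x
  have h2 : ∃ R : H →L[ℂ] H, mulOp T (ofBounded (absInv A)) = ofBounded R := ⟨V, h1⟩
  have h3 : mulOp T (ofBounded (absInv A)) = ofBounded (relOp A T) := by
    unfold relOp toBounded
    rw [dif_pos h2]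
    exact h2.choose_spec
  have h4 : (x, relOp A T x) ∈ (mulOp T (ofBounded (absInv A))).graph := by
    rw [h3, mem_graph_ofBounded]
  rw [mem_graph_mulOp] at h4
  simpa only [mem_graph_ofBounded, exists_eq_left] using h4

/-- The operator `A + C (A - i)`, with domain `dom A`. -/
def pertOp (A : H →ₗ.[ℂ] H) (C : H →L[ℂ] H) : H →ₗ.[ℂ] H where
  domain := A.domain
  toFun := A.toFun + (C : H →ₗ[ℂ] H).comp (A.toFun - Complex.I • A.domain.subtype)

theorem mem_graph_pertOp {A : H →ₗ.[ℂ] H} {C : H →L[ℂ] H} {x z : H} :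
    (x, z) ∈ (pertOp A C).graph ↔ ∃ y, (x, y) ∈ A.graph ∧ z = y + C (y - Complex.I • x) := by
  simp only [LinearPMap.mem_graph_iff]
  constructor
  · rintro ⟨u, rfl, rfl⟩
    exact ⟨_, ⟨u, rfl, rfl⟩, rfl⟩
  · rintro ⟨_, ⟨u, rfl, rfl⟩, rfl⟩
    exact ⟨u, rfl, rfl⟩

/-- A norm continuous path `C` of operators with limits `0` and `Cp` at `∓ ∞`, for which
`C(t) (A - i)` is symmetric on `dom A`, and which is compact relative to `A`, uniformly in `t`. -/
structure RelCompactPath (A : H →ₗ.[ℂ] H) (C : ℝ → H →L[ℂ] H) (Cp : H →L[ℂ] H) : Prop where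
  sa : IsSelfAdjoint A
  symm : ∀ t x y x' y', (x, y) ∈ A.graph → (x', y') ∈ A.graph →
    ⟪C t (y - Complex.I • x), x'⟫_ℂ = ⟪x, C t (y' - Complex.I • x')⟫_ℂ
  cont : Continuous C
  bot : Tendsto C atBot (𝓝 0)
  top : Tendsto C atTop (𝓝 Cp)
  approx : ∀ t, FinApprox (C t)
  unif : ∀ ε > 0, ∀ᶠ μ in Bornology.cobounded ℝ, ∀ t, ‖C t * cayleyOp A μ‖ ≤ ε

variable [TopologicalSpace.SeparableSpace H]

/-- Take C(t) = K(t) V with K(t) = B(t)(|A| + I)⁻¹ and V = (|A| + I)(A - i)⁻¹. All properties of C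
except the uniform relative bound are inherited directly from K and B. -/
theorem RelTraceClassPath.exists_relCompactPath {A : H →ₗ.[ℂ] H} {B B' : ℝ → H →ₗ.[ℂ] H}
    (hyp : RelTraceClassPath A B B') : ∃ C Cp, RelCompactPath A C Cp ∧
      ∀ t, familyOp A B t = pertOp A (C t) := by
  have hA := hyp.selfAdjoint
  obtain ⟨hc, hb, ⟨Kp, ht⟩, ⟨M, hM⟩, hP⟩ := path_of_traceNorm hyp.absCont hyp.deriv
    hyp.tendsto_atBot hyp.traceClass hyp.integrable
  have hM0 : 0 ≤ M := (norm_nonneg _).trans (hM 0)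
  set K : ℝ → H →L[ℂ] H := fun t => relOp A (B t) with hK
  -- V is bounded by the closed graph theorem because |A| and A have the same domain.
  obtain ⟨V, hV⟩ := exists_bounded_comp (T := addScalar (absOp A) 1)
    (isClosed_addScalar (isAbs_absOp hA).1.isClosed 1) (resolventOp A Complex.I) (by
      intro x
      have h1 : resolventOp A Complex.I x ∈ A.domain :=
        LinearPMap.mem_domain_of_mem_graph (resolventOp_mem_graph hA (by simp) x)
      rw [← domain_absOp hA] at h1
      obtain ⟨y, hy⟩ := LinearPMap.mem_domain_iff.1 h1
      exact LinearPMap.mem_domain_of_mem_graph (y := y + resolventOp A Complex.I x)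
        (mem_graph_addScalar.2 (by simpa using hy)))
  have hVA : ∀ x y, (x, y) ∈ A.graph → absInv A (V (y - Complex.I • x)) = x := by
    intro x y h
    have h1 := hV (y - Complex.I • x)
    rw [resolventOp_apply hA (by simp) h] at h1
    exact (isBoundedInverse_iff.1 (isBoundedInverse_absInv hA)).2 _ _ h1
  have hB : ∀ t x y, (x, y) ∈ A.graph → (x, K t (V (y - Complex.I • x))) ∈ (B t).graph := by
    intro t x y h
    have h1 := relOp_mem_graph hA (hyp.closed t) (hyp.domain_le t) (V (y - Complex.I • x))
    rwa [hVA x y h] at h1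
  refine ⟨fun t => K t * V, Kp * V, ⟨hA, ?_, ?_, ?_, ?_, ?_, ?_⟩, ?_⟩
  · intro t x y x' y' h h'
    exact isSymm_iff.1 (hyp.symm t) _ _ _ _ (hB t x y h) (hB t x' y' h')
  · exact hc.mul continuous_const
  · simpa using hb.mul_const V
  · exact ht.mul_const V
  · intro t
    refine FinApprox.comp_clm (finApprox_of_forall fun ε hε => ?_) V
    obtain ⟨w, b, s, hs⟩ := hP ε hε
    refine ⟨(K t).comp (basisProj b s), FinApprox.clm_comp
      (finApprox_of_finite _ (finite_range_basisProj b s)) _, ?_⟩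
    have : K t - (K t).comp (basisProj b s) = K t * (1 - basisProj b s) := by
      rw [mul_sub, mul_one]; rfl
    rw [this]
    exact hs t
  · intro ε hε
    -- Split K V U, with U = (A - i)(A - iμ)⁻¹, by the projection P. The part with 1 - P is at most
    -- ε/2 uniformly in t since ‖U‖ ≤ 1. For the other part, ‖P V U‖ is the norm of U* V* P, a
    -- finite sum of vectors U* V* bᵢ tending to zero.
    obtain ⟨w, b, s, hs⟩ := hP (ε / 2 / (‖V‖ + 1)) (by positivity)
    have hlim : Tendsto (fun μ : ℝ => M * ∑ i ∈ s, ‖ContinuousLinearMap.adjoint (cayleyOp A μ)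
        (ContinuousLinearMap.adjoint V (b i))‖) (Bornology.cobounded ℝ) (𝓝 0) := by
      have h1 := tendsto_finsetSum s fun i _ =>
        (tendsto_adjoint_cayleyOp hA (ContinuousLinearMap.adjoint V (b i))).norm
      have h2 := h1.const_mul M
      simpa using h2
    filter_upwards [hlim.eventually (gt_mem_nhds (half_pos hε)),
      (tendsto_norm_cobounded_atTop (E := ℝ)).eventually (eventually_ge_atTop 1)] with μ hμ hμ1 t
    have hU : ‖cayleyOp A μ‖ ≤ 1 := norm_cayleyOp_le hA hμ1
    have e1 : K t * V * cayleyOp A μ = K t * (1 - basisProj b s) * (V * cayleyOp A μ) +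
        K t * (basisProj b s * (V * cayleyOp A μ)) := by
      noncomm_ring
    have e2 : ‖basisProj b s * (V * cayleyOp A μ)‖ ≤ ∑ i ∈ s,
        ‖ContinuousLinearMap.adjoint (cayleyOp A μ) (ContinuousLinearMap.adjoint V (b i))‖ := by
      rw [← norm_star, star_mul, star_basisProj, star_mul]
      refine ContinuousLinearMap.opNorm_le_bound _ (Finset.sum_nonneg fun _ _ => norm_nonneg _)
        fun x => ?_
      change ‖ContinuousLinearMap.adjoint (cayleyOp A μ) (ContinuousLinearMap.adjoint V
        (basisProj b s x))‖ ≤ _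
      rw [basisProj_apply, map_sum, map_sum, Finset.sum_mul]
      refine norm_sum_le_of_le _ fun i _ => ?_
      rw [map_smul, map_smul, norm_smul, mul_comm]
      gcongr
      calc ‖⟪b i, x⟫_ℂ‖ ≤ ‖b i‖ * ‖x‖ := norm_inner_le_norm _ _
        _ = ‖x‖ := by rw [b.orthonormal.1 i, one_mul]
    change ‖K t * V * cayleyOp A μ‖ ≤ ε
    rw [e1]
    calc _ ≤ ‖K t * (1 - basisProj b s)‖ * (‖V‖ * ‖cayleyOp A μ‖) +
          ‖K t‖ * ‖basisProj b s * (V * cayleyOp A μ)‖ := by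
          refine (norm_add_le _ _).trans (add_le_add ?_ (norm_mul_le _ _))
          exact (norm_mul_le _ _).trans (by gcongr; exact norm_mul_le _ _)
      _ ≤ (ε / 2 / (‖V‖ + 1)) * ((‖V‖ + 1) * 1) + M * ∑ i ∈ s,
        ‖ContinuousLinearMap.adjoint (cayleyOp A μ) (ContinuousLinearMap.adjoint V (b i))‖ := by
          gcongr
          · exact hs t
          · linarith
          · exact hM t
      _ ≤ ε / 2 + ε / 2 := by
          refine add_le_add (le_of_eq ?_) hμ.le
          field_simp
      _ = ε := by ring
  · intro t
    refine LinearPMap.eq_of_eq_graph ?_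
    ext ⟨x, z⟩
    rw [familyOp, mem_graph_add, mem_graph_pertOp]
    constructor
    · rintro ⟨a, c, h1, h2, rfl⟩
      refine ⟨a, h1, ?_⟩
      rw [(B t).mem_graph_snd_inj h2 (hB t x a h1) rfl]
      rfl
    · rintro ⟨y, h1, rfl⟩
      exact ⟨y, _, h1, hB t x y h1, rfl⟩

end Extraction

/-! ### Self-adjointness and norm resolvent convergence of A + C (A - i). -/

section Perturbation

variable {H : Type*} [NormedAddCommGroup H] [InnerProductSpace ℂ H] [CompleteSpace H]

/-- `C (A - i)` is symmetric on `dom A` and has relative bound zero with respect to `A`. -/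
structure RelPert (A : H →ₗ.[ℂ] H) (C : H →L[ℂ] H) : Prop where
  symm : ∀ x y x' y', (x, y) ∈ A.graph → (x', y') ∈ A.graph →
    ⟪C (y - Complex.I • x), x'⟫_ℂ = ⟪x, C (y' - Complex.I • x')⟫_ℂ
  unif : ∀ ε > 0, ∀ᶠ μ in Bornology.cobounded ℝ, ‖C * cayleyOp A μ‖ ≤ ε

variable {A : H →ₗ.[ℂ] H} {C : H →L[ℂ] H}

theorem pertOp_zero : pertOp A 0 = A := by
  refine LinearPMap.eq_of_eq_graph ?_
  ext ⟨x, z⟩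
  rw [mem_graph_pertOp]
  constructor
  · rintro ⟨y, h, rfl⟩
    simpa using h
  · intro h
    exact ⟨z, h, by simp⟩

theorem RelPert.exists_mu (h : RelPert A C) :
    ∃ μ : ℝ, 1 ≤ |μ| ∧ ‖C * cayleyOp A μ‖ ≤ 1 / 2 ∧ ‖C * cayleyOp A (-μ)‖ ≤ 1 / 2 := by
  have h1 := h.unif (1 / 2) (by norm_num)
  have h2 := tendsto_neg_cobounded.eventually h1
  have h3 := (tendsto_norm_cobounded_atTop (E := ℝ)).eventually (eventually_ge_atTop 1)
  obtain ⟨μ, h1, h2, h3⟩ := (h1.and (h2.and h3)).exists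
  exact ⟨μ, h3, h1, h2⟩

/-- The factorization A + C (A - i) - iμ = (1 + C U)(A - iμ), with U = (A - i)(A - iμ)⁻¹, reduces
solvability to a Neumann series. -/
theorem exists_mem_graph_pertOp (hA : IsSelfAdjoint A) {μ : ℝ} (hμ : μ ≠ 0)
    (hC : ‖C * cayleyOp A μ‖ ≤ 1 / 2) (w : H) :
    ∃ x y, (x, y) ∈ (pertOp A C).graph ∧ y - ((μ : ℂ) * Complex.I) • x = w := by
  have hu : IsUnit (1 + C * cayleyOp A μ) := by
    have := isUnit_one_sub_of_norm_lt_one (x := -(C * cayleyOp A μ))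
      (by rw [norm_neg]; linarith)
    rwa [sub_neg_eq_add] at this
  obtain ⟨v, rfl⟩ := ((ContinuousLinearMap.isUnit_iff_bijective).1 hu).2 w
  have h := resolventOp_mem_graph hA (z := μ * Complex.I) (by simpa using hμ) v
  have h1 := cayleyOp_apply hA hμ h
  rw [add_sub_cancel_right] at h1
  refine ⟨_, _, mem_graph_pertOp.2 ⟨_, h, rfl⟩, ?_⟩
  rw [← h1]
  change _ = v + C (cayleyOp A μ v)
  abel

theorem RelPert.isSelfAdjoint (h : RelPert A C) (hA : IsSelfAdjoint A) :
    IsSelfAdjoint (pertOp A C) := by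
  obtain ⟨μ, hμ, h1, h2⟩ := h.exists_mu
  have hμ0 : μ ≠ 0 := by rintro rfl; simp at hμ; linarith
  refine isSelfAdjoint_of_surjective ?_ hμ0 (exists_mem_graph_pertOp hA hμ0 h1) fun w => ?_
  · rw [isSymm_iff]
    intro x z x' z' hx hx'
    obtain ⟨y, hy, rfl⟩ := mem_graph_pertOp.1 hx
    obtain ⟨y', hy', rfl⟩ := mem_graph_pertOp.1 hx'
    rw [inner_add_left, inner_add_right, h.symm _ _ _ _ hy hy',
      isSymm_iff.1 (isSymm_of_isSelfAdjoint hA) _ _ _ _ hy hy']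
  · obtain ⟨x, y, hxy, e⟩ := exists_mem_graph_pertOp hA (neg_ne_zero.2 hμ0) h2 w
    refine ⟨x, y, hxy, ?_⟩
    rw [← e]
    simp

/-- By the second resolvent identity the difference of the resolvents is R(t)(C - D(t)) V, where V =
(A - i)(A + C (A - i) - z)⁻¹ is a fixed bounded operator and self-adjointness gives ‖R(t)‖ ≤ |Im
z|⁻¹. -/
theorem tendsto_resolventOp_pertOp {l : Filter ℝ} {D : ℝ → H →L[ℂ] H}
    (hA : IsSelfAdjoint A) (hD : ∀ t, RelPert A (D t)) (hC : RelPert A C)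
    (hlim : Tendsto D l (𝓝 C)) {z : ℂ} (hz : z.im ≠ 0) :
    Tendsto (fun t => resolventOp (pertOp A (D t)) z) l (𝓝 (resolventOp (pertOp A C) z)) := by
  have hs := hC.isSelfAdjoint hA
  obtain ⟨V, hV⟩ := exists_bounded_comp (T := addScalar A (-Complex.I))
    (isClosed_addScalar hA.isClosed _) (resolventOp (pertOp A C) z) (by
      intro x
      have h1 := LinearPMap.mem_domain_of_mem_graph (resolventOp_mem_graph hs hz x)
      obtain ⟨y, hy⟩ := LinearPMap.mem_domain_iff.1 (show _ ∈ A.domain from h1)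
      exact LinearPMap.mem_domain_of_mem_graph (y := y - Complex.I • resolventOp (pertOp A C) z x)
        (mem_graph_addScalar.2 (by simpa using hy)))
  have key : ∀ t w, resolventOp (pertOp A (D t)) z w - resolventOp (pertOp A C) z w =
      resolventOp (pertOp A (D t)) z ((C - D t) (V w)) := by
    intro t w
    set x := resolventOp (pertOp A C) z w with hx
    have h1 := mem_graph_addScalar.1 (hV w)
    rw [← hx] at h1
    set y := V w - -Complex.I • x with hy
    have hyx : y - Complex.I • x = V w := by rw [hy]; simp
    have h2 : (x, y + C (V w)) ∈ (pertOp A C).graph := mem_graph_pertOp.2 ⟨y, h1, by rw [hyx]⟩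
    have h3 : (x, y + D t (V w)) ∈ (pertOp A (D t)).graph :=
      mem_graph_pertOp.2 ⟨y, h1, by rw [hyx]⟩
    have h4 : w + z • x = y + C (V w) :=
      (pertOp A C).mem_graph_snd_inj (resolventOp_mem_graph hs hz w) h2 rfl
    have h5 := resolventOp_apply ((hD t).isSelfAdjoint hA) hz h3
    have h6 : y + D t (V w) - z • x = w - (C - D t) (V w) := by
      rw [sub_apply, eq_sub_of_add_eq' h4.symm]
      abel
    rw [h6, map_sub] at h5
    rw [← h5]
    abel
  rw [tendsto_iff_norm_sub_tendsto_zero]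
  have hl : Tendsto (fun t => |z.im|⁻¹ * (‖D t - C‖ * ‖V‖)) l (𝓝 0) := by
    have := ((tendsto_iff_norm_sub_tendsto_zero.1 hlim).mul_const ‖V‖).const_mul |z.im|⁻¹
    simpa using this
  refine squeeze_zero (fun _ => norm_nonneg _) (fun t => ?_) hl
  refine ContinuousLinearMap.opNorm_le_bound _ (by positivity) fun w => ?_
  rw [sub_apply, key]
  calc _ ≤ |z.im|⁻¹ * ‖(C - D t) (V w)‖ :=
        norm_resolventOp_apply_le ((hD t).isSelfAdjoint hA) hz _
    _ ≤ |z.im|⁻¹ * (‖D t - C‖ * (‖V‖ * ‖w‖)) := by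
        rw [norm_sub_rev]
        gcongr
        exact (ContinuousLinearMap.le_opNorm _ _).trans (by gcongr; exact V.le_opNorm w)
    _ = _ := by ring

variable {D : ℝ → H →L[ℂ] H} {Cp : H →L[ℂ] H}

theorem RelCompactPath.relPert (h : RelCompactPath A D Cp) (t : ℝ) : RelPert A (D t) :=
  ⟨h.symm t, fun ε hε => (h.unif ε hε).mono fun _ hμ => hμ t⟩

theorem RelCompactPath.norm_limit_le (h : RelCompactPath A D Cp) {ε : ℝ} {μ : ℝ}
    (hμ : ∀ t, ‖D t * cayleyOp A μ‖ ≤ ε) : ‖Cp * cayleyOp A μ‖ ≤ ε :=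
  le_of_tendsto ((h.top.mul_const _).norm) (Eventually.of_forall hμ)

theorem RelCompactPath.relPert_limit (h : RelCompactPath A D Cp) : RelPert A Cp := by
  refine ⟨fun x y x' y' h1 h2 => ?_, fun ε hε => (h.unif ε hε).mono fun μ hμ => h.norm_limit_le hμ⟩
  have h3 : ∀ v, Tendsto (fun t => D t v) atTop (𝓝 (Cp v)) := fun v =>
    ((ContinuousLinearMap.apply ℂ H v).continuous.tendsto _).comp h.top
  refine tendsto_nhds_unique ((h3 (y - Complex.I • x)).inner tendsto_const_nhds)
    ((Tendsto.inner tendsto_const_nhds (h3 (y' - Complex.I • x'))).congr fun t => ?_)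
  exact (h.symm t _ _ _ _ h1 h2).symm

theorem relPert_zero : RelPert A (0 : H →L[ℂ] H) :=
  ⟨by simp, fun ε hε => Eventually.of_forall fun μ => by simpa using hε.le⟩

theorem RelCompactPath.approx_limit (h : RelCompactPath A D Cp) : FinApprox Cp := by
  refine finApprox_of_forall fun ε hε => ?_
  obtain ⟨t, ht⟩ := ((tendsto_iff_norm_sub_tendsto_zero.1 h.top).eventually (gt_mem_nhds hε)).exists
  exact ⟨D t, h.approx t, by rw [norm_sub_rev]; exact ht.le⟩

theorem RelCompactPath.exists_norm_le (h : RelCompactPath A D Cp) : ∃ M, ∀ t, ‖D t‖ ≤ M := by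
  obtain ⟨a, ha⟩ := eventually_atBot.1 (h.bot.norm.eventually
    (gt_mem_nhds (show ‖(0 : H →L[ℂ] H)‖ < ‖(0 : H →L[ℂ] H)‖ + 1 by linarith)))
  obtain ⟨b, hb⟩ := eventually_atTop.1 (h.top.norm.eventually
    (gt_mem_nhds (show ‖Cp‖ < ‖Cp‖ + 1 by linarith)))
  obtain ⟨M, hM⟩ := (isCompact_Icc (a := a) (b := b)).exists_bound_of_continuousOn
    h.cont.continuousOn
  refine ⟨max M (‖Cp‖ + 1), fun t => ?_⟩
  rcases le_total t a with h1 | h1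
  · refine le_max_of_le_right ((ha t h1).le.trans ?_)
    simp
  · rcases le_total t b with h2 | h2
    · exact le_max_of_le_left (hM t ⟨h1, h2⟩)
    · exact le_max_of_le_right (hb t h2).le

end Perturbation

/-! ### Absolutely continuous functions with values in H, and skew-symmetry of d/dt. -/

section Primitive

variable {H : Type*} [NormedAddCommGroup H] [InnerProductSpace ℂ H] [CompleteSpace H]

/-- `u` is a primitive of the locally integrable function `g`. -/
structure IsPrimitive (u g : ℝ → H) : Prop where
  loc : LocallyIntegrable g volume
  eq : ∀ s t : ℝ, u t = u s + ∫ x in s..t, g x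

theorem _root_.MeasureTheory.LocallyIntegrable.intervalIntegrable' {X : Type*}
    [NormedAddCommGroup X] {g : ℝ → X} (h : LocallyIntegrable g volume) (s t : ℝ) :
    IntervalIntegrable g volume s t :=
  (h.integrableOn_isCompact isCompact_uIcc).intervalIntegrable

theorem locallyIntegrable_L2 (g : L2 H) : LocallyIntegrable (fun x => g x) volume :=
  (Lp.memLp g).locallyIntegrable (by norm_num)

variable {u v g k : ℝ → H}

theorem IsPrimitive.continuous (h : IsPrimitive u g) : Continuous u := by
  have : u = fun t => u 0 + ∫ x in (0 : ℝ)..t, g x := funext fun t => h.eq 0 t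
  rw [this]
  exact continuous_const.add
    (intervalIntegral.continuous_primitive (fun a b => h.loc.intervalIntegrable' a b) 0)

theorem IsPrimitive.ae_hasDerivAt (h : IsPrimitive u g) : ∀ᵐ t, HasDerivAt u (g t) t := by
  filter_upwards [LocallyIntegrable.ae_hasDerivAt_integral h.loc] with t ht
  have : u = fun t => u 0 + ∫ x in (0 : ℝ)..t, g x := funext fun t => h.eq 0 t
  rw [this]
  exact (ht 0).const_add (u 0)

theorem IsPrimitive.norm_sub_le (h : IsPrimitive u g) (s t : ℝ) :
    ‖u t - u s‖ ≤ |∫ x in s..t, ‖g x‖| := by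
  rw [h.eq s t, add_sub_cancel_left]
  exact intervalIntegral.norm_integral_le_abs_integral_norm

theorem _root_.MeasureTheory.LocallyIntegrable.norm' {X : Type*}
    [NormedAddCommGroup X] {g : ℝ → X} (h : LocallyIntegrable g volume) :
    LocallyIntegrable (fun x => ‖g x‖) volume := fun x => by
  obtain ⟨s, hs, hi⟩ := h x
  exact ⟨s, hs, hi.norm⟩

theorem inner_re_add_eq (x y : H) (a b : H) :
    (⟪x, y⟫_ℂ).re - (⟪a, b⟫_ℂ).re = (⟪x - a, y⟫_ℂ).re + (⟪a, y - b⟫_ℂ).re := by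
  rw [inner_sub_left, inner_sub_right, Complex.sub_re, Complex.sub_re]; ring

/-- The product rule for the inner product of two absolutely continuous functions. -/
theorem IsPrimitive.integral_re_inner (hu : IsPrimitive u g) (hv : IsPrimitive v k) (s t : ℝ) :
    ∫ x in s..t, ((⟪g x, v x⟫_ℂ).re + (⟪u x, k x⟫_ℂ).re) =
      (⟪u t, v t⟫_ℂ).re - (⟪u s, v s⟫_ℂ).re := by
  obtain ⟨M1, hM1⟩ := (isCompact_uIcc (a := s) (b := t)).exists_bound_of_continuousOn
    hu.continuous.continuousOn
  obtain ⟨M2, hM2⟩ := (isCompact_uIcc (a := s) (b := t)).exists_bound_of_continuousOn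
    hv.continuous.continuousOn
  set M := max (max M1 M2) 0
  -- Increments of the inner product are dominated by M times those of the primitive of ‖g‖ + ‖k‖,
  -- so it is absolutely continuous and the scalar fundamental theorem applies.
  have hloc : LocallyIntegrable (fun x => ‖g x‖ + ‖k x‖) volume := hu.loc.norm'.add hv.loc.norm'
  have hG := (hloc.intervalIntegrable' s t).absolutelyContinuousOnInterval_intervalIntegral
    (c := s) Set.left_mem_uIcc
  have hF : AbsolutelyContinuousOnInterval (fun x => (⟪u x, v x⟫_ℂ).re) s t := by
    refine absolutelyContinuousOnInterval_of_dist_le (C := M) (le_max_right _ _) hG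
      fun x hx y hy => ?_
    rw [Real.dist_eq, Real.dist_eq, inner_re_add_eq, intervalIntegral.integral_interval_sub_left
      (hloc.intervalIntegrable' _ _) (hloc.intervalIntegrable' _ _)]
    have h1 := hu.norm_sub_le y x
    have h2 := hv.norm_sub_le y x
    have h3 : |∫ x in y..x, ‖g x‖| + |∫ x in y..x, ‖k x‖| = |∫ x in y..x, (‖g x‖ + ‖k x‖)| := by
      rw [intervalIntegral.integral_add (hu.loc.norm'.intervalIntegrable' _ _)
        (hv.loc.norm'.intervalIntegrable' _ _)]
      rcases le_total y x with h | h
      · rw [abs_of_nonneg (intervalIntegral.integral_nonneg h fun _ _ => norm_nonneg _),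
          abs_of_nonneg (intervalIntegral.integral_nonneg h fun _ _ => norm_nonneg _),
          abs_of_nonneg (add_nonneg
            (intervalIntegral.integral_nonneg h fun _ _ => norm_nonneg _)
            (intervalIntegral.integral_nonneg h fun _ _ => norm_nonneg _))]
      · rw [intervalIntegral.integral_symm x y, intervalIntegral.integral_symm x y, ← neg_add,
          abs_neg, abs_neg, abs_neg,
          abs_of_nonneg (intervalIntegral.integral_nonneg h fun _ _ => norm_nonneg _),
          abs_of_nonneg (intervalIntegral.integral_nonneg h fun _ _ => norm_nonneg _),
          abs_of_nonneg (add_nonneg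
            (intervalIntegral.integral_nonneg h fun _ _ => norm_nonneg _)
            (intervalIntegral.integral_nonneg h fun _ _ => norm_nonneg _))]
    calc _ ≤ ‖u x - u y‖ * ‖v x‖ + ‖u y‖ * ‖v x - v y‖ := by
          refine (abs_add_le _ _).trans (add_le_add ?_ ?_)
          · exact (Complex.abs_re_le_norm _).trans (norm_inner_le_norm _ _)
          · exact (Complex.abs_re_le_norm _).trans (norm_inner_le_norm _ _)
      _ ≤ |∫ x in y..x, ‖g x‖| * M + M * |∫ x in y..x, ‖k x‖| := by
          have h4 : ‖v x‖ ≤ M := (hM2 x hx).trans ((le_max_right _ _).trans (le_max_left _ _))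
          have h5 : ‖u y‖ ≤ M := (hM1 y hy).trans ((le_max_left _ _).trans (le_max_left _ _))
          gcongr
      _ = _ := by rw [← h3]; ring
  rw [← hF.integral_deriv_eq_sub]
  refine intervalIntegral.integral_congr_ae ?_
  filter_upwards [hu.ae_hasDerivAt, hv.ae_hasDerivAt] with x h1 h2 _
  have h3 := (Complex.reCLM.hasFDerivAt.comp_hasDerivAt x (h1.inner ℂ h2)).deriv
  have h4 : deriv (fun x => (⟪u x, v x⟫_ℂ).re) x = _ := h3
  rw [h4]
  simp [add_comm]

theorem mem_ddtGraph_iff {p : L2 H × L2 H} :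
    p ∈ ddtGraph H ↔ ∃ u : ℝ → H, p.1 =ᵐ[volume] u ∧ IsPrimitive u (fun x => p.2 x) := by
  constructor
  · rintro ⟨u, h1, h2⟩
    exact ⟨u, h1, ⟨locallyIntegrable_L2 _, h2⟩⟩
  · rintro ⟨u, h1, h2⟩
    exact ⟨u, h1, h2.eq⟩

/-- A function with integrable derivative which is itself integrable has derivative of mean zero. -/
theorem integral_eq_zero_of_primitive {F h : ℝ → ℝ} (hF : Integrable F volume)
    (hh : Integrable h volume) (hp : ∀ s t, ∫ x in s..t, h x = F t - F s) : ∫ x, h x = 0 := by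
  have h1 : Tendsto F atTop (𝓝 (F 0 + ∫ x in Set.Ioi 0, h x)) := by
    have := (intervalIntegral_tendsto_integral_Ioi 0 hh.integrableOn tendsto_id).const_add (F 0)
    refine this.congr fun t => ?_
    rw [hp]; simp
  have h2 : Tendsto F atBot (𝓝 (F 0 - ∫ x in Set.Iic 0, h x)) := by
    have := (intervalIntegral_tendsto_integral_Iic 0 hh.integrableOn tendsto_id).const_sub (F 0)
    refine this.congr fun t => ?_
    rw [hp]; simp
  -- Integrability of the derivative makes F converge at both ends; integrability of F itself forces
  -- both limits to be zero.
  have h3 := IntegrableAtFilter.eq_zero_of_tendsto (hF.integrableAtFilter _) (fun s hs => by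
    obtain ⟨b, hb⟩ := mem_atTop_sets.1 hs
    rw [← top_le_iff, ← Real.volume_Ici (a := b)]
    exact measure_mono hb) h1
  have h4 := IntegrableAtFilter.eq_zero_of_tendsto (hF.integrableAtFilter _) (fun s hs => by
    obtain ⟨b, hb⟩ := mem_atBot_sets.1 hs
    rw [← top_le_iff, ← Real.volume_Iic (a := b)]
    exact measure_mono hb) h2
  have h5 := intervalIntegral.integral_Iic_add_Ioi (b := 0) hh.integrableOn hh.integrableOn
  linarith

/-- The integrand is the derivative of the integrable function Re ⟪u, v⟫, so its integral over the
line vanishes. -/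
theorem re_inner_ddt {p q : L2 H × L2 H} (hp : p ∈ ddtGraph H) (hq : q ∈ ddtGraph H) :
    (⟪p.2, q.1⟫_ℂ).re + (⟪p.1, q.2⟫_ℂ).re = 0 := by
  obtain ⟨u, hu1, hu⟩ := mem_ddtGraph_iff.1 hp
  obtain ⟨v, hv1, hv⟩ := mem_ddtGraph_iff.1 hq
  have i1 : Integrable (fun t => (⟪p.1 t, q.1 t⟫_ℂ).re) volume :=
    (L2.integrable_inner (𝕜 := ℂ) p.1 q.1).re
  have i2 : Integrable (fun t => (⟪p.2 t, q.1 t⟫_ℂ).re) volume :=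
    (L2.integrable_inner (𝕜 := ℂ) p.2 q.1).re
  have i3 : Integrable (fun t => (⟪p.1 t, q.2 t⟫_ℂ).re) volume :=
    (L2.integrable_inner (𝕜 := ℂ) p.1 q.2).re
  have e1 : ∀ a b : L2 H, (⟪a, b⟫_ℂ).re = ∫ t, (⟪a t, b t⟫_ℂ).re := by
    intro a b
    rw [L2.inner_def]
    exact (integral_re (L2.integrable_inner (𝕜 := ℂ) a b)).symm
  rw [e1, e1, ← integral_add i2 i3]
  have h1 : (fun t => (⟪u t, v t⟫_ℂ).re) =ᵐ[volume] fun t => (⟪p.1 t, q.1 t⟫_ℂ).re := by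
    filter_upwards [hu1, hv1] with t h1 h2
    rw [h1, h2]
  have h2 : (fun t => (⟪p.2 t, v t⟫_ℂ).re + (⟪u t, q.2 t⟫_ℂ).re) =ᵐ[volume]
      fun t => (⟪p.2 t, q.1 t⟫_ℂ).re + (⟪p.1 t, q.2 t⟫_ℂ).re := by
    filter_upwards [hu1, hv1] with t h1 h2
    rw [h1, h2]
  rw [← integral_congr_ae h2]
  exact integral_eq_zero_of_primitive ((integrable_congr h1).2 i1)
    ((integrable_congr h2).2 (i2.add i3)) fun s t => hu.integral_re_inner hv s t

/-- `d/dt` is skew-symmetric. -/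
theorem inner_ddt {p q : L2 H × L2 H} (hp : p ∈ ddtGraph H) (hq : q ∈ ddtGraph H) :
    ⟪p.2, q.1⟫_ℂ = - ⟪p.1, q.2⟫_ℂ := by
  have h1 := re_inner_ddt hp hq
  -- Replacing p by i p recovers the imaginary part.
  have h2 := re_inner_ddt ((ddtGraph H).smul_mem Complex.I hp) hq
  simp only [Prod.smul_fst, Prod.smul_snd, inner_smul_left, Complex.conj_I] at h2
  apply Complex.ext
  · simp; linarith
  · simp at h2 ⊢; linarith

theorem IsPrimitive.smul_real {φ φ' : ℝ → ℝ} (hφ : ∀ t, HasDerivAt φ (φ' t) t)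
    (hφ' : Continuous φ') (x : H) : IsPrimitive (fun t => φ t • x) (fun t => φ' t • x) := by
  refine ⟨(hφ'.smul continuous_const).locallyIntegrable, fun s t => ?_⟩
  rw [intervalIntegral.integral_smul_const, intervalIntegral.integral_eq_sub_of_hasDerivAt
    (fun x _ => hφ x) (hφ'.intervalIntegrable _ _)]
  module

/-- Product rule for a scalar and a vector valued function. -/
theorem IsPrimitive.smul {φ φ' : ℝ → ℝ} (hφ : ∀ t, HasDerivAt φ (φ' t) t)
    (hφ' : Continuous φ') (hu : IsPrimitive u g) :
    IsPrimitive (fun t => φ t • u t) (fun t => φ' t • u t + φ t • g t) := by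
  have hφc : Continuous φ := continuous_iff_continuousAt.2 fun t => (hφ t).continuousAt
  have hloc : LocallyIntegrable (fun t => φ' t • u t + φ t • g t) volume :=
    (hφ'.smul hu.continuous).locallyIntegrable.add (hu.loc.continuous_smul hφc)
  refine ⟨hloc, fun s t => ?_⟩
  rw [← sub_eq_iff_eq_add']
  set w := φ t • u t - φ s • u s with hw
  set w' := ∫ x in s..t, (φ' x • u x + φ x • g x) with hw'
  -- Tested against a fixed vector x, the assertion is the product rule for inner products applied
  -- to φ x and u.
  have key : ∀ x : H, (⟪x, w⟫_ℂ).re = (⟪x, w'⟫_ℂ).re := by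
    intro x
    have h1 := (IsPrimitive.smul_real hφ hφ' x).integral_re_inner hu s t
    have hi : IntervalIntegrable (fun r => φ' r • u r + φ r • g r) volume s t :=
      hloc.intervalIntegrable' s t
    have h2 : (⟪x, w'⟫_ℂ).re = ∫ r in s..t, (⟪x, φ' r • u r + φ r • g r⟫_ℂ).re := by
      have := ((Complex.reCLM).comp ((innerSL ℂ x).restrictScalars ℝ)).intervalIntegral_comp_comm hi
      exact this.symm
    have hsm : ∀ (c : ℝ) (y : H), c • y = (c : ℂ) • y := fun c y => (Complex.coe_smul c y).symm
    rw [h2, hw, inner_sub_right, Complex.sub_re]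
    simp only [hsm, inner_smul_left, inner_smul_right, Complex.conj_ofReal, inner_add_right,
      Complex.add_re] at h1 ⊢
    exact h1.symm
  have h3 := key (w - w')
  rw [← sub_eq_zero, ← Complex.sub_re, ← inner_sub_right] at h3
  have h4 : (⟪w - w', w - w'⟫_ℂ).re = ‖w - w'‖ ^ 2 := inner_self_eq_norm_sq (𝕜 := ℂ) _
  rw [h4] at h3
  simpa [sub_eq_zero] using h3

theorem smul_mem_ddtGraph {φ φ' : ℝ → ℝ} (hφ : ∀ t, HasDerivAt φ (φ' t) t)
    (hφ' : Continuous φ') {p q : L2 H × L2 H} (hp : p ∈ ddtGraph H)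
    (h1 : q.1 =ᵐ[volume] fun t => φ t • p.1 t)
    (h2 : q.2 =ᵐ[volume] fun t => φ' t • p.1 t + φ t • p.2 t) : q ∈ ddtGraph H := by
  obtain ⟨u, hu1, hu⟩ := mem_ddtGraph_iff.1 hp
  refine ⟨fun t => φ t • u t, ?_, fun s t => ?_⟩
  · filter_upwards [h1, hu1] with t e1 e2
    rw [e1, e2]
  · have h3 := (hu.smul hφ hφ').eq s t
    refine h3.trans ?_
    congr 1
    refine intervalIntegral.integral_congr_ae ?_
    filter_upwards [h2, hu1] with x e1 e2 _
    rw [e1, e2]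

theorem clm_mem_ddtGraph (T : H →L[ℂ] H) {p q : L2 H × L2 H} (hp : p ∈ ddtGraph H)
    (h1 : q.1 =ᵐ[volume] fun t => T (p.1 t)) (h2 : q.2 =ᵐ[volume] fun t => T (p.2 t)) :
    q ∈ ddtGraph H := by
  obtain ⟨u, hu1, hu⟩ := mem_ddtGraph_iff.1 hp
  refine ⟨fun t => T (u t), ?_, fun s t => ?_⟩
  · filter_upwards [h1, hu1] with t e1 e2
    rw [e1, e2]
  · change T (u t) = T (u s) + _
    rw [hu.eq s t, map_add]
    congr 1
    have h3 := T.intervalIntegral_comp_comm (hu.loc.intervalIntegrable' s t)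
    rw [← h3]
    refine intervalIntegral.integral_congr_ae ?_
    filter_upwards [h2] with x e1 _
    rw [e1]

/-- Integrals of square integrable functions over sets of finite measure. -/
theorem norm_setIntegral_L2_le (g : L2 H) {S : Set ℝ} (hS : MeasurableSet S)
    (hfin : volume S ≠ ∞) : ‖∫ x in S, g x‖ ≤ Real.sqrt (volume.real S) * ‖g‖ := by
  set w := ∫ x in S, g x with hw
  -- Pairing the integral w with itself equals pairing g with the indicator of S times w, so
  -- Cauchy–Schwarz in L² gives the square root of the measure.
  have h1 := L2.inner_indicatorConstLp_eq_inner_setIntegral ℂ hS hfin w g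
  have h2 : ‖w‖ * ‖w‖ ≤ ‖w‖ * (Real.sqrt (volume.real S) * ‖g‖) := by
    have h3 : (⟪w, w⟫_ℂ).re = ‖w‖ * ‖w‖ := inner_self_eq_norm_mul_norm (𝕜 := ℂ) _
    rw [← h3, hw, ← hw, ← h1]
    refine (Complex.re_le_norm _).trans ((norm_inner_le_norm _ _).trans_eq ?_)
    rw [norm_indicatorConstLp (by norm_num) (by norm_num), Real.sqrt_eq_rpow]
    simp; ring
  rcases (norm_nonneg w).eq_or_lt with h | h
  · rw [← h]; positivity
  · exact le_of_mul_le_mul_left h2 h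

/-- Hölder continuity of functions with derivative in `L²`. -/
theorem norm_sub_le_of_primitive {p : L2 H} {u : ℝ → H}
    (hu : IsPrimitive u (fun x => p x)) (s t : ℝ) :
    ‖u t - u s‖ ≤ Real.sqrt |t - s| * ‖p‖ := by
  rw [hu.eq s t, add_sub_cancel_left, intervalIntegral.norm_intervalIntegral_eq]
  refine (norm_setIntegral_L2_le p measurableSet_uIoc (by simp [Set.uIoc])).trans_eq ?_
  simp [Set.uIoc, max_sub_min_eq_abs]

end Primitive

/-! ### Weak derivatives, closedness of d/dt and density of tensor products. -/

section TestFunctions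

variable {H : Type*} [NormedAddCommGroup H] [InnerProductSpace ℂ H] [CompleteSpace H]

theorem exists_primitive_of_integral_eq_zero {θ : ℝ → ℝ} (hθ : Continuous θ)
    (hc : HasCompactSupport θ) (h0 : ∫ t, θ t = 0) :
    ∃ η : ℝ → ℝ, HasCompactSupport η ∧ ∀ t, HasDerivAt η (θ t) t := by
  obtain ⟨R, hR⟩ := hc.isCompact.isBounded.subset_closedBall 0
  have hz : ∀ t, R < |t| → θ t = 0 := by
    intro t ht
    by_contra h
    have := hR (subset_tsupport θ h)
    rw [Metric.mem_closedBall, dist_zero_right, Real.norm_eq_abs] at this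
    linarith
  have hsupp : Function.support θ ⊆ Set.Ioc (-(|R| + 1)) (|R| + 1) := by
    intro t ht
    by_contra h
    refine ht (hz t ?_)
    rw [Set.mem_Ioc, not_and_or, not_lt, not_le] at h
    have := le_abs_self R
    rcases h with h | h
    · have := neg_le_abs t; linarith
    · have := le_abs_self t; linarith
  refine ⟨fun t => ∫ x in (-(|R| + 1))..t, θ x, ?_, fun t =>
    hθ.integral_hasStrictDerivAt _ t |>.hasDerivAt⟩
  refine HasCompactSupport.intro (isCompact_Icc (a := -(|R| + 1)) (b := |R| + 1)) fun t ht => ?_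
  have hRR := le_abs_self R
  rw [Set.mem_Icc, not_and_or, not_le, not_le] at ht
  rcases ht with h | h
  · rw [intervalIntegral.integral_symm, neg_eq_zero]
    refine intervalIntegral.integral_zero_ae (Eventually.of_forall fun x hx => hz x ?_)
    rw [Set.uIoc_of_le h.le] at hx
    have := neg_le_abs x
    linarith [hx.2]
  · rw [← h0, ← intervalIntegral.integral_eq_integral_of_support_subset hsupp,
      ← sub_eq_zero, intervalIntegral.integral_interval_sub_left
        (hθ.intervalIntegrable _ _) (hθ.intervalIntegrable _ _)]
    refine intervalIntegral.integral_zero_ae (Eventually.of_forall fun x hx => hz x ?_)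
    rw [Set.uIoc_of_le h.le] at hx
    have := le_abs_self x
    linarith [hx.1]

theorem memLp_tensor {φ : ℝ → ℝ} (hφ : Continuous φ) (hc : HasCompactSupport φ) (x : H) :
    MemLp (fun t => φ t • x) 2 (volume : Measure ℝ) :=
  Continuous.memLp_of_hasCompactSupport (hφ.smul continuous_const) hc.smul_right

theorem inner_tensor {φ : ℝ → ℝ} (hφ : Continuous φ) (hc : HasCompactSupport φ) (x : H)
    (g : L2 H) : ⟪(memLp_tensor hφ hc x).toLp, g⟫_ℂ = ⟪x, ∫ t, φ t • g t⟫_ℂ := by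
  rw [L2.inner_def, ← integral_inner
    ((locallyIntegrable_L2 g).integrable_smul_left_of_hasCompactSupport hφ hc)]
  refine integral_congr_ae ?_
  filter_upwards [(memLp_tensor hφ hc x).coeFn_toLp] with t ht
  rw [ht, ← Complex.coe_smul, ← Complex.coe_smul, inner_smul_left, inner_smul_right,
    Complex.conj_ofReal]

theorem tensor_mem_ddtGraph {η θ : ℝ → ℝ} (hη : ∀ t, HasDerivAt η (θ t) t) (hθ : Continuous θ)
    (hηc : HasCompactSupport η) (hθc : HasCompactSupport θ) (hη' : Continuous η) (x : H) :
    ((memLp_tensor hη' hηc x).toLp, (memLp_tensor hθ hθc x).toLp) ∈ ddtGraph H := by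
  refine ⟨fun t => η t • x, MemLp.coeFn_toLp (memLp_tensor hη' hηc x), fun s t => ?_⟩
  refine ((IsPrimitive.smul_real hη hθ x).eq s t).trans ?_
  congr 1
  refine intervalIntegral.integral_congr_ae ?_
  filter_upwards [(memLp_tensor hθ hθc x).coeFn_toLp] with t ht _
  rw [ht]

/-- Integration by parts against a compactly supported function. -/
theorem IsPrimitive.integral_smul_add {v g : ℝ → H} (hv : IsPrimitive v g) {η θ : ℝ → ℝ}
    (hη : ∀ t, HasDerivAt η (θ t) t) (hθ : Continuous θ)
    (hηc : HasCompactSupport η) (hθc : HasCompactSupport θ) :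
    (∫ t, θ t • v t) + ∫ t, η t • g t = 0 := by
  have hη' : Continuous η := continuous_iff_continuousAt.2 fun t => (hη t).continuousAt
  have i1 : Integrable (fun t => θ t • v t) volume :=
    hv.continuous.locallyIntegrable.integrable_smul_left_of_hasCompactSupport hθ hθc
  have i2 : Integrable (fun t => η t • g t) volume :=
    hv.loc.integrable_smul_left_of_hasCompactSupport hη' hηc
  rw [← integral_add i1 i2]
  obtain ⟨R, hR⟩ := (hηc.isCompact.union hθc.isCompact).isBounded.subset_closedBall 0
  have hz : ∀ t, R < |t| → η t = 0 ∧ θ t = 0 := by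
    intro t ht
    by_contra h
    rw [not_and_or] at h
    have : t ∈ tsupport η ∪ tsupport θ :=
      h.imp (fun h => subset_tsupport η h) (fun h => subset_tsupport θ h)
    have := hR this
    rw [Metric.mem_closedBall, dist_zero_right, Real.norm_eq_abs] at this
    linarith
  have hRR := le_abs_self R
  have hsupp : Function.support (fun t => θ t • v t + η t • g t) ⊆
      Set.Ioc (-(|R| + 1)) (|R| + 1) := by
    intro t ht
    by_contra h
    refine ht ?_
    have : R < |t| := by
      rw [Set.mem_Ioc, not_and_or, not_lt, not_le] at h
      rcases h with h | h
      · have := neg_le_abs t; linarith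
      · have := le_abs_self t; linarith
    simp [hz t this]
  rw [← intervalIntegral.integral_eq_integral_of_support_subset hsupp]
  have h1 := (hv.smul hη hθ).eq (-(|R| + 1)) (|R| + 1)
  have e1 : η (-(|R| + 1)) = 0 := (hz _ (by rw [abs_neg]; linarith [le_abs_self (|R| + 1)])).1
  have e2 : η (|R| + 1) = 0 := (hz _ (by linarith [le_abs_self (|R| + 1)])).1
  rw [e1, e2, zero_smul, zero_smul, zero_add] at h1
  exact h1.symm

/-- The lemma of du Bois-Reymond: `d/dt` is maximal among its weak extensions. -/
theorem mem_ddtGraph_of_weak {g h : L2 H}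
    (hw : ∀ p ∈ ddtGraph H, ⟪p.2, g⟫_ℂ = - ⟪p.1, h⟫_ℂ) : (g, h) ∈ ddtGraph H := by
  set v : ℝ → H := fun t => ∫ x in (0 : ℝ)..t, h x with hv
  have hvp : IsPrimitive v (fun x => h x) := by
    refine ⟨locallyIntegrable_L2 h, fun s t => ?_⟩
    rw [hv]
    exact (intervalIntegral.integral_add_adjacent_intervals (intervalIntegrable_L2 h 0 s)
      (intervalIntegrable_L2 h s t)).symm
  have hgv : LocallyIntegrable (fun t => g t - v t) volume :=
    (locallyIntegrable_L2 g).sub hvp.continuous.locallyIntegrable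
  -- With v the primitive of h, the function g - v is annihilated by every derivative of a test
  -- function, that is, by every test function of mean zero.
  have key : ∀ θ : ℝ → ℝ, Continuous θ → HasCompactSupport θ → ∫ t, θ t = 0 →
      ∫ t, θ t • (g t - v t) = 0 := by
    intro θ hθ hθc h0
    obtain ⟨η, hηc, hη⟩ := exists_primitive_of_integral_eq_zero hθ hθc h0
    have hη' : Continuous η := continuous_iff_continuousAt.2 fun t => (hη t).continuousAt
    have h1 : ∀ x : H, ⟪x, (∫ t, θ t • g t) + ∫ t, η t • h t⟫_ℂ = 0 := by
      intro x
      have := hw _ (tensor_mem_ddtGraph hη hθ hηc hθc hη' x)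
      simp only at this
      rw [inner_tensor hθ hθc, inner_tensor hη' hηc] at this
      rw [inner_add_right, this]; simp
    have h2 := inner_self_eq_zero.1 (h1 _)
    have h3 := hvp.integral_smul_add hη hθ hηc hθc
    simp only [smul_sub]
    rw [integral_sub ((locallyIntegrable_L2 g).integrable_smul_left_of_hasCompactSupport hθ hθc)
      (hvp.continuous.locallyIntegrable.integrable_smul_left_of_hasCompactSupport hθ hθc)]
    rw [eq_neg_of_add_eq_zero_left h2, eq_neg_of_add_eq_zero_left h3, sub_self]
  let ρ : ContDiffBump (0 : ℝ) := ⟨1, 2, by norm_num, by norm_num⟩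
  set r : ℝ → ℝ := ρ.normed volume with hr
  have hrc : Continuous r := ρ.continuous_normed
  have hrs : HasCompactSupport r := ρ.hasCompactSupport_normed
  have hr1 : ∫ t, r t = 1 := ρ.integral_normed
  set c : H := ∫ t, r t • (g t - v t) with hc
  have hgvc : LocallyIntegrable (fun t => g t - v t - c) volume :=
    hgv.sub (locallyIntegrable_const c)
  have hae : ∀ᵐ t, g t - v t - c = 0 := by
    refine ae_eq_zero_of_integral_contDiff_smul_eq_zero hgvc fun ζ hζ hζc => ?_
    have hζ' : Continuous ζ := hζ.continuous
    set m := ∫ t, ζ t with hm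
    have i1 := hζ'.integrable_of_hasCompactSupport (μ := volume) hζc
    have i2 := hrc.integrable_of_hasCompactSupport (μ := volume) hrs
    have hcs : HasCompactSupport (fun t => ζ t - m * r t) := by
      refine hζc.comp₂_left hrs (m := fun a b => a - m * b) ?_
      simp
    -- Subtracting m r, where r has integral 1, makes an arbitrary test function mean zero; thus g -
    -- v equals the constant c almost everywhere.
    have h1 := key (fun t => ζ t - m * r t) (hζ'.sub (continuous_const.mul hrc)) hcs (by
      rw [integral_sub i1 (i2.const_mul m), integral_const_mul, hr1]; simp [hm])
    have j1 := hgv.integrable_smul_left_of_hasCompactSupport hζ' hζc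
    have j2 := hgv.integrable_smul_left_of_hasCompactSupport hrc hrs
    have h2 : ∫ t, (ζ t • (g t - v t) - m • (r t • (g t - v t))) = 0 := by
      rw [← h1]
      exact integral_congr_ae (Eventually.of_forall fun t => by
        simp only [sub_smul, mul_smul])
    rw [integral_sub (g := fun t => m • (r t • (g t - v t))) j1 (j2.smul m), integral_smul, ← hc,
      sub_eq_zero] at h2
    have h3 : ∀ t, ζ t • (g t - v t - c) = ζ t • (g t - v t) - ζ t • c := fun t => smul_sub _ _ _
    simp only [h3]
    rw [integral_sub j1 (i1.smul_const c), h2, integral_smul_const, sub_self]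
  refine ⟨fun t => v t + c, ?_, fun s t => ?_⟩
  · filter_upwards [hae] with t ht
    rw [sub_sub, sub_eq_zero] at ht
    exact ht
  · have := hvp.eq s t
    change v t + c = v s + c + _
    rw [this]; abel

theorem mem_ddtGraph_iff_weak {g h : L2 H} :
    (g, h) ∈ ddtGraph H ↔ ∀ p ∈ ddtGraph H, ⟪p.2, g⟫_ℂ = - ⟪p.1, h⟫_ℂ :=
  ⟨fun hg _ hp => inner_ddt hp hg, mem_ddtGraph_of_weak⟩

/-- By the weak characterization the graph is an intersection of closed conditions, one for each
test pair. -/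
theorem isClosed_ddtGraph : IsClosed (ddtGraph H : Set (L2 H × L2 H)) := by
  have : (ddtGraph H : Set (L2 H × L2 H)) =
      ⋂ p ∈ ddtGraph H, {q | ⟪p.2, q.1⟫_ℂ = - ⟪p.1, q.2⟫_ℂ} := by
    ext q
    simp only [Set.mem_iInter, Set.mem_ofPred_eq]
    exact mem_ddtGraph_iff_weak
  rw [this]
  refine isClosed_biInter fun _ _ => isClosed_eq (by fun_prop) (by fun_prop)

/-- A subspace containing the products of test functions with vectors from a dense set is dense. -/
theorem dense_of_tensor_mem {D : Submodule ℂ (L2 H)} {S : Set H} (hS : Dense S)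
    (h : ∀ (φ θ : ℝ → ℝ) (hφ : Continuous φ) (hc : HasCompactSupport φ),
      (∀ t, HasDerivAt φ (θ t) t) → Continuous θ → HasCompactSupport θ →
      ∀ x ∈ S, (memLp_tensor hφ hc x).toLp ∈ D) : Dense (D : Set (L2 H)) := by
  rw [Submodule.dense_iff_topologicalClosure_eq_top, Submodule.topologicalClosure_eq_top_iff,
    Submodule.eq_bot_iff]
  intro g hg
  refine Lp.ext (EventuallyEq.trans ?_ (Lp.coeFn_zero H 2 (volume : Measure ℝ)).symm)
  refine ae_eq_zero_of_integral_contDiff_smul_eq_zero (locallyIntegrable_L2 g) fun φ hφ hc => ?_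
  refine hS.eq_zero_of_inner_right ℂ fun x hx => ?_
  rw [← inner_tensor hφ.continuous hc]
  refine (Submodule.mem_orthogonal _ _).1 hg _ (h φ (deriv φ) hφ.continuous hc
    (fun t => ?_) ?_ hc.deriv x hx)
  · exact (hφ.differentiable (by simp)).differentiableAt.hasDerivAt
  · exact hφ.continuous_deriv (by simp)

end TestFunctions

/-! ### Multiplication operators and operators with constant fibers. -/

section Fibers

open scoped BoundedContinuousFunction

variable {H : Type*} [NormedAddCommGroup H] [InnerProductSpace ℂ H] [CompleteSpace H]

theorem memLp_mul (G : ℝ →ᵇ (H →L[ℂ] H)) (f : L2 H) :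
    MemLp (fun t => G t (f t)) 2 (volume : Measure ℝ) := by
  refine MemLp.of_le_mul (c := ‖G‖) (Lp.memLp f) ?_ (Eventually.of_forall fun t => ?_)
  · exact (isBoundedBilinearMap_apply (𝕜 := ℂ) (E := H) (F := H)).continuous.comp_aestronglyMeasurable
      (G.continuous.aestronglyMeasurable.prodMk (Lp.aestronglyMeasurable f))
  · exact (ContinuousLinearMap.le_opNorm _ _).trans
      (mul_le_mul_of_nonneg_right (G.norm_coe_le_norm t) (norm_nonneg _))

/-- Multiplication by a bounded continuous operator valued function. -/
def mulL2 (G : ℝ →ᵇ (H →L[ℂ] H)) : L2 H →L[ℂ] L2 H :=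
  LinearMap.mkContinuous
    { toFun := fun f => (memLp_mul G f).toLp
      map_add' := fun f g => by
        refine Lp.ext ?_
        filter_upwards [(memLp_mul G (f + g)).coeFn_toLp, (memLp_mul G f).coeFn_toLp,
          (memLp_mul G g).coeFn_toLp, Lp.coeFn_add f g,
          Lp.coeFn_add (memLp_mul G f).toLp (memLp_mul G g).toLp] with t h1 h2 h3 h4 h5
        rw [h1, h5, Pi.add_apply, h2, h3, h4, Pi.add_apply, map_add]
      map_smul' := fun c f => by
        refine Lp.ext ?_
        filter_upwards [(memLp_mul G (c • f)).coeFn_toLp, (memLp_mul G f).coeFn_toLp,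
          Lp.coeFn_smul c f, Lp.coeFn_smul c (memLp_mul G f).toLp] with t h1 h2 h3 h4
        rw [h1, RingHom.id_apply, h4, Pi.smul_apply, h2, h3, Pi.smul_apply, map_smul] }
    ‖G‖ fun f => by
      refine Lp.norm_le_mul_norm_of_ae_le_mul ?_
      filter_upwards [(memLp_mul G f).coeFn_toLp] with t h1
      change ‖MemLp.toLp (fun t => G t (f t)) (memLp_mul G f) t‖ ≤ _
      rw [h1]
      exact (ContinuousLinearMap.le_opNorm _ _).trans
        (mul_le_mul_of_nonneg_right (G.norm_coe_le_norm t) (norm_nonneg _))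

theorem coeFn_mulL2 (G : ℝ →ᵇ (H →L[ℂ] H)) (f : L2 H) :
    mulL2 G f =ᵐ[volume] fun t => G t (f t) :=
  (memLp_mul G f).coeFn_toLp

theorem norm_mulL2_apply_le {G : ℝ →ᵇ (H →L[ℂ] H)} {c : ℝ} (hc : ∀ t, ‖G t‖ ≤ c) (f : L2 H) :
    ‖mulL2 G f‖ ≤ c * ‖f‖ := by
  refine Lp.norm_le_mul_norm_of_ae_le_mul ?_
  filter_upwards [coeFn_mulL2 G f] with t h1
  rw [h1]
  exact (ContinuousLinearMap.le_opNorm _ _).trans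
    (mul_le_mul_of_nonneg_right (hc t) (norm_nonneg _))

theorem norm_mulL2_le {G : ℝ →ᵇ (H →L[ℂ] H)} {c : ℝ} (hc : ∀ t, ‖G t‖ ≤ c) : ‖mulL2 G‖ ≤ c :=
  ContinuousLinearMap.opNorm_le_bound _ ((norm_nonneg _).trans (hc 0)) (norm_mulL2_apply_le hc)

theorem mulL2_mul (G K : ℝ →ᵇ (H →L[ℂ] H)) (f : L2 H) :
    mulL2 G (mulL2 K f) = mulL2 (G * K) f := by
  refine Lp.ext ?_
  filter_upwards [coeFn_mulL2 G (mulL2 K f), coeFn_mulL2 K f, coeFn_mulL2 (G * K) f] with t h1 h2 h3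
  rw [h1, h2, h3]; rfl

/-- The operator with constant fiber `T`. -/
def constL2 (T : H →L[ℂ] H) : L2 H →L[ℂ] L2 H :=
  mulL2 (BoundedContinuousFunction.const ℝ T)

theorem coeFn_constL2 (T : H →L[ℂ] H) (f : L2 H) : constL2 T f =ᵐ[volume] fun t => T (f t) :=
  coeFn_mulL2 (BoundedContinuousFunction.const ℝ T) f

theorem norm_constL2_apply_le {T : H →L[ℂ] H} {c : ℝ} (hc : ‖T‖ ≤ c) (f : L2 H) :
    ‖constL2 T f‖ ≤ c * ‖f‖ :=
  norm_mulL2_apply_le (G := BoundedContinuousFunction.const ℝ T) (fun _ => hc) f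

theorem constL2_mem_ddtGraph (T : H →L[ℂ] H) {p : L2 H × L2 H} (hp : p ∈ ddtGraph H) :
    (constL2 T p.1, constL2 T p.2) ∈ ddtGraph H :=
  clm_mem_ddtGraph T hp (coeFn_constL2 T p.1) (coeFn_constL2 T p.2)

theorem inner_eq_of_ae {a b c d : L2 H} (h : ∀ᵐ t, ⟪a t, b t⟫_ℂ = ⟪c t, d t⟫_ℂ) :
    ⟪a, b⟫_ℂ = ⟪c, d⟫_ℂ := by
  rw [L2.inner_def, L2.inner_def]
  exact integral_congr_ae h

theorem mem_fiberGraph_iff {A : ℝ → H →ₗ.[ℂ] H} {p : L2 H × L2 H} :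
    p ∈ fiberGraph A ↔ ∀ᵐ t, (p.1 t, p.2 t) ∈ (A t).graph := by
  refine eventually_congr (f := ae volume) (Eventually.of_forall fun t => ?_)
  rw [LinearPMap.mem_graph_iff]
  constructor
  · rintro ⟨h, e⟩
    exact ⟨⟨_, h⟩, rfl, e⟩
  · rintro ⟨⟨y, hy⟩, h1, h2⟩
    have h1 : y = p.1 t := h1
    subst h1
    exact ⟨hy, h2⟩

/-- A bounded inverse in the fibers gives a bounded inverse. -/
theorem IsBoundedInverse.constL2 {A : H →ₗ.[ℂ] H} {z : ℂ} {R : H →L[ℂ] H}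
    (h : IsBoundedInverse (addScalar A z) R) :
    IsBoundedInverse (addScalar (fiberOp fun _ => A) z) (constL2 R) := by
  rw [isBoundedInverse_iff] at h ⊢
  simp only [mem_graph_addScalar, graph_fiberOp, mem_fiberGraph_iff] at h ⊢
  refine ⟨fun f => ?_, fun f g hfg => Lp.ext ?_⟩
  · filter_upwards [coeFn_constL2 R f, Lp.coeFn_sub f (z • ModelOperator.constL2 R f),
      Lp.coeFn_smul z (ModelOperator.constL2 R f)] with t h1 h2 h3
    rw [h2, Pi.sub_apply, h3, Pi.smul_apply, h1]
    exact h.1 _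
  · filter_upwards [coeFn_constL2 R g, hfg, Lp.coeFn_sub g (z • f), Lp.coeFn_smul z f]
      with t h1 h2 h3 h4
    rw [h3, Pi.sub_apply, h4, Pi.smul_apply] at h2
    rw [h1]
    exact h.2 _ _ h2

/-- Symmetry holds fiberwise, and the fiberwise resolvents at ± i solve the range conditions. -/
theorem isSelfAdjoint_fiberOp {A : H →ₗ.[ℂ] H} (hA : IsSelfAdjoint A) :
    IsSelfAdjoint (fiberOp fun _ => A) := by
  have hs : IsSymm (fiberOp fun _ => A) := by
    rw [isSymm_iff]
    intro x y x' y' h h'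
    rw [graph_fiberOp, mem_fiberGraph_iff] at h h'
    refine inner_eq_of_ae ?_
    filter_upwards [h, h'] with t h1 h2
    exact isSymm_iff.1 (isSymm_of_isSelfAdjoint hA) _ _ _ _ h1 h2
  have hr : ∀ z : ℂ, z.im ≠ 0 → ∀ w : L2 H, ∃ x y, (x, y) ∈ (fiberOp fun _ => A).graph ∧
      y - z • x = w := by
    intro z hz w
    have h1 := (isBoundedInverse_iff.1 (isBoundedInverse_resolventOp hA hz).constL2).1 w
    rw [mem_graph_addScalar] at h1
    exact ⟨_, _, h1, by rw [neg_smul]; abel⟩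
  refine isSelfAdjoint_of_surjective hs (one_ne_zero (α := ℝ)) (hr _ (by simp)) fun w => ?_
  obtain ⟨x, y, h1, h2⟩ := hr (-((1 : ℝ) * Complex.I)) (by simp) w
  exact ⟨x, y, h1, by rw [← h2, neg_smul, sub_neg_eq_add]⟩

theorem resolventOp_fiberOp {A : H →ₗ.[ℂ] H} (hA : IsSelfAdjoint A) {z : ℂ} (hz : z.im ≠ 0) :
    resolventOp (fiberOp fun _ => A) z = constL2 (resolventOp A z) :=
  (isBoundedInverse_resolventOp (isSelfAdjoint_fiberOp hA) hz).eq
    (isBoundedInverse_resolventOp hA hz).constL2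

theorem isClosed_fiberGraph {A : H →ₗ.[ℂ] H} (hA : IsSelfAdjoint A) :
    IsClosed (fiberGraph (fun _ => A) : Set (L2 H × L2 H)) := by
  rw [← graph_fiberOp]
  exact (isSelfAdjoint_fiberOp hA).isClosed

end Fibers

/-! ### The model operator: graph, domain, density and closedness. -/

section Model

open scoped BoundedContinuousFunction

variable {H : Type*} [NormedAddCommGroup H] [InnerProductSpace ℂ H] [CompleteSpace H]

theorem mem_graph_domRestrict {E F : Type*} [AddCommGroup E] [Module ℂ E] [AddCommGroup F]
    [Module ℂ F] {T : E →ₗ.[ℂ] F} {S : Submodule ℂ E} {x : E} {y : F} :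
    (x, y) ∈ (T.domRestrict S).graph ↔ x ∈ S ∧ (x, y) ∈ T.graph := by
  simp only [LinearPMap.mem_graph_iff]
  constructor
  · rintro ⟨⟨u, hu⟩, rfl, rfl⟩
    obtain ⟨h1, h2⟩ := Submodule.mem_inf.1 hu
    exact ⟨h1, ⟨u, h2⟩, rfl, (LinearPMap.domRestrict_apply rfl).symm⟩
  · rintro ⟨h1, ⟨u, h2⟩, rfl, rfl⟩
    exact ⟨⟨u, Submodule.mem_inf.2 ⟨h1, h2⟩⟩, rfl, LinearPMap.domRestrict_apply rfl⟩

/-- A skew-symmetric relation commuting with the resolvents of a self-adjoint operator is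
orthogonal to it in the mean. -/
theorem re_inner_eq_zero_of_commute {E : Type*} [NormedAddCommGroup E] [InnerProductSpace ℂ E]
    [CompleteSpace E] {T : E →ₗ.[ℂ] E} (hT : IsSelfAdjoint T) {W : Submodule ℂ (E × E)}
    (hs : ∀ p ∈ W, ∀ q ∈ W, ⟪p.2, q.1⟫_ℂ = - ⟪p.1, q.2⟫_ℂ)
    (hc : ∀ z : ℂ, z.im ≠ 0 → ∀ p ∈ W, (resolventOp T z p.1, resolventOp T z p.2) ∈ W)
    {f f' a : E} (hd : (f, f') ∈ W) (ha : (f, a) ∈ T.graph) : (⟪f', a⟫_ℂ).re = 0 := by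
  have key : ∀ μ : ℝ, μ ≠ 0 → (⟪yosidaOp T μ f', yosidaOp T μ a⟫_ℂ).re = 0 := by
    intro μ hμ
    have hz : ((μ : ℂ) * Complex.I).im ≠ 0 := by simpa using hμ
    set R := resolventOp T (μ * Complex.I) with hR
    have h1 : (R f, R f') ∈ W := hc _ hz _ hd
    -- Formally ⟪f', T f⟫ = -⟪f, T f'⟫ = -⟪T f, f'⟫, but a = T f need not lie in the domain of W.
    -- Its regularization R a = f + iμ R f does, so the computation is made for R f' and R a, and
    -- then |μ| → ∞.
    have h2 : (R a, f' + (μ * Complex.I : ℂ) • R f') ∈ W := by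
      have e : R a = f + (μ * Complex.I : ℂ) • R f := by
        have := resolventOp_apply hT hz ha
        rw [map_sub, map_smul, sub_eq_iff_eq_add] at this
        exact this
      rw [e]
      exact W.add_mem hd (W.smul_mem _ h1)
    have h3 := hs _ h1 _ h2
    have h4 := isSymm_iff.1 (isSymm_of_isSelfAdjoint hT) _ _ _ _
      (resolventOp_comm_graph hT hz ha) (resolventOp_mem_graph hT hz f')
    simp only at h3
    have h5 : (⟪R f', R a⟫_ℂ).re = 0 := by
      have h6 := congrArg Complex.re (inner_conj_symm (𝕜 := ℂ) (R a) (R f'))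
      rw [Complex.conj_re] at h6
      rw [← h4] at h3
      have h7 := congrArg Complex.re h3
      rw [Complex.neg_re] at h7
      linarith
    simp only [yosidaOp, smul_apply, inner_smul_left, inner_smul_right, ← hR]
    rw [← mul_assoc, Complex.mul_conj, Complex.re_ofReal_mul, h5, mul_zero]
  have h1 := (tendsto_yosidaOp hT f').inner (𝕜 := ℂ) (tendsto_yosidaOp hT a)
  have h2 := (Complex.continuous_re.tendsto _).comp h1
  have h3 : ∀ᶠ μ : ℝ in Bornology.cobounded ℝ, μ ≠ 0 :=
    ((tendsto_norm_cobounded_atTop (E := ℝ)).eventually (eventually_ge_atTop 1)).mono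
      fun μ hμ h0 => by rw [h0, norm_zero] at hμ; linarith
  exact tendsto_nhds_unique h2 (tendsto_const_nhds.congr' (h3.mono fun μ hμ => (key μ hμ).symm))

section Orthogonality

variable {A : H →ₗ.[ℂ] H} {f f' a : L2 H}

/-- `d/dt` and a self-adjoint operator with constant fibers are orthogonal in the mean. -/
theorem re_inner_ddt_fiber (hA : IsSelfAdjoint A) (hd : (f, f') ∈ ddtGraph H)
    (ha : (f, a) ∈ fiberGraph fun _ => A) : (⟪f', a⟫_ℂ).re = 0 := by
  refine re_inner_eq_zero_of_commute (isSelfAdjoint_fiberOp hA) (W := ddtGraph H)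
    (fun p hp q hq => inner_ddt hp hq) (fun z hz p hp => ?_) hd (by rwa [graph_fiberOp])
  rw [resolventOp_fiberOp hA hz]
  exact constL2_mem_ddtGraph _ hp

/-- The real cross term vanishes, so the sum controls each summand. This replaces a simultaneous
diagonalization of d/dt and A by Fourier and spectral transforms. -/
theorem norm_sq_ddt_add_fiber (hA : IsSelfAdjoint A) (hd : (f, f') ∈ ddtGraph H)
    (ha : (f, a) ∈ fiberGraph fun _ => A) : ‖f' + a‖ ^ 2 = ‖f'‖ ^ 2 + ‖a‖ ^ 2 := by
  have h := re_inner_ddt_fiber hA hd ha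
  have := @norm_add_sq ℂ _ _ _ _ f' a
  rw [this, show RCLike.re ⟪f', a⟫_ℂ = 0 from h]
  ring

theorem norm_le_norm_ddt_add_fiber (hA : IsSelfAdjoint A) (hd : (f, f') ∈ ddtGraph H)
    (ha : (f, a) ∈ fiberGraph fun _ => A) : ‖f'‖ ≤ ‖f' + a‖ ∧ ‖a‖ ≤ ‖f' + a‖ := by
  have h := norm_sq_ddt_add_fiber hA hd ha
  constructor <;> refine le_of_sq_le_sq ?_ (norm_nonneg _) <;>
    rw [h] <;> nlinarith [sq_nonneg ‖a‖, sq_nonneg ‖f'‖]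

end Orthogonality

variable {A : H →ₗ.[ℂ] H} {C : ℝ → H →L[ℂ] H} {Cp : H →L[ℂ] H}

/-- The path as a bounded continuous function. -/
def RelCompactPath.bcf (h : RelCompactPath A C Cp) : ℝ →ᵇ (H →L[ℂ] H) :=
  BoundedContinuousFunction.ofNormedAddCommGroup C h.cont h.exists_norm_le.choose
    h.exists_norm_le.choose_spec

@[simp]
theorem RelCompactPath.bcf_apply (h : RelCompactPath A C Cp) (t : ℝ) : h.bcf t = C t := rfl

variable {B : ℝ → H →ₗ.[ℂ] H} {f f' a g : L2 H}

theorem mem_fiberGraph_pertOp (h : RelCompactPath A C Cp) (ha : (f, a) ∈ fiberGraph fun _ => A) :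
    (f, g) ∈ fiberGraph (fun t => pertOp A (C t)) ↔ g = a + mulL2 h.bcf (a - Complex.I • f) := by
  have h1 : ∀ᵐ t, (a + mulL2 h.bcf (a - Complex.I • f)) t =
      a t + C t (a t - Complex.I • f t) := by
    filter_upwards [coeFn_mulL2 h.bcf (a - Complex.I • f), Lp.coeFn_sub a (Complex.I • f),
      Lp.coeFn_smul Complex.I f, Lp.coeFn_add a (mulL2 h.bcf (a - Complex.I • f))] with t h1 h2 h3 h4
    rw [h4, Pi.add_apply, h1, h2, Pi.sub_apply, h3, Pi.smul_apply, RelCompactPath.bcf_apply]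
  rw [mem_fiberGraph_iff] at ha ⊢
  constructor
  · intro hg
    refine Lp.ext ?_
    filter_upwards [h1, ha, hg] with t h1 h2 h3
    obtain ⟨y, hy, hz⟩ := mem_graph_pertOp.1 h3
    have : y = a t := A.mem_graph_snd_inj hy h2 rfl
    rw [h1, ← this]
    exact hz
  · rintro rfl
    filter_upwards [h1, ha] with t h1 h2
    exact mem_graph_pertOp.2 ⟨_, h2, h1⟩

/-- Since A(t) = A + C(t)(A - i) with C bounded and continuous, f ∈ dom 𝐀₋ already implies f ∈ dom
𝐀. The third domain condition contained in `modelOp` is therefore automatic. -/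
theorem mem_graph_modelOp (h : RelCompactPath A C Cp)
    (hB : ∀ t, familyOp A B t = pertOp A (C t)) :
    (f, g) ∈ (modelOp A B).graph ↔ ∃ f' a, (f, f') ∈ ddtGraph H ∧
      (f, a) ∈ fiberGraph (fun _ => A) ∧ g = f' + a + mulL2 h.bcf (a - Complex.I • f) := by
  have hB' : familyOp A B = fun t => pertOp A (C t) := funext hB
  rw [modelOp, mem_graph_domRestrict, hB', LinearPMap.mem_domain_iff]
  simp only [mem_graph_add, graph_ddt, graph_fiberOp]
  constructor
  · rintro ⟨⟨a, ha⟩, f', b, h1, h2, rfl⟩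
    rw [mem_fiberGraph_pertOp h ha] at h2
    exact ⟨f', a, h1, ha, by rw [h2]; abel⟩
  · rintro ⟨f', a, h1, ha, rfl⟩
    exact ⟨⟨a, ha⟩, f', _, h1, (mem_fiberGraph_pertOp h ha).2 rfl, by abel⟩

theorem domain_modelOp (h : RelCompactPath A C Cp)
    (hB : ∀ t, familyOp A B t = pertOp A (C t)) :
    (modelOp A B).domain = (ddt H).domain ⊓ (fiberOp fun _ => A).domain := by
  ext f
  rw [Submodule.mem_inf, LinearPMap.mem_domain_iff, LinearPMap.mem_domain_iff,
    LinearPMap.mem_domain_iff]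
  simp only [mem_graph_modelOp h hB, graph_ddt, graph_fiberOp]
  constructor
  · rintro ⟨g, f', a, h1, h2, -⟩
    exact ⟨⟨f', h1⟩, a, h2⟩
  · rintro ⟨⟨f', h1⟩, a, h2⟩
    exact ⟨_, f', a, h1, h2, rfl⟩

theorem tensor_mem_fiberGraph {φ : ℝ → ℝ} (hφ : Continuous φ) (hc : HasCompactSupport φ) {x y : H}
    (hxy : (x, y) ∈ A.graph) :
    ((memLp_tensor hφ hc x).toLp, (memLp_tensor hφ hc y).toLp) ∈ fiberGraph fun _ => A := by
  rw [mem_fiberGraph_iff]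
  filter_upwards [(memLp_tensor hφ hc x).coeFn_toLp, (memLp_tensor hφ hc y).coeFn_toLp] with t h1 h2
  simp only [h1, h2]
  have := A.graph.smul_mem (φ t : ℂ) hxy
  rwa [Prod.smul_mk, Complex.coe_smul, Complex.coe_smul] at this

theorem dense_domain_modelOp (h : RelCompactPath A C Cp)
    (hB : ∀ t, familyOp A B t = pertOp A (C t)) : Dense ((modelOp A B).domain : Set (L2 H)) := by
  refine dense_of_tensor_mem h.sa.dense_domain fun φ θ hφ hc hd hθ hθc x hx => ?_
  obtain ⟨y, hxy⟩ := LinearPMap.mem_domain_iff.1 hx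
  exact LinearPMap.mem_domain_of_mem_graph ((mem_graph_modelOp h hB).2
    ⟨_, _, tensor_mem_ddtGraph hd hθ hc hθc hφ x, tensor_mem_fiberGraph hφ hc hxy, rfl⟩)

theorem constL2_cayleyOp_apply (hA : IsSelfAdjoint A) {μ : ℝ} (hμ : μ ≠ 0)
    (ha : (f, a) ∈ fiberGraph fun _ => A) :
    constL2 (cayleyOp A μ) (a - ((μ : ℂ) * Complex.I) • f) = a - Complex.I • f := by
  refine Lp.ext ?_
  filter_upwards [coeFn_constL2 (cayleyOp A μ) (a - ((μ : ℂ) * Complex.I) • f),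
    Lp.coeFn_sub a (((μ : ℂ) * Complex.I) • f), Lp.coeFn_smul ((μ : ℂ) * Complex.I) f,
    Lp.coeFn_sub a (Complex.I • f), Lp.coeFn_smul Complex.I f, mem_fiberGraph_iff.1 ha]
    with t h1 h2 h3 h4 h5 h6
  rw [h1, h2, h4, Pi.sub_apply, Pi.sub_apply, h3, h5, Pi.smul_apply, Pi.smul_apply]
  exact cayleyOp_apply hA hμ h6

/-- A multiplication operator applied to `(A - i) f`, for a rapidly oscillating shift. -/
theorem mulL2_sub_smul (hA : IsSelfAdjoint A) {μ : ℝ} (hμ : μ ≠ 0) (G : ℝ →ᵇ (H →L[ℂ] H))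
    (ha : (f, a) ∈ fiberGraph fun _ => A) :
    mulL2 G (a - Complex.I • f) =
      mulL2 (G * BoundedContinuousFunction.const ℝ (cayleyOp A μ))
        (a - ((μ : ℂ) * Complex.I) • f) := by
  rw [← constL2_cayleyOp_apply hA hμ ha, constL2, mulL2_mul]

/-- The graph norms of `d/dt` and of the constant fiber operator are controlled by the graph
norm of the model operator. -/
theorem RelCompactPath.exists_graph_bound (h : RelCompactPath A C Cp) : ∃ c, 0 ≤ c ∧
    ∀ f f' a : L2 H, (f, f') ∈ ddtGraph H → (f, a) ∈ fiberGraph (fun _ => A) →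
      ‖f' + a‖ ≤ c * (‖f' + a + mulL2 h.bcf (a - Complex.I • f)‖ + ‖f‖) := by
  -- For this μ the perturbation is at most (‖a‖ + |μ| ‖f‖)/2 uniformly in t. As ‖a‖ ≤ ‖f' + a‖,
  -- half of the left side is absorbed, which leaves the constant 2 max(1, |μ|).
  obtain ⟨μ, hμ, h1⟩ := ((h.unif (1 / 2) (by norm_num)).and
    ((tendsto_norm_cobounded_atTop (E := ℝ)).eventually (eventually_ge_atTop 1))).exists
  have hμ0 : μ ≠ 0 := by rintro rfl; rw [norm_zero] at h1; linarith
  refine ⟨2 * max 1 |μ|, by positivity, fun f f' a hd ha => ?_⟩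
  have h2 := mulL2_sub_smul h.sa hμ0 h.bcf ha
  have h3 : ‖mulL2 h.bcf (a - Complex.I • f)‖ ≤ 1 / 2 * (‖a‖ + |μ| * ‖f‖) := by
    rw [h2]
    have h4 : ‖a - ((μ : ℂ) * Complex.I) • f‖ ≤ ‖a‖ + |μ| * ‖f‖ := by
      refine (norm_sub_le _ _).trans_eq ?_
      rw [norm_smul]
      simp
    have h5 : ∀ t, ‖(h.bcf * BoundedContinuousFunction.const ℝ (cayleyOp A μ)) t‖ ≤ 1 / 2 :=
      fun t => hμ t
    exact (norm_mulL2_apply_le h5 _).trans (mul_le_mul_of_nonneg_left h4 (by norm_num))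
  have h4 := (norm_le_norm_ddt_add_fiber h.sa hd ha).2
  have h5 : ‖f' + a‖ ≤ ‖f' + a + mulL2 h.bcf (a - Complex.I • f)‖ +
      ‖mulL2 h.bcf (a - Complex.I • f)‖ := by
    have := norm_sub_le (f' + a + mulL2 h.bcf (a - Complex.I • f))
      (mulL2 h.bcf (a - Complex.I • f))
    rwa [add_sub_cancel_right] at this
  have h6 : ‖f' + a + mulL2 h.bcf (a - Complex.I • f)‖ ≤
    max 1 |μ| * ‖f' + a + mulL2 h.bcf (a - Complex.I • f)‖ :=
    le_mul_of_one_le_left (norm_nonneg _) (le_max_left _ _)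
  have h7 : |μ| * ‖f‖ ≤ max 1 |μ| * ‖f‖ := by gcongr; exact le_max_right _ _
  have h8 : 0 ≤ max 1 |μ| * ‖f‖ := by positivity
  nlinarith

/-- Along a convergent sequence in the graph, the graph bound makes f' and a Cauchy separately; the
closed operators d/dt and 𝐀₋ then identify the limits. -/
theorem isClosed_modelOp (h : RelCompactPath A C Cp)
    (hB : ∀ t, familyOp A B t = pertOp A (C t)) : (modelOp A B).IsClosed := by
  obtain ⟨c, hc, hb⟩ := h.exists_graph_bound
  have hA := h.sa
  change IsClosed ((modelOp A B).graph : Set (L2 H × L2 H))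
  refine IsSeqClosed.isClosed fun p q hp hq => ?_
  have hp' : ∀ n, ∃ f' a, ((p n).1, f') ∈ ddtGraph H ∧ ((p n).1, a) ∈ fiberGraph (fun _ => A) ∧
      (p n).2 = f' + a + mulL2 h.bcf (a - Complex.I • (p n).1) := fun n =>
    (mem_graph_modelOp h hB).1 (hp n)
  choose f' a h1 h2 h3 using hp'
  have hbd : ∀ m n, ‖f' m - f' n‖ ≤ c * (‖(p m).2 - (p n).2‖ + ‖(p m).1 - (p n).1‖) ∧
      ‖a m - a n‖ ≤ c * (‖(p m).2 - (p n).2‖ + ‖(p m).1 - (p n).1‖) := by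
    intro m n
    have e1 : ((p m).1 - (p n).1, f' m - f' n) ∈ ddtGraph H := (ddtGraph H).sub_mem (h1 m) (h1 n)
    have e2 : ((p m).1 - (p n).1, a m - a n) ∈ fiberGraph (fun _ => A) :=
      (fiberGraph (fun _ => A)).sub_mem (h2 m) (h2 n)
    have e3 := hb _ _ _ e1 e2
    have e4 := norm_le_norm_ddt_add_fiber hA e1 e2
    have e5 : f' m - f' n + (a m - a n) +
        mulL2 h.bcf (a m - a n - Complex.I • ((p m).1 - (p n).1)) = (p m).2 - (p n).2 := by
      rw [h3 m, h3 n]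
      simp only [map_sub, map_smul]
      module
    rw [e5] at e3
    exact ⟨e4.1.trans e3, e4.2.trans e3⟩
  have hcs := hq.cauchySeq
  have hlim : Tendsto (fun k : ℕ × ℕ => c * (‖(p k.1).2 - (p k.2).2‖ + ‖(p k.1).1 - (p k.2).1‖))
      atTop (𝓝 0) := by
    have t1 : Tendsto (fun k : ℕ × ℕ => p k.1) atTop (𝓝 q) :=
      hq.comp (tendsto_fst.mono_left (by rw [prod_atTop_atTop_eq]))
    have t2 : Tendsto (fun k : ℕ × ℕ => p k.2) atTop (𝓝 q) :=
      hq.comp (tendsto_snd.mono_left (by rw [prod_atTop_atTop_eq]))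
    have t3 := t1.sub t2
    have := ((t3.snd_nhds.norm.add t3.fst_nhds.norm).const_mul c)
    simpa using this
  have c1 : CauchySeq f' := cauchySeq_iff_tendsto_dist_atTop_0.2
    (squeeze_zero (fun _ => dist_nonneg) (fun k => by
      rw [dist_eq_norm]; exact (hbd k.1 k.2).1) hlim)
  have c2 : CauchySeq a := cauchySeq_iff_tendsto_dist_atTop_0.2
    (squeeze_zero (fun _ => dist_nonneg) (fun k => by
      rw [dist_eq_norm]; exact (hbd k.1 k.2).2) hlim)
  obtain ⟨f₀, l1⟩ := cauchySeq_tendsto_of_complete c1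
  obtain ⟨a₀, l2⟩ := cauchySeq_tendsto_of_complete c2
  refine (mem_graph_modelOp h hB).2 ⟨f₀, a₀, ?_, ?_, ?_⟩
  · exact isClosed_ddtGraph.mem_of_tendsto (hq.fst_nhds.prodMk_nhds l1) (Eventually.of_forall h1)
  · exact (isClosed_fiberGraph hA).mem_of_tendsto (hq.fst_nhds.prodMk_nhds l2)
      (Eventually.of_forall h2)
  · refine tendsto_nhds_unique hq.snd_nhds (((l1.add l2).add (((mulL2 h.bcf).continuous.tendsto
      _).comp (l2.sub (hq.fst_nhds.const_smul Complex.I)))).congr fun n => (h3 n).symm)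

end Model

/-! ### Inversion of d/dt + T for boundedly invertible T. -/

section Inverse

variable {H : Type*} [NormedAddCommGroup H] [InnerProductSpace ℂ H] [CompleteSpace H]
variable {A T : H →ₗ.[ℂ] H} {D : H →L[ℂ] H}

theorem relCompactPath_zero (hT : IsSelfAdjoint T) :
    RelCompactPath T (fun _ => (0 : H →L[ℂ] H)) 0 where
  sa := hT
  symm := by simp
  cont := continuous_const
  bot := tendsto_const_nhds
  top := tendsto_const_nhds
  approx _ := FinApprox.zero
  unif ε hε := Eventually.of_forall fun μ t => by simpa using hε.le

theorem mem_graph_modelOp_zero (hT : IsSelfAdjoint T) {f g : L2 H} :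
    (f, g) ∈ (modelOp T fun _ => 0).graph ↔ ∃ f' a, (f, f') ∈ ddtGraph H ∧
      (f, a) ∈ fiberGraph (fun _ => T) ∧ g = f' + a := by
  have h0 : mulL2 (relCompactPath_zero hT).bcf = 0 := by
    rw [← norm_le_zero_iff]
    exact norm_mulL2_le fun t => by simp
  rw [mem_graph_modelOp (relCompactPath_zero hT)
    (fun t => by rw [familyOp, pertOp_zero, add_zero])]
  simp [h0]

theorem zero_mem_resolventSet_iff : (0 : ℂ) ∈ resolventSet T ↔
    ∃ R : H →L[ℂ] H, (∀ x, (R x, x) ∈ T.graph) ∧ ∀ x y, (x, y) ∈ T.graph → R y = x := by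
  refine exists_congr fun R => ?_
  rw [isBoundedInverse_iff]
  simp only [mem_graph_addScalar, neg_zero, zero_smul, sub_zero]

/-- If `T` is boundedly invertible, so is `d/dt + T` in `L²(ℝ; H)`. -/
theorem exists_isBoundedInverse_modelOp (hT : IsSelfAdjoint T) (h0 : (0 : ℂ) ∈ resolventSet T) :
    ∃ Q, IsBoundedInverse (modelOp T fun _ => 0) Q := by
  obtain ⟨R, hR1, hR2⟩ := zero_mem_resolventSet_iff.1 h0
  have hcl : (modelOp T fun _ => 0).IsClosed := isClosed_modelOp (relCompactPath_zero hT)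
    (fun t => by rw [familyOp, pertOp_zero, add_zero])
  have hRf : ∀ f : L2 H, (constL2 R f, f) ∈ fiberGraph fun _ => T := by
    intro f
    rw [mem_fiberGraph_iff]
    filter_upwards [coeFn_constL2 R f] with t h1
    simp only [h1]
    exact hR1 _
  have hRa : ∀ f a : L2 H, (f, a) ∈ (fiberGraph fun _ => T) → constL2 R a = f := by
    intro f a ha
    refine Lp.ext ?_
    filter_upwards [coeFn_constL2 R a, mem_fiberGraph_iff.1 ha] with t h1 h2
    rw [h1]
    exact hR2 _ _ h2
  have hsymm : ∀ f g : L2 H, ⟪constL2 R f, g⟫_ℂ = ⟪f, constL2 R g⟫_ℂ := by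
    intro f g
    refine inner_eq_of_ae ?_
    filter_upwards [coeFn_constL2 R f, coeFn_constL2 R g] with t h1 h2
    rw [h1, h2]
    exact (isSymm_iff.1 (isSymm_of_isSelfAdjoint hT) _ _ _ _ (hR1 (f t)) (hR1 (g t))).symm
  refine (exists_isBoundedInverse (c := ‖R‖) hcl (fun f g hfg => ?_) fun g hg => ?_).imp
    fun Q hQ => hQ.1
  · obtain ⟨f', a, h1, h2, rfl⟩ := (mem_graph_modelOp_zero hT).1 hfg
    rw [← hRa f a h2]
    refine (norm_constL2_apply_le le_rfl a).trans ?_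
    gcongr
    exact (norm_le_norm_ddt_add_fiber hT h1 h2).2
  -- Let g be orthogonal to the range. Testing with R p, where R = T⁻¹, gives ⟪p', R g⟫ = -⟪p, g⟫:
  -- the function R g has weak derivative g.
  · have hu : (constL2 R g, g) ∈ ddtGraph H := mem_ddtGraph_of_weak fun p hp => by
      have h1 := hg _ _ ((mem_graph_modelOp_zero hT).2
        ⟨_, _, constL2_mem_ddtGraph R hp, hRf p.1, rfl⟩)
      rw [inner_add_left, hsymm] at h1
      exact eq_neg_of_add_eq_zero_left h1
    -- Hence R g is itself in the domain and is mapped to g + g, to which g is orthogonal.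
    have h1 := hg _ _ ((mem_graph_modelOp_zero hT).2 ⟨_, _, hu, hRf g, rfl⟩)
    rw [inner_add_left, ← two_mul, mul_eq_zero, inner_self_eq_zero] at h1
    exact h1.resolve_left two_ne_zero

/-- `Q` is the inverse of `d/dt + A + D (A - i)`, and `W = (A - i) Q`. -/
structure IsModelInverse (A : H →ₗ.[ℂ] H) (D : H →L[ℂ] H) (Q W : L2 H →L[ℂ] L2 H) : Prop where
  fiber : ∀ h, (Q h, W h + Complex.I • Q h) ∈ fiberGraph fun _ => A
  ddt : ∀ h, (Q h, h - (W h + Complex.I • Q h) - constL2 D (W h)) ∈ ddtGraph H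
  left : ∀ f f' a, (f, f') ∈ ddtGraph H → (f, a) ∈ (fiberGraph fun _ => A) →
    Q (f' + a + constL2 D (a - Complex.I • f)) = f

/-- With T = A + D (A - i), the operator T Q is bounded by the closed graph theorem and V = (A -
i)(T - i)⁻¹ is bounded on fibers, so W = V (T Q - i Q) is bounded and equals (A - i) Q. -/
theorem exists_isModelInverse (hA : IsSelfAdjoint A) (hD : RelPert A D)
    (h0 : (0 : ℂ) ∈ resolventSet (pertOp A D)) : ∃ Q W, IsModelInverse A D Q W := by
  have hT := hD.isSelfAdjoint hA
  obtain ⟨Q, hQ⟩ := exists_isBoundedInverse_modelOp hT h0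
  rw [isBoundedInverse_iff] at hQ
  obtain ⟨hQ1, hQ2⟩ := hQ
  have hI : Complex.I.im ≠ 0 := by simp
  obtain ⟨V, hV⟩ := exists_bounded_comp (T := addScalar A (-Complex.I))
    (isClosed_addScalar hA.isClosed _) (resolventOp (pertOp A D) Complex.I) (fun x => by
      obtain ⟨y, hy, -⟩ := mem_graph_pertOp.1 (resolventOp_mem_graph hT hI x)
      exact LinearPMap.mem_domain_of_mem_graph ((mem_graph_addScalar
        (y := y + (-Complex.I) • resolventOp (pertOp A D) Complex.I x)).2
          (by rwa [add_sub_cancel_right])))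
  obtain ⟨QT, hQT⟩ := exists_bounded_comp (isSelfAdjoint_fiberOp hT).isClosed Q (fun h => by
    obtain ⟨f', a, -, h2, -⟩ := (mem_graph_modelOp_zero hT).1 (hQ1 h)
    rw [← graph_fiberOp] at h2
    exact LinearPMap.mem_domain_of_mem_graph h2)
  simp only [graph_fiberOp] at hQT
  have hfun : ∀ {f a b : L2 H}, (f, a) ∈ (fiberGraph fun _ => pertOp A D) →
      (f, b) ∈ (fiberGraph fun _ => pertOp A D) → a = b := by
    intro f a b h1 h2
    rw [← graph_fiberOp] at h1 h2
    exact LinearPMap.mem_graph_snd_inj _ h1 h2 rfl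
  have hconv : ∀ {f a : L2 H}, (f, a) ∈ (fiberGraph fun _ => A) →
      (f, a + constL2 D (a - Complex.I • f)) ∈ fiberGraph fun _ => pertOp A D := by
    intro f a ha
    rw [mem_fiberGraph_iff] at ha ⊢
    filter_upwards [ha, coeFn_constL2 D (a - Complex.I • f), Lp.coeFn_sub a (Complex.I • f),
      Lp.coeFn_smul Complex.I f, Lp.coeFn_add a (constL2 D (a - Complex.I • f))]
      with t h1 h2 h3 h4 h5
    rw [mem_graph_pertOp]
    refine ⟨_, h1, ?_⟩
    rw [h5, Pi.add_apply, h2, h3, Pi.sub_apply, h4, Pi.smul_apply]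
  set W : L2 H →L[ℂ] L2 H := (constL2 V).comp (QT - Complex.I • Q) with hW
  have hfib : ∀ h, (Q h, W h + Complex.I • Q h) ∈ fiberGraph fun _ => A := by
    intro h
    rw [mem_fiberGraph_iff]
    filter_upwards [mem_fiberGraph_iff.1 (hQT h), coeFn_constL2 V (QT h - Complex.I • Q h),
      Lp.coeFn_sub (QT h) (Complex.I • Q h), Lp.coeFn_smul Complex.I (Q h),
      Lp.coeFn_add (W h) (Complex.I • Q h)] with t h1 h2 h3 h4 h5
    have h6 := resolventOp_apply hT hI h1
    have h7 := mem_graph_addScalar.1 (hV (QT h t - Complex.I • Q h t))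
    have h8 : W h t = V (QT h t - Complex.I • Q h t) := by
      have : W h = constL2 V (QT h - Complex.I • Q h) := rfl
      rw [this, h2, h3, Pi.sub_apply, h4, Pi.smul_apply]
    rw [h6] at h7
    rw [h5, Pi.add_apply, h8, h4, Pi.smul_apply]
    simpa using h7
  refine ⟨Q, W, hfib, fun h => ?_, fun f f' a h1 h2 => ?_⟩
  · obtain ⟨f', a, h1, h2, h3⟩ := (mem_graph_modelOp_zero hT).1 (hQ1 h)
    have h4 := hfun h2 (hconv (hfib h))
    have h5 : h - (W h + Complex.I • Q h) - constL2 D (W h) = f' := by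
      rw [add_sub_cancel_right] at h4
      rw [sub_sub, ← h4, h3, add_sub_cancel_right]
    rwa [h5]
  · refine hQ2 _ _ ((mem_graph_modelOp_zero hT).2 ⟨_, _, h1, hconv h2, ?_⟩)
    abel

theorem exists_isModelInverse_zero (hA : IsSelfAdjoint A) (h0 : (0 : ℂ) ∈ resolventSet A) :
    ∃ Q W, IsModelInverse A 0 Q W :=
  exists_isModelInverse hA relPert_zero (by rwa [pertOp_zero])

end Inverse

/-! ### Local Rellich compactness by averaging over the cells of a grid. -/

section Local

open scoped BoundedContinuousFunction

variable {H : Type*} [NormedAddCommGroup H] [InnerProductSpace ℂ H] [CompleteSpace H]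

/-- The embedding of `H` as the functions constant on a set and zero outside of it. -/
def embL2 (H : Type*) [NormedAddCommGroup H] [InnerProductSpace ℂ H] {S : Set ℝ}
    (hS : MeasurableSet S) (hfin : volume S ≠ ∞) : H →L[ℂ] L2 H :=
  LinearMap.mkContinuous
    { toFun := fun x => indicatorConstLp 2 hS hfin x
      map_add' := fun x y => indicatorConstLp_add.symm
      map_smul' := fun c x => by
        refine Lp.ext ?_
        filter_upwards [indicatorConstLp_coeFn (p := 2) (hs := hS) (hμs := hfin) (c := c • x),
          indicatorConstLp_coeFn (p := 2) (hs := hS) (hμs := hfin) (c := x),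
          Lp.coeFn_smul c (indicatorConstLp 2 hS hfin x)] with t h1 h2 h3
        rw [h1, RingHom.id_apply, h3, Pi.smul_apply, h2, Set.indicator_const_smul_apply] }
    (volume.real S ^ (1 / (2 : ℝ≥0∞).toReal)) fun x => by
      rw [mul_comm]
      exact norm_indicatorConstLp_le (hs := hS) (hμs := hfin)

theorem embL2_apply {S : Set ℝ} (hS : MeasurableSet S) (hfin : volume S ≠ ∞) (x : H) :
    embL2 H hS hfin x = indicatorConstLp 2 hS hfin x := rfl

theorem coeFn_embL2 {S : Set ℝ} (hS : MeasurableSet S) (hfin : volume S ≠ ∞) (x : H) :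
    embL2 H hS hfin x =ᵐ[volume] S.indicator fun _ => x :=
  indicatorConstLp_coeFn (hs := hS) (hμs := hfin)

theorem adjoint_embL2 {S : Set ℝ} (hS : MeasurableSet S) (hfin : volume S ≠ ∞) (f : L2 H) :
    ContinuousLinearMap.adjoint (embL2 H hS hfin) f = ∫ t in S, f t := by
  refine ext_inner_left ℂ fun x => ?_
  rw [ContinuousLinearMap.adjoint_inner_right, embL2_apply,
    L2.inner_indicatorConstLp_eq_inner_setIntegral]

theorem norm_le_of_ae_le_indicator {w f : L2 H} {S : Set ℝ} (hS : MeasurableSet S)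
    (hfin : volume S ≠ ∞) {a b : ℝ} (ha : 0 ≤ a) (hb : 0 ≤ b)
    (h : ∀ᵐ t, ‖w t‖ ≤ a * ‖f t‖ + S.indicator (fun _ => b) t) :
    ‖w‖ ≤ a * ‖f‖ + b * Real.sqrt (volume.real S) := by
  set F : Lp ℝ 2 (volume : Measure ℝ) := (Lp.memLp f).norm.toLp with hF
  have hFn : ‖F‖ = ‖f‖ := by
    rw [hF, Lp.norm_toLp, eLpNorm_norm, Lp.norm_def]
  set K := a • F + indicatorConstLp 2 hS hfin b with hK
  have h1 : ‖w‖ ≤ ‖K‖ := by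
    refine Lp.norm_le_norm_of_ae_le ?_
    filter_upwards [h, Lp.coeFn_add (a • F) (indicatorConstLp 2 hS hfin b), Lp.coeFn_smul a F,
      (Lp.memLp f).norm.coeFn_toLp,
      indicatorConstLp_coeFn (p := 2) (hs := hS) (hμs := hfin) (c := b)] with t h1 h2 h3 h4 h5
    refine h1.trans (le_trans ?_ (le_abs_self _))
    rw [hK, h2, Pi.add_apply, h3, Pi.smul_apply, hF, h4, h5, smul_eq_mul]
  refine h1.trans ((norm_add_le _ _).trans_eq ?_)
  rw [norm_smul, hFn, norm_indicatorConstLp (by norm_num) (by norm_num), Real.norm_of_nonneg ha,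
    Real.norm_of_nonneg hb, Real.sqrt_eq_rpow]
  simp

/-- The cells of a uniform grid. -/
def cell (δ : ℝ) (k : ℤ) : Set ℝ := Set.Ico (k * δ) ((k + 1) * δ)

theorem mem_cell_iff {δ : ℝ} (hδ : 0 < δ) {k : ℤ} {t : ℝ} : t ∈ cell δ k ↔ ⌊t / δ⌋ = k := by
  rw [Int.floor_eq_iff, le_div_iff₀ hδ, div_lt_iff₀ hδ, cell, Set.mem_Ico]

theorem measurableSet_cell (δ : ℝ) (k : ℤ) : MeasurableSet (cell δ k) := measurableSet_Ico

theorem volume_cell_ne_top (δ : ℝ) (k : ℤ) : volume (cell δ k) ≠ ∞ := by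
  simp [cell]

theorem volume_real_cell {δ : ℝ} (hδ : 0 < δ) (k : ℤ) : volume.real (cell δ k) = δ := by
  rw [cell, Real.volume_real_Ico_of_le (by nlinarith)]
  ring

/-- Values of a function with square integrable derivative are close to its averages. -/
theorem norm_sub_average_le {f p : L2 H} {u : ℝ → H} (hf : f =ᵐ[volume] u)
    (hu : IsPrimitive u fun x => p x) {δ : ℝ} (hδ : 0 < δ) {k : ℤ} {t : ℝ} (ht : t ∈ cell δ k) :
    ‖u t - (δ⁻¹ : ℂ) • ContinuousLinearMap.adjoint
      (embL2 H (measurableSet_cell δ k) (volume_cell_ne_top δ k)) f‖ ≤ Real.sqrt δ * ‖p‖ := by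
  have h1 : ∫ r in cell δ k, f r = ∫ r in cell δ k, u r :=
    integral_congr_ae (ae_restrict_of_ae hf)
  have hvol := volume_real_cell hδ k
  have hi : IntegrableOn u (cell δ k) volume :=
    (hu.continuous.integrableOn_Icc).mono_set Set.Ico_subset_Icc_self
  have hic : IntegrableOn (fun _ => u t) (cell δ k) volume :=
    integrableOn_const (volume_cell_ne_top δ k)
  have h2 : (δ : ℂ) • (u t - (δ⁻¹ : ℂ) • ∫ r in cell δ k, u r) = ∫ r in cell δ k, (u t - u r) := by
    rw [integral_sub hic hi, setIntegral_const, hvol, smul_sub, smul_smul,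
      mul_inv_cancel₀ (by exact_mod_cast hδ.ne'), one_smul, Complex.coe_smul]
  have h3 : ‖∫ r in cell δ k, (u t - u r)‖ ≤ Real.sqrt δ * ‖p‖ * volume.real (cell δ k) := by
    refine norm_setIntegral_le_of_norm_le_const (volume_cell_ne_top δ k).lt_top fun r hr => ?_
    refine (norm_sub_le_of_primitive hu r t).trans ?_
    gcongr
    rw [cell, Set.mem_Ico] at ht hr
    rw [abs_le]
    constructor <;> nlinarith
  rw [adjoint_embL2, h1]
  rw [← h2, norm_smul, hvol, Complex.norm_real, Real.norm_of_nonneg hδ.le, mul_comm] at h3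
  exact le_of_mul_le_mul_right h3 hδ

theorem exists_pos_sqrt_mul_le (c : ℝ) {δ₀ ε : ℝ} (hδ₀ : 0 < δ₀) (hε : 0 < ε) :
    ∃ δ, 0 < δ ∧ δ ≤ δ₀ ∧ Real.sqrt δ * c ≤ ε := by
  have h1 : Tendsto (fun δ : ℝ => Real.sqrt δ * c) (𝓝 0) (𝓝 (Real.sqrt 0 * c)) :=
    (Real.continuous_sqrt.mul continuous_const).tendsto 0
  rw [Real.sqrt_zero, zero_mul] at h1
  have h2 := (h1.eventually (ge_mem_nhds hε)).and (ge_mem_nhds hδ₀)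
  obtain ⟨δ, ⟨h3, h4⟩, h5⟩ := ((h2.filter_mono nhdsWithin_le_nhds).and
    (self_mem_nhdsWithin (s := Set.Ioi (0 : ℝ)))).exists
  exact ⟨δ, h5, h4, h3⟩

/-- A local form of Rellich's theorem: multiplication by a compact operator valued function
vanishing at infinity is compact on functions with derivative in `L²`. -/
theorem finApprox_mulL2_comp (G : ℝ →ᵇ (H →L[ℂ] H)) (hG : ∀ t, FinApprox (G t))
    (h0 : Tendsto G (cocompact ℝ) (𝓝 0)) (Q Q' : L2 H →L[ℂ] L2 H)
    (hQ : ∀ h, (Q h, Q' h) ∈ ddtGraph H) : FinApprox ((mulL2 G).comp Q) := by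
  refine finApprox_of_forall fun ε hε => ?_
  -- The error has two parts: ε₁ ‖Q h‖, from the oscillation of G within a cell and its tail outside
  -- J, and at most ε₁ ‖h‖, from averaging. They add up to ε ‖h‖.
  set ε₁ := ε / (‖Q‖ + 1) with hε₁
  have hε₁' : 0 < ε₁ := by positivity
  have hsum : ε₁ * ‖Q‖ + ε₁ = ε := by rw [hε₁]; field_simp
  obtain ⟨δ₀, hδ₀, huc⟩ := Metric.uniformContinuous_iff_le.1
    (G.continuous.uniformContinuous_of_tendsto_cocompact h0) ε₁ hε₁'
  obtain ⟨T, hT⟩ : ∃ T : ℝ, ∀ t, T ≤ |t| → ‖G t‖ ≤ ε₁ := by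
    have h1 : ∀ᶠ t in cocompact ℝ, ‖G t‖ ≤ ε₁ :=
      h0.norm.eventually (ge_mem_nhds (by rwa [norm_zero]))
    rw [← Metric.cobounded_eq_cocompact, ← comap_norm_atTop, eventually_comap] at h1
    obtain ⟨T, hT⟩ := eventually_atTop.1 h1
    exact ⟨T, fun t ht => hT _ ht t rfl⟩
  -- Besides making averaging errors small, δ ≤ δ₀ controls the oscillation of G in a cell, and δ ≤
  -- 1 allows whole cells to cover [-|T|, |T|) with N δ ≤ |T| + 1.
  obtain ⟨δ, hδ, hδ1, hδ2⟩ := exists_pos_sqrt_mul_le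
    (‖G‖ * ‖Q'‖ * Real.sqrt (2 * (|T| + 1))) (lt_min hδ₀ one_pos) hε₁'
  obtain ⟨N, hN⟩ : ∃ N : ℕ, |T| ≤ N * δ ∧ N * δ ≤ |T| + 1 := by
    refine ⟨⌈|T| / δ⌉₊, ?_, ?_⟩
    · rw [← div_le_iff₀ hδ]; exact Nat.le_ceil _
    · have := (Nat.ceil_lt_add_one (div_nonneg (abs_nonneg T) hδ.le)).le
      calc (⌈|T| / δ⌉₊ : ℝ) * δ ≤ (|T| / δ + 1) * δ := by gcongr
        _ = |T| + δ := by field_simp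
        _ ≤ _ := by gcongr; exact hδ1.trans (min_le_right _ _)
  let ι : ℤ → (H →L[ℂ] L2 H) := fun k => embL2 H (measurableSet_cell δ k) (volume_cell_ne_top δ k)
  -- On each of finitely many cells, replace Q h by its average and G by its value at the left
  -- endpoint. Each summand factors through one G (k δ), hence is a norm limit of finite rank
  -- operators.
  let S : L2 H →L[ℂ] L2 H := ∑ k ∈ Finset.Ico (-(N : ℤ)) N,
    (ι k).comp ((G (k * δ)).comp (((δ⁻¹ : ℂ) • ContinuousLinearMap.adjoint (ι k)).comp Q))
  refine ⟨S, FinApprox.sum _ fun k _ => ((hG _).comp_clm _).clm_comp _, ?_⟩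
  refine ContinuousLinearMap.opNorm_le_bound _ hε.le fun h => ?_
  obtain ⟨u, hu1, hu⟩ := mem_ddtGraph_iff.1 (hQ h)
  set v : ℤ → H := fun k => G (k * δ) ((δ⁻¹ : ℂ) • ContinuousLinearMap.adjoint (ι k) (Q h)) with hv
  set J : Set ℝ := Set.Ico (-(N : ℝ) * δ) (N * δ) with hJ
  have hJS : ∀ t, t ∈ J ↔ ⌊t / δ⌋ ∈ Finset.Ico (-(N : ℤ)) N := by
    intro t
    rw [Finset.mem_Ico, Int.le_floor, Int.floor_lt, le_div_iff₀ hδ, div_lt_iff₀ hδ, hJ, Set.mem_Ico]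
    push_cast
    rfl
  have hSv : S h = ∑ k ∈ Finset.Ico (-(N : ℤ)) N, ι k (v k) := by
    simp [S, hv]
  have hSt : ∀ᵐ t, S h t = J.indicator (fun t => v ⌊t / δ⌋) t := by
    rw [hSv]
    have h1 : ∀ᵐ t, ∀ k : ℤ, ι k (v k) t = (cell δ k).indicator (fun _ => v k) t :=
      ae_all_iff.2 fun k => coeFn_embL2 _ _ _
    filter_upwards [Lp.coeFn_fun_finsetSum (Finset.Ico (-(N : ℤ)) N) (fun k => ι k (v k)), h1]
      with t h1 h2
    rw [h1]
    have h3 : ∀ k, (cell δ k).indicator (fun _ => v k) t = if ⌊t / δ⌋ = k then v k else 0 := by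
      intro k
      by_cases hk : ⌊t / δ⌋ = k
      · rw [if_pos hk, Set.indicator_of_mem ((mem_cell_iff hδ).2 hk)]
      · rw [if_neg hk, Set.indicator_of_notMem fun hc => hk ((mem_cell_iff hδ).1 hc)]
    simp only [h2, h3, Finset.sum_ite_eq]
    by_cases ht : t ∈ J
    · rw [if_pos ((hJS t).1 ht), Set.indicator_of_mem ht]
    · rw [if_neg fun hc => ht ((hJS t).2 hc), Set.indicator_of_notMem ht]
  have hb : 0 ≤ ‖G‖ * (Real.sqrt δ * ‖Q' h‖) := by positivity
  have key := norm_le_of_ae_le_indicator (w := mulL2 G (Q h) - S h) (f := Q h) (S := J)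
    measurableSet_Ico (by simp [hJ]) hε₁'.le hb (by
    filter_upwards [hSt, Lp.coeFn_sub (mulL2 G (Q h)) (S h), coeFn_mulL2 G (Q h), hu1]
      with t h1 h2 h3 h4
    rw [h2, Pi.sub_apply, h1, h3]
    by_cases ht : t ∈ J
    · rw [Set.indicator_of_mem ht, Set.indicator_of_mem ht]
      set k := ⌊t / δ⌋ with hk
      have htc : t ∈ cell δ k := (mem_cell_iff hδ).2 rfl
      have h5 := norm_sub_average_le hu1 hu hδ htc
      have h6 : ‖G t - G (k * δ)‖ ≤ ε₁ := by
        rw [← dist_eq_norm]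
        refine huc ?_
        rw [cell, Set.mem_Ico] at htc
        rw [Real.dist_eq, abs_le]
        have := hδ1.trans (min_le_left _ _)
        constructor <;> nlinarith
      have h7 : G t (Q h t) - v k = (G t - G (k * δ)) (Q h t) +
          G (k * δ) (Q h t - (δ⁻¹ : ℂ) • ContinuousLinearMap.adjoint (ι k) (Q h)) := by
        rw [map_sub, sub_apply, hv]
        abel
      rw [h7]
      refine (norm_add_le _ _).trans (add_le_add ?_ ?_)
      · exact (ContinuousLinearMap.le_opNorm _ _).trans (by gcongr)
      · refine (ContinuousLinearMap.le_opNorm _ _).trans ?_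
        rw [h4]
        gcongr
        exact G.norm_coe_le_norm _
    · rw [Set.indicator_of_notMem ht, Set.indicator_of_notMem ht, sub_zero, add_zero]
      have h5 : T ≤ |t| := by
        refine (le_abs_self T).trans (hN.1.trans ?_)
        rw [hJ, Set.mem_Ico, not_and_or, not_le, not_lt] at ht
        rcases ht with h | h
        · have := neg_le_abs t; linarith
        · exact h.trans (le_abs_self t)
      exact (ContinuousLinearMap.le_opNorm _ _).trans
        (mul_le_mul_of_nonneg_right (hT t h5) (norm_nonneg _)))
  have hvolJ : volume.real J ≤ 2 * (|T| + 1) := by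
    rw [hJ, Real.volume_real_Ico_of_le (by nlinarith [Nat.cast_nonneg (α := ℝ) N])]
    linarith [hN.2]
  rw [sub_apply, ContinuousLinearMap.comp_apply]
  refine key.trans ?_
  calc _ ≤ ε₁ * (‖Q‖ * ‖h‖) + ‖G‖ * (Real.sqrt δ * (‖Q'‖ * ‖h‖)) * Real.sqrt (2 * (|T| + 1)) := by
        gcongr
        · exact Q.le_opNorm h
        · exact Q'.le_opNorm h
    _ = ε₁ * ‖Q‖ * ‖h‖ + Real.sqrt δ * (‖G‖ * ‖Q'‖ * Real.sqrt (2 * (|T| + 1))) * ‖h‖ := by ring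
    _ ≤ ε₁ * ‖Q‖ * ‖h‖ + ε₁ * ‖h‖ := by gcongr
    _ = _ := by rw [← hsum]; ring

end Local

/-! ### Abstract criteria for semi-Fredholm properties and for their failure. -/

section Fredholm

variable {E : Type*} [NormedAddCommGroup E] [InnerProductSpace ℂ E] [CompleteSpace E]
variable {T : E →ₗ.[ℂ] E}

theorem mem_graph_adjoint_iff (hT : Dense (T.domain : Set E)) {x y : E} :
    (x, y) ∈ T†.graph ↔ ∀ u v, (u, v) ∈ T.graph → ⟪v, x⟫_ℂ = ⟪u, y⟫_ℂ := by
  have h := Submodule.mem_adjoint_iff T.graph (x, y)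
  rw [← T.adjoint_graph_eq_graph_adjoint hT] at h
  simpa only [sub_eq_zero] using h

/-- The kernel of an unbounded operator, as a subspace of the whole space. -/
def kerOp (T : E →ₗ.[ℂ] E) : Submodule ℂ E :=
  T.graph.comap (LinearMap.inl ℂ E E)

theorem mem_kerOp {x : E} : x ∈ kerOp T ↔ (x, 0) ∈ T.graph := Iff.rfl

theorem map_ker_eq_kerOp : (LinearMap.ker T.toFun).map T.domain.subtype = kerOp T := by
  ext x
  simp only [Submodule.mem_map, LinearMap.mem_ker, mem_kerOp, LinearPMap.mem_graph_iff]
  constructor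
  · rintro ⟨u, h1, h2⟩
    exact ⟨u, h2, h1⟩
  · rintro ⟨u, h1, h2⟩
    exact ⟨u, h2, h1⟩

theorem finiteDimensional_ker_iff :
    FiniteDimensional ℂ (LinearMap.ker T.toFun) ↔ FiniteDimensional ℂ (kerOp T) := by
  rw [← map_ker_eq_kerOp]
  let e := (LinearMap.ker T.toFun).equivMapOfInjective _ T.domain.injective_subtype
  exact ⟨fun _ => Module.Finite.equiv e, fun _ => Module.Finite.equiv e.symm⟩

theorem mem_range_iff {y : E} : y ∈ LinearMap.range T.toFun ↔ ∃ x, (x, y) ∈ T.graph := by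
  simp only [LinearMap.mem_range, LinearPMap.mem_graph_iff]
  constructor
  · rintro ⟨u, h⟩
    exact ⟨u, u, rfl, h⟩
  · rintro ⟨_, u, -, h⟩
    exact ⟨u, h⟩

theorem kerOp_adjoint (hT : Dense (T.domain : Set E)) :
    kerOp T† = (LinearMap.range T.toFun)ᗮ := by
  ext x
  rw [mem_kerOp, mem_graph_adjoint_iff hT, Submodule.mem_orthogonal]
  simp only [inner_zero_right, mem_range_iff]
  exact ⟨fun h v ⟨u, hu⟩ => h u v hu, fun h u v hu => h v ⟨u, hu⟩⟩

/-- An operator with a right parametrix has closed range of finite codimension. -/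
theorem lowerSemiFredholm_of_parametrix (hT : Dense (T.domain : Set E)) {K V : E →L[ℂ] E}
    (hK : FinApprox K) (hV : ‖V‖ ≤ 1 / 2) (h : ∀ x, ∃ u, (u, x + V x + K x) ∈ T.graph) :
    IsLowerSemiFredholm T := by
  -- As 1/2 + 1/4 < 1, the operator 1 + V + (K - F) is invertible, with inverse W.
  obtain ⟨F, hF, hKF⟩ := hK (1 / 4) (by norm_num)
  have hu : IsUnit (1 + (V + (K - F))) := by
    have := isUnit_one_sub_of_norm_lt_one (x := -(V + (K - F))) (by
      rw [norm_neg]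
      linarith [norm_add_le V (K - F)])
    rwa [sub_neg_eq_add] at this
  obtain ⟨U, hU⟩ := hu
  set W : E →L[ℂ] E := ((U⁻¹ : (E →L[ℂ] E)ˣ) : E →L[ℂ] E) with hW
  have hUW : ∀ y, W y + (V (W y) + (K (W y) - F (W y))) = y := by
    intro y
    have h1 : ((U : E →L[ℂ] E) * W) y = y := by rw [hW, Units.mul_inv]; rfl
    rw [hU] at h1
    simpa using h1
  -- Where F W y = 0 the remainder is absent and y = (1 + V + K) W y lies in the range of T. So the
  -- range contains a closed subspace of finite codimension, which makes it closed.
  set M : Submodule ℂ E := LinearMap.ker ((F.comp W : E →L[ℂ] E) : E →ₗ[ℂ] E) with hM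
  have hMc : IsClosed (M : Set E) := (F.comp W).isClosed_ker
  have hMr : M ≤ LinearMap.range T.toFun := by
    intro y hy
    have h1 : F (W y) = 0 := hy
    obtain ⟨u, h2⟩ := h (W y)
    have h3 := hUW y
    rw [h1, sub_zero, ← add_assoc] at h3
    rw [h3] at h2
    exact mem_range_iff.2 ⟨u, h2⟩
  have hfin : FiniteDimensional ℂ (LinearMap.range ((F.comp W : E →L[ℂ] E) : E →ₗ[ℂ] E)) := by
    refine Submodule.finiteDimensional_of_le (S₂ := LinearMap.range (F : E →ₗ[ℂ] E)) ?_
    rintro _ ⟨x, rfl⟩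
    exact ⟨W x, rfl⟩
  have hq : FiniteDimensional ℂ (E ⧸ M) :=
    Module.Finite.equiv (LinearMap.quotKerEquivRange _).symm
  refine ⟨Submodule.isClosed_mono_of_finiteDimensional_quotient hMc hMr, ?_⟩
  rw [finiteDimensional_ker_iff, kerOp_adjoint hT]
  have : CompleteSpace M := hMc.completeSpace_coe
  have hMo : FiniteDimensional ℂ Mᗮ :=
    Module.Finite.equiv (Submodule.quotientEquivOfIsCompl M Mᗮ M.isCompl_orthogonal)
  exact Submodule.finiteDimensional_of_le (Submodule.orthogonal_le hMr)

/-- A lower bound for an operator with closed range, modulo its kernel. -/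
theorem exists_ker_approx (hc : T.IsClosed) (hr : HasClosedRange T) :
    ∃ c, 0 ≤ c ∧ ∀ y, (∃ u, (u, y) ∈ T.graph) → ∃ x, (x, y) ∈ T.graph ∧ ‖x‖ ≤ c * ‖y‖ := by
  have h1 : IsClosed (T.graph : Set (E × E)) := hc
  have : CompleteSpace T.graph := h1.completeSpace_coe
  have h2 : IsClosed (LinearMap.range T.toFun : Set E) := hr
  have : CompleteSpace (LinearMap.range T.toFun) := h2.completeSpace_coe
  let π : T.graph →L[ℂ] LinearMap.range T.toFun :=
    ((ContinuousLinearMap.snd ℂ E E).comp T.graph.subtypeL).codRestrict _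
      fun p => mem_range_iff.2 ⟨p.1.1, p.2⟩
  have hs : Function.Surjective π := by
    rintro ⟨y, hy⟩
    obtain ⟨x, hx⟩ := mem_range_iff.1 hy
    exact ⟨⟨(x, y), hx⟩, rfl⟩
  obtain ⟨c, hc0, h⟩ := π.exists_preimage_norm_le hs
  refine ⟨c, hc0.le, fun y hy => ?_⟩
  obtain ⟨⟨⟨x, y'⟩, hp⟩, h3, h4⟩ := h ⟨y, mem_range_iff.2 hy⟩
  have h5 : y' = y := congrArg Subtype.val h3
  subst h5
  exact ⟨x, hp, (norm_fst_le (x, y')).trans h4⟩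

theorem exists_dist_ker_le (hc : T.IsClosed) (hr : HasClosedRange T) :
    ∃ c, 0 ≤ c ∧ ∀ x y, (x, y) ∈ T.graph → ∃ k ∈ kerOp T, ‖x - k‖ ≤ c * ‖y‖ := by
  obtain ⟨c, hc0, h⟩ := exists_ker_approx hc hr
  refine ⟨c, hc0, fun x y hxy => ?_⟩
  obtain ⟨u, hu, h1⟩ := h y ⟨x, hxy⟩
  refine ⟨x - u, ?_, by simpa using h1⟩
  have := T.graph.sub_mem hxy hu
  rwa [Prod.mk_sub_mk, sub_self] at this

/-- Split z = r + k along ran T and ker T*, and write r = T x with ‖x‖ ≤ c ‖r‖. Then ‖r‖² = ⟪T x, z⟫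
= ⟪x, w⟫ ≤ c ‖r‖ ‖w‖. The closed range theorem for T* is not needed. -/
theorem exists_dist_ker_adjoint_le (hT : Dense (T.domain : Set E)) (hc : T.IsClosed)
    (hr : HasClosedRange T) :
    ∃ c, 0 ≤ c ∧ ∀ x y, (x, y) ∈ T†.graph → ∃ k ∈ kerOp T†, ‖x - k‖ ≤ c * ‖y‖ := by
  obtain ⟨c, hc0, h⟩ := exists_ker_approx hc hr
  have h2 : IsClosed (LinearMap.range T.toFun : Set E) := hr
  have : CompleteSpace (LinearMap.range T.toFun) := h2.completeSpace_coe
  refine ⟨c, hc0, fun z w hzw => ?_⟩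
  rw [kerOp_adjoint hT]
  obtain ⟨r, hr, k, hk, rfl⟩ := (LinearMap.range T.toFun).exists_add_mem_mem_orthogonal z
  refine ⟨k, hk, ?_⟩
  rw [add_sub_cancel_right]
  obtain ⟨x, hx, h1⟩ := h r (mem_range_iff.1 hr)
  have h3 := (mem_graph_adjoint_iff hT).1 hzw _ _ hx
  rw [inner_add_right, Submodule.inner_right_of_mem_orthogonal hr hk, add_zero] at h3
  have h4 : ‖r‖ * ‖r‖ ≤ c * ‖w‖ * ‖r‖ := by
    have h5 : ‖⟪r, r⟫_ℂ‖ = ‖r‖ * ‖r‖ := by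
      rw [inner_self_eq_norm_sq_to_K]; simp [sq]
    rw [← h5, h3]
    refine (norm_inner_le_norm _ _).trans ?_
    calc ‖x‖ * ‖w‖ ≤ c * ‖r‖ * ‖w‖ := by gcongr
      _ = _ := by ring
  rcases (norm_nonneg r).eq_or_lt with h6 | h6
  · rw [← h6]; positivity
  · exact le_of_mul_le_mul_right h4 h6

/-- A vector close to a finite dimensional subspace and almost orthogonal to it vanishes. -/
theorem eq_zero_of_close {N : Submodule ℂ E} [FiniteDimensional ℂ N] {c : ℝ} (hc : 0 ≤ c) :
    ∃ ε > 0, ∃ (m : ℕ) (e : Fin m → E), ∀ f k, k ∈ N → ‖f - k‖ ≤ c * (ε * ‖f‖) →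
      (∀ j, ‖⟪e j, f⟫_ℂ‖ ≤ ε * ‖f‖) → f = 0 := by
  set m := Module.finrank ℂ N
  let b := stdOrthonormalBasis ℂ N
  have hpos : 0 < 2 * (m + 2 * c + 1) := by positivity
  refine ⟨1 / (2 * (m + 2 * c + 1)), by positivity, m, fun j => (b j : E), fun f k hk h1 h2 => ?_⟩
  -- With an orthonormal basis of N as test vectors one gets ‖k‖ ≤ (m + c) ε ‖f‖, hence ‖f‖ ≤ (m +
  -- 2c) ε ‖f‖ ≤ ‖f‖ / 2.
  set ε := 1 / (2 * (m + 2 * c + 1)) with hε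
  have hε0 : 0 < ε := by positivity
  have h3 : ‖⟪k, f⟫_ℂ‖ ≤ ‖k‖ * (m * (ε * ‖f‖)) := by
    have e1 : k = ∑ j, ⟪(b j : E), k⟫_ℂ • (b j : E) := by
      have := congrArg (Subtype.val) (b.sum_repr' ⟨k, hk⟩)
      simpa using this.symm
    have e2 : ⟪k, f⟫_ℂ = ∑ j, starRingEnd ℂ ⟪(b j : E), k⟫_ℂ * ⟪(b j : E), f⟫_ℂ := by
      conv_lhs => rw [e1]
      rw [sum_inner]
      simp only [inner_smul_left]
    rw [e2]
    refine (norm_sum_le _ _).trans ?_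
    have e3 : ∀ j ∈ Finset.univ, ‖starRingEnd ℂ ⟪(b j : E), k⟫_ℂ * ⟪(b j : E), f⟫_ℂ‖ ≤
        ‖k‖ * (ε * ‖f‖) := by
      intro j _
      rw [norm_mul, RCLike.norm_conj]
      have e4 : ‖(b j : E)‖ = 1 := b.orthonormal.1 j
      have e5 := norm_inner_le_norm (𝕜 := ℂ) (b j : E) k
      rw [e4, one_mul] at e5
      exact mul_le_mul e5 (h2 j) (norm_nonneg _) (norm_nonneg _)
    refine (Finset.sum_le_card_nsmul _ _ _ e3).trans_eq ?_
    rw [Finset.card_univ, Fintype.card_fin, nsmul_eq_mul]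
    ring
  have h4 : ‖k‖ ≤ (m + c) * (ε * ‖f‖) := by
    have e1 : ‖k‖ * ‖k‖ ≤ ‖k‖ * ((m + c) * (ε * ‖f‖)) := by
      have e2 : ‖k‖ * ‖k‖ = ‖⟪k, k⟫_ℂ‖ := by rw [inner_self_eq_norm_sq_to_K]; simp [sq]
      have e3 : ⟪k, k⟫_ℂ = ⟪k, f⟫_ℂ - ⟪k, f - k⟫_ℂ := by rw [inner_sub_right]; ring
      rw [e2, e3]
      refine (norm_sub_le _ _).trans ?_
      have e4 : ‖⟪k, f - k⟫_ℂ‖ ≤ ‖k‖ * (c * (ε * ‖f‖)) :=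
        (norm_inner_le_norm _ _).trans (by gcongr)
      calc _ ≤ ‖k‖ * (m * (ε * ‖f‖)) + ‖k‖ * (c * (ε * ‖f‖)) := add_le_add h3 e4
        _ = _ := by ring
    rcases (norm_nonneg k).eq_or_lt with h6 | h6
    · rw [← h6]; positivity
    · exact le_of_mul_le_mul_left e1 h6
  have h5 : ‖f‖ ≤ ‖k‖ + ‖f - k‖ := by
    have := norm_add_le k (f - k)
    rwa [add_sub_cancel] at this
  have h6 : (m + 2 * c) * ε ≤ 1 / 2 := by
    rw [hε, mul_one_div, div_le_div_iff₀ hpos two_pos]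
    linarith
  have h7 : (m + 2 * c) * ε * ‖f‖ ≤ 1 / 2 * ‖f‖ := by gcongr
  have h8 : ‖f‖ ≤ 0 := by nlinarith [norm_nonneg f]
  exact norm_le_zero_iff.1 h8

/-- A closed operator with suitable approximate null vectors, common to the operator and to its
adjoint and tending weakly to zero, is not semi-Fredholm. -/
theorem not_semiFredholm_of_approx (hT : Dense (T.domain : Set E)) (hc : T.IsClosed)
    (h : ∀ ε > 0, ∀ (m : ℕ) (e : Fin m → E), ∃ f g g', f ≠ 0 ∧ (f, g) ∈ T.graph ∧
      (f, g') ∈ T†.graph ∧ ‖g‖ ≤ ε * ‖f‖ ∧ ‖g'‖ ≤ ε * ‖f‖ ∧ ∀ j, ‖⟪e j, f⟫_ℂ‖ ≤ ε * ‖f‖) :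
    ¬ IsUpperSemiFredholm T ∧ ¬ IsLowerSemiFredholm T := by
  constructor
  · rintro ⟨hr, hk⟩
    rw [finiteDimensional_ker_iff] at hk
    obtain ⟨c, hc0, h1⟩ := exists_dist_ker_le hc hr
    obtain ⟨ε, hε, m, e, h2⟩ := eq_zero_of_close (N := kerOp T) hc0
    obtain ⟨f, g, g', hf, h3, -, h4, -, h5⟩ := h ε hε m e
    obtain ⟨k, hk, h6⟩ := h1 _ _ h3
    exact hf (h2 f k hk (h6.trans (by gcongr)) h5)
  · rintro ⟨hr, hk⟩
    rw [finiteDimensional_ker_iff] at hk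
    obtain ⟨c, hc0, h1⟩ := exists_dist_ker_adjoint_le hT hc hr
    obtain ⟨ε, hε, m, e, h2⟩ := eq_zero_of_close (N := kerOp T†) hc0
    obtain ⟨f, g, g', hf, -, h3, -, h4, h5⟩ := h ε hε m e
    obtain ⟨k, hk, h6⟩ := h1 _ _ h3
    exact hf (h2 f k hk (h6.trans (by gcongr)) h5)

end Fredholm

/-! ### Cutoffs, and compactness relative to the inverses of model operators. -/

section Parametrix

open scoped BoundedContinuousFunction

variable {H : Type*} [NormedAddCommGroup H] [InnerProductSpace ℂ H] [CompleteSpace H]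
variable {A : H →ₗ.[ℂ] H} {D : H →L[ℂ] H}

/-- Multiplication by a bounded continuous real function. -/
def realMul (H : Type*) [NormedAddCommGroup H] [InnerProductSpace ℂ H] (φ : ℝ →ᵇ ℝ) :
    ℝ →ᵇ (H →L[ℂ] H) :=
  BoundedContinuousFunction.ofNormedAddCommGroup
    (fun t => ((φ t : ℝ) : ℂ) • ContinuousLinearMap.id ℂ H)
    ((Complex.continuous_ofReal.comp φ.continuous).smul continuous_const) ‖φ‖ fun t => by
      rw [norm_smul, Complex.norm_real]
      exact (mul_le_of_le_one_right (norm_nonneg _) ContinuousLinearMap.norm_id_le).trans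
        (φ.norm_coe_le_norm t)

theorem realMul_apply (φ : ℝ →ᵇ ℝ) (t : ℝ) (x : H) : realMul H φ t x = φ t • x := by
  rw [← Complex.coe_smul]
  rfl

theorem norm_realMul_apply_le (φ : ℝ →ᵇ ℝ) (t : ℝ) : ‖realMul H φ t‖ ≤ |φ t| :=
  ContinuousLinearMap.opNorm_le_bound _ (abs_nonneg _) fun x => by
    rw [realMul_apply, norm_smul, Real.norm_eq_abs]

theorem realMul_comm (φ : ℝ →ᵇ ℝ) (G : ℝ →ᵇ (H →L[ℂ] H)) : realMul H φ * G = G * realMul H φ := by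
  ext t x
  change realMul H φ t (G t x) = G t (realMul H φ t x)
  rw [realMul_apply, realMul_apply, ← Complex.coe_smul, ← Complex.coe_smul, map_smul]

theorem coeFn_realMul (φ : ℝ →ᵇ ℝ) (f : L2 H) :
    mulL2 (realMul H φ) f =ᵐ[volume] fun t => φ t • f t := by
  filter_upwards [coeFn_mulL2 (realMul H φ) f] with t ht
  rw [ht, realMul_apply]

theorem realMul_mem_ddtGraph {φ φ' : ℝ →ᵇ ℝ} (hφ : ∀ t, HasDerivAt φ (φ' t) t) {f f' : L2 H}
    (h : (f, f') ∈ ddtGraph H) :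
    (mulL2 (realMul H φ) f, mulL2 (realMul H φ') f + mulL2 (realMul H φ) f') ∈ ddtGraph H := by
  refine smul_mem_ddtGraph hφ φ'.continuous h (coeFn_realMul φ f) ?_
  filter_upwards [coeFn_realMul φ' f, coeFn_realMul φ f',
    Lp.coeFn_add (mulL2 (realMul H φ') f) (mulL2 (realMul H φ) f')] with t h1 h2 h3
  rw [h3, Pi.add_apply, h1, h2]

theorem realMul_mem_fiberGraph (φ : ℝ →ᵇ ℝ) {f a : L2 H} (h : (f, a) ∈ fiberGraph fun _ => A) :
    (mulL2 (realMul H φ) f, mulL2 (realMul H φ) a) ∈ fiberGraph fun _ => A := by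
  rw [mem_fiberGraph_iff] at h ⊢
  filter_upwards [h, coeFn_realMul φ f, coeFn_realMul φ a] with t h1 h2 h3
  simp only [h2, h3]
  have := A.graph.smul_mem (φ t : ℂ) h1
  rwa [Prod.smul_mk, Complex.coe_smul, Complex.coe_smul] at this

/-- Slowly varying smooth steps. -/
theorem exists_slow_step {ε : ℝ} (hε : 0 < ε) : ∃ φ φ' : ℝ →ᵇ ℝ, (∀ t, HasDerivAt φ (φ' t) t) ∧
    (∀ t, |φ' t| ≤ ε) ∧ (∀ t, |φ t| ≤ 1) ∧ (∀ t, |1 - φ t| ≤ 1) ∧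
    Tendsto φ atBot (𝓝 0) ∧ Tendsto φ atTop (𝓝 1) := by
  have h0 : ∀ t, 0 ≤ Real.sigmoid t := Real.sigmoid_nonneg
  have h1 : ∀ t, Real.sigmoid t ≤ 1 := Real.sigmoid_le_one
  have hc : Continuous fun t => Real.sigmoid (ε * t) :=
    continuous_sigmoid.comp (continuous_const.mul continuous_id)
  have hb : ∀ t, |Real.sigmoid (ε * t)| ≤ 1 := fun t => by
    rw [abs_of_nonneg (h0 _)]; exact h1 _
  have hb' : ∀ t, |1 - Real.sigmoid (ε * t)| ≤ 1 := fun t => by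
    rw [abs_of_nonneg (sub_nonneg.2 (h1 _))]; linarith [h0 (ε * t)]
  have hd : ∀ t, |Real.sigmoid (ε * t) * (1 - Real.sigmoid (ε * t)) * ε| ≤ ε := by
    intro t
    rw [abs_mul, abs_mul, abs_of_pos hε]
    exact mul_le_of_le_one_left hε.le (mul_le_one₀ (hb t) (abs_nonneg _) (hb' t))
  refine ⟨BoundedContinuousFunction.ofNormedAddCommGroup _ hc 1 hb,
    BoundedContinuousFunction.ofNormedAddCommGroup
      (fun t => Real.sigmoid (ε * t) * (1 - Real.sigmoid (ε * t)) * ε)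
      ((hc.mul (continuous_const.sub hc)).mul continuous_const) ε hd, fun t => ?_, hd, hb, hb',
    Real.tendsto_sigmoid_atBot.comp (tendsto_id.const_mul_atBot hε),
    Real.tendsto_sigmoid_atTop.comp (tendsto_id.const_mul_atTop hε)⟩
  have h2 : HasDerivAt (fun t : ℝ => ε * t) ε t := by
    simpa using (hasDerivAt_id t).const_mul ε
  exact (Real.hasDerivAt_sigmoid (ε * t)).comp t h2

/-- Multiplication by compact operator valued functions vanishing at infinity is compact relative
to the inverse of a model operator. -/
theorem IsModelInverse.finApprox {Q W : L2 H →L[ℂ] L2 H} (h : IsModelInverse A D Q W)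
    (hA : IsSelfAdjoint A) (G : ℝ →ᵇ (H →L[ℂ] H)) (hG : ∀ t, FinApprox (G t))
    (h0 : Tendsto G (cocompact ℝ) (𝓝 0))
    (hu : ∀ ε > 0, ∀ᶠ μ in Bornology.cobounded ℝ, ∀ t, ‖G t * cayleyOp A μ‖ ≤ ε) :
    FinApprox ((mulL2 G).comp W) := by
  refine finApprox_of_forall fun ε hε => ?_
  set X : L2 H →L[ℂ] L2 H := W + Complex.I • Q with hX
  obtain ⟨μ, hμ, h1⟩ := ((hu (ε / (‖X‖ + 1)) (by positivity)).and
    ((tendsto_norm_cobounded_atTop (E := ℝ)).eventually (eventually_ge_atTop 1))).exists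
  have hμ0 : μ ≠ 0 := by rintro rfl; rw [norm_zero] at h1; linarith
  set K : ℝ →ᵇ (H →L[ℂ] H) := G * BoundedContinuousFunction.const ℝ (cayleyOp A μ) with hK
  have hK0 : Tendsto K (cocompact ℝ) (𝓝 0) := by
    have := h0.mul_const (cayleyOp A μ)
    rw [zero_mul] at this
    exact this
  have hfin := finApprox_mulL2_comp K (fun t => (hG t).comp_clm _) hK0 Q
    (1 - X - (constL2 D).comp W) (fun x => h.ddt x)
  refine ⟨(-((μ : ℂ) * Complex.I)) • (mulL2 K).comp Q, hfin.smul _, ?_⟩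
  -- W = (A - i) Q is not differentiable, unlike Q. Since (A - i) Q = U (A - iμ) Q with U = (A -
  -- i)(A - iμ)⁻¹ and X = A Q, one has G W = K X - iμ K Q for K = G U. The first term is small by
  -- the choice of μ, the second is covered by the Rellich argument.
  have e : (mulL2 G).comp W - (-((μ : ℂ) * Complex.I)) • (mulL2 K).comp Q = (mulL2 K).comp X := by
    ext1 x
    have h2 := mulL2_sub_smul hA hμ0 G (h.fiber x)
    rw [add_sub_cancel_right] at h2
    change mulL2 G (W x) - (-((μ : ℂ) * Complex.I)) • mulL2 K (Q x) =
      mulL2 K (W x + Complex.I • Q x)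
    rw [h2, map_sub, map_smul]
    module
  rw [e]
  refine (ContinuousLinearMap.opNorm_comp_le _ _).trans ?_
  calc ‖mulL2 K‖ * ‖X‖ ≤ ε / (‖X‖ + 1) * ‖X‖ := by
        gcongr
        exact norm_mulL2_le fun t => hμ t
    _ ≤ ε := by
        rw [div_mul_eq_mul_div, div_le_iff₀ (by positivity)]
        nlinarith [norm_nonneg X]

theorem fiber_unique {f a b : L2 H} (h1 : (f, a) ∈ fiberGraph fun _ => A)
    (h2 : (f, b) ∈ fiberGraph fun _ => A) : a = b := by
  rw [← graph_fiberOp] at h1 h2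
  exact LinearPMap.mem_graph_snd_inj _ h1 h2 rfl

theorem constL2_zero : constL2 (0 : H →L[ℂ] H) = 0 := by
  rw [← norm_le_zero_iff]
  exact norm_mulL2_le fun t => by simp

section Localized

variable {C : ℝ → H →L[ℂ] H} {Cp : H →L[ℂ] H} (h : RelCompactPath A C Cp) (φ : ℝ →ᵇ ℝ)

/-- The path, cut off at `+ ∞`. -/
def RelCompactPath.cutBot : ℝ →ᵇ (H →L[ℂ] H) := h.bcf - realMul H φ * h.bcf

/-- The difference of the path and its limit, cut off at `- ∞`. -/
def RelCompactPath.cutTop : ℝ →ᵇ (H →L[ℂ] H) :=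
  realMul H φ * h.bcf - realMul H φ * BoundedContinuousFunction.const ℝ Cp

theorem RelCompactPath.cutBot_apply (t : ℝ) : h.cutBot φ t = ((1 - φ t : ℝ) : ℂ) • C t := by
  ext x
  change C t x - realMul H φ t (C t x) = ((1 - φ t : ℝ) : ℂ) • C t x
  rw [realMul_apply, Complex.coe_smul, sub_smul, one_smul]

theorem RelCompactPath.cutTop_apply (t : ℝ) : h.cutTop φ t = ((φ t : ℝ) : ℂ) • (C t - Cp) := by
  ext x
  change realMul H φ t (C t x) - realMul H φ t (Cp x) = ((φ t : ℝ) : ℂ) • (C t x - Cp x)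
  rw [realMul_apply, realMul_apply, Complex.coe_smul, smul_sub]

variable {φ} (hφ : ∀ t, |φ t| ≤ 1) (hφ' : ∀ t, |1 - φ t| ≤ 1) (hb : Tendsto φ atBot (𝓝 0))
  (ht : Tendsto φ atTop (𝓝 1))

include hφ' ht in
-- The product (1 - φ) C vanishes at both ends: at -∞ because C does, at +∞ because 1 - φ does.
theorem RelCompactPath.finApprox_cutBot {Q W : L2 H →L[ℂ] L2 H} (hQ : IsModelInverse A D Q W) :
    FinApprox ((mulL2 (h.cutBot φ)).comp W) := by
  have hn : ∀ t (X : H →L[ℂ] H), ‖((1 - φ t : ℝ) : ℂ) • X‖ ≤ ‖X‖ := fun t X => by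
    rw [norm_smul, Complex.norm_real]
    exact mul_le_of_le_one_left (norm_nonneg _) (hφ' t)
  refine hQ.finApprox h.sa _ (fun t => ?_) ?_ fun ε hε => (h.unif ε hε).mono fun μ hμ t => ?_
  · rw [h.cutBot_apply]
    exact (h.approx t).smul _
  · rw [cocompact_eq_atBot_atTop, tendsto_sup]
    obtain ⟨M, hM⟩ := h.exists_norm_le
    constructor
    · refine squeeze_zero_norm (fun t => ?_) (tendsto_zero_iff_norm_tendsto_zero.1 h.bot)
      rw [h.cutBot_apply]
      exact hn t _
    · refine squeeze_zero_norm (a := fun t => |1 - φ t| * M) (fun t => ?_) ?_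
      · rw [h.cutBot_apply, norm_smul, Complex.norm_real, Real.norm_eq_abs]
        exact mul_le_mul_of_nonneg_left (hM t) (abs_nonneg _)
      · have := ((ht.const_sub 1).abs).mul_const M
        simpa using this
  · rw [h.cutBot_apply, smul_mul_assoc]
    exact (hn t _).trans (hμ t)

include hφ hb in
-- Here φ vanishes at -∞ and C - Cp at +∞. The relative bound for the difference is obtained with
-- ε/2 for each of the two terms, the one for Cp by passing to the limit.
theorem RelCompactPath.finApprox_cutTop {Q W : L2 H →L[ℂ] L2 H} (hQ : IsModelInverse A D Q W) :
    FinApprox ((mulL2 (h.cutTop φ)).comp W) := by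
  have hn : ∀ t (X : H →L[ℂ] H), ‖((φ t : ℝ) : ℂ) • X‖ ≤ ‖X‖ := fun t X => by
    rw [norm_smul, Complex.norm_real]
    exact mul_le_of_le_one_left (norm_nonneg _) (hφ t)
  refine hQ.finApprox h.sa _ (fun t => ?_) ?_ fun ε hε =>
    (h.unif (ε / 2) (half_pos hε)).mono fun μ hμ t => ?_
  · rw [h.cutTop_apply]
    exact ((h.approx t).sub h.approx_limit).smul _
  · rw [cocompact_eq_atBot_atTop, tendsto_sup]
    obtain ⟨M, hM⟩ := h.exists_norm_le
    constructor
    · refine squeeze_zero_norm (a := fun t => |φ t| * (M + ‖Cp‖)) (fun t => ?_) ?_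
      · rw [h.cutTop_apply, norm_smul, Complex.norm_real, Real.norm_eq_abs]
        exact mul_le_mul_of_nonneg_left ((norm_sub_le _ _).trans (by gcongr; exact hM t))
          (abs_nonneg _)
      · have := (hb.abs).mul_const (M + ‖Cp‖)
        simpa using this
    · refine squeeze_zero_norm (fun t => ?_) (tendsto_iff_norm_sub_tendsto_zero.1 h.top)
      rw [h.cutTop_apply]
      exact hn t _
  · rw [h.cutTop_apply, smul_mul_assoc, sub_mul]
    refine (hn t _).trans ((norm_sub_le _ _).trans ?_)
    linarith [hμ t, h.norm_limit_le hμ]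

end Localized

end Parametrix

/-! ### The Fredholm property when both limit operators are boundedly invertible. -/

section Sufficiency

open scoped BoundedContinuousFunction

variable {H : Type*} [NormedAddCommGroup H] [InnerProductSpace ℂ H] [CompleteSpace H]
variable {A : H →ₗ.[ℂ] H} {C : ℝ → H →L[ℂ] H} {Cp : H →L[ℂ] H} {B : ℝ → H →ₗ.[ℂ] H}
variable {φ φ' : ℝ →ᵇ ℝ} {L WL P WP : L2 H →L[ℂ] L2 H}

theorem RelCompactPath.mulL2_cutBot (h : RelCompactPath A C Cp) (w : L2 H) :
    mulL2 (h.cutBot φ) w = mulL2 h.bcf w - mulL2 (realMul H φ) (mulL2 h.bcf w) := by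
  refine Lp.ext ?_
  filter_upwards [coeFn_mulL2 (h.cutBot φ) w, coeFn_mulL2 h.bcf w,
    coeFn_mulL2 (realMul H φ) (mulL2 h.bcf w),
    Lp.coeFn_sub (mulL2 h.bcf w) (mulL2 (realMul H φ) (mulL2 h.bcf w))] with t h1 h2 h3 h4
  rw [h1, h4, Pi.sub_apply, h3, h2]
  rfl

theorem RelCompactPath.mulL2_cutTop (h : RelCompactPath A C Cp) (w : L2 H) :
    mulL2 (h.cutTop φ) w =
      mulL2 (realMul H φ) (mulL2 h.bcf w) - mulL2 (realMul H φ) (constL2 Cp w) := by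
  refine Lp.ext ?_
  filter_upwards [coeFn_mulL2 (h.cutTop φ) w, coeFn_mulL2 h.bcf w, coeFn_constL2 Cp w,
    coeFn_mulL2 (realMul H φ) (mulL2 h.bcf w), coeFn_mulL2 (realMul H φ) (constL2 Cp w),
    Lp.coeFn_sub (mulL2 (realMul H φ) (mulL2 h.bcf w)) (mulL2 (realMul H φ) (constL2 Cp w))]
    with t h1 h2 h3 h4 h5 h6
  rw [h1, h6, Pi.sub_apply, h4, h5, h2, h3]
  rfl

theorem mulL2_realMul_comm (φ : ℝ →ᵇ ℝ) (G : ℝ →ᵇ (H →L[ℂ] H)) (w : L2 H) :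
    mulL2 G (mulL2 (realMul H φ) w) = mulL2 (realMul H φ) (mulL2 G w) := by
  rw [mulL2_mul, mulL2_mul, realMul_comm]

/-- The right parametrix of the model operator. -/
theorem RelCompactPath.parametrix (h : RelCompactPath A C Cp)
    (hB : ∀ t, familyOp A B t = pertOp A (C t)) (hL : IsModelInverse A 0 L WL)
    (hP : IsModelInverse A Cp P WP) (hd : ∀ t, HasDerivAt φ (φ' t) t) (x : L2 H) :
    ∃ u, (u, x + ((mulL2 (realMul H φ')).comp (P - L)) x +
      ((mulL2 (h.cutBot φ)).comp WL + (mulL2 (h.cutTop φ)).comp WP) x) ∈ (modelOp A B).graph := by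
  have hL2 := hL.ddt x
  rw [constL2_zero, zero_apply, sub_zero] at hL2
  have d1 := realMul_mem_ddtGraph hd hL2
  have d2 := realMul_mem_ddtGraph hd (hP.ddt x)
  have a1 := realMul_mem_fiberGraph φ (hL.fiber x)
  have a2 := realMul_mem_fiberGraph φ (hP.fiber x)
  have d3 := (ddtGraph H).add_mem ((ddtGraph H).sub_mem hL2 d1) d2
  have a3 := (fiberGraph fun _ => A).add_mem ((fiberGraph fun _ => A).sub_mem (hL.fiber x) a1) a2
  rw [Prod.mk_sub_mk, Prod.mk_add_mk] at d3 a3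
  -- The preimage is u = L x - φ L x + φ P x. Differentiating φ produces φ'(P - L) x; where L or P
  -- is not the exact inverse, (1 - φ) C or φ (C - Cp) remains.
  refine ⟨_, (mem_graph_modelOp h hB).2 ⟨_, _, d3, a3, ?_⟩⟩
  simp only [add_apply, sub_apply, ContinuousLinearMap.comp_apply, h.mulL2_cutBot, h.mulL2_cutTop,
    map_add, map_sub, map_smul, mulL2_realMul_comm]
  module

/-- Elements of the kernel of the model operator, in terms of the localized inverses. -/
theorem RelCompactPath.eq_of_mem_ker (h : RelCompactPath A C Cp) (hL : IsModelInverse A 0 L WL)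
    (hP : IsModelInverse A Cp P WP) (hd : ∀ t, HasDerivAt φ (φ' t) t) {f f' a : L2 H}
    (h1 : (f, f') ∈ ddtGraph H) (h2 : (f, a) ∈ fiberGraph fun _ => A)
    (h3 : f' + a + mulL2 h.bcf (a - Complex.I • f) = 0) :
    f = ((P - L).comp (mulL2 (realMul H φ'))) f -
      (L.comp ((mulL2 (h.cutBot φ)).comp WL) + P.comp ((mulL2 (h.cutTop φ)).comp WL)) (f' + a) := by
  have e1 := hL.left _ _ _ h1 h2
  rw [constL2_zero, zero_apply, add_zero] at e1
  have e2 : a - Complex.I • f = WL (f' + a) := by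
    have := hL.fiber (f' + a)
    rw [e1] at this
    exact sub_eq_of_eq_add (fiber_unique h2 this)
  have d1 := realMul_mem_ddtGraph hd h1
  have a1 := realMul_mem_fiberGraph φ h2
  have d2 := (ddtGraph H).sub_mem h1 d1
  have a2 := (fiberGraph fun _ => A).sub_mem h2 a1
  rw [Prod.mk_sub_mk] at d2 a2
  have e3 := hL.left _ _ _ d2 a2
  have e4 := hP.left _ _ _ d1 a1
  rw [constL2_zero, zero_apply, add_zero] at e3
  set S := mulL2 (realMul H φ) with hS
  set S' := mulL2 (realMul H φ') with hS'
  set w := a - Complex.I • f with hw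
  -- Split f = (1 - φ) f + φ f. The first piece is recovered by L from its image under d/dt + A, the
  -- second by P from its image under d/dt + A₊; the kernel equation rewrites both images through φ'
  -- f and the cut off perturbations of w = (A - i) f.
  have e5 : f' - (S' f + S f') + (a - S a) = - S' f - mulL2 (h.cutBot φ) w := by
    have : S (f' + a + mulL2 h.bcf w) = 0 := by rw [h3, map_zero]
    rw [map_add, map_add] at this
    rw [h.mulL2_cutBot, ← hS]
    linear_combination (norm := module) h3 - this
  have e6 : S' f + S f' + S a + constL2 Cp (S a - Complex.I • S f) =
      S' f - mulL2 (h.cutTop φ) w := by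
    have : S (f' + a + mulL2 h.bcf w) = 0 := by rw [h3, map_zero]
    rw [map_add, map_add] at this
    have e7 : constL2 Cp (S a - Complex.I • S f) = S (constL2 Cp w) := by
      rw [← map_smul, ← map_sub, ← hw, constL2, hS, mulL2_realMul_comm]
    rw [e7, h.mulL2_cutTop, ← hS]
    linear_combination (norm := module) this
  have e3' : L (- S' f - mulL2 (h.cutBot φ) w) = f - S f := by rw [← e5]; exact e3
  have e4' : P (S' f - mulL2 (h.cutTop φ) w) = S f := by rw [← e6]; exact e4
  have e8 : f = L (- S' f - mulL2 (h.cutBot φ) w) + P (S' f - mulL2 (h.cutTop φ) w) := by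
    rw [e3', e4']; abel
  conv_lhs => rw [e8]
  simp only [add_apply, sub_apply, ContinuousLinearMap.comp_apply, map_sub, map_neg, ← e2]
  abel

/-- With F of finite rank close to K, the map f ↦ F (f' + a) is injective on the kernel: if it
vanishes, the identity gives ‖f‖ ≤ (1/2 + 1/4) ‖f‖. The graph bound ‖f' + a‖ ≤ c ‖f‖ on the kernel
dictates the accuracy 1 / (4 (c + 1)). -/
theorem RelCompactPath.finiteDimensional_kerOp (h : RelCompactPath A C Cp)
    (hB : ∀ t, familyOp A B t = pertOp A (C t)) {V K : L2 H →L[ℂ] L2 H} (hV : ‖V‖ ≤ 1 / 2)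
    (hK : FinApprox K)
    (hf : ∀ f f' a : L2 H, (f, f') ∈ ddtGraph H → (f, a) ∈ (fiberGraph fun _ => A) →
      f' + a + mulL2 h.bcf (a - Complex.I • f) = 0 → f = V f - K (f' + a)) :
    FiniteDimensional ℂ (kerOp (modelOp A B)) := by
  obtain ⟨c, hc0, hc⟩ := h.exists_graph_bound
  obtain ⟨F, hF, hKF⟩ := hK (1 / (4 * (c + 1))) (by positivity)
  set N := kerOp (modelOp A B) with hN
  have hex : ∀ f : N, ∃ f' a, (f.1, f') ∈ ddtGraph H ∧ (f.1, a) ∈ (fiberGraph fun _ => A) ∧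
      f' + a + mulL2 h.bcf (a - Complex.I • f.1) = 0 := by
    intro f
    obtain ⟨f', a, h1, h2, h3⟩ := (mem_graph_modelOp h hB).1 (mem_kerOp.1 f.2)
    exact ⟨f', a, h1, h2, h3.symm⟩
  choose f' a h1 h2 h3 using hex
  have hw : ∀ f : N, f' f + a f = - mulL2 h.bcf (a f - Complex.I • f.1) := fun f =>
    eq_neg_of_add_eq_zero_left (h3 f)
  have hadd : ∀ f g : N, a (f + g) = a f + a g := fun f g => by
    have := (fiberGraph fun _ => A).add_mem (h2 f) (h2 g)
    rw [Prod.mk_add_mk] at this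
    exact fiber_unique (h2 (f + g)) this
  have hsmul : ∀ (z : ℂ) (f : N), a (z • f) = z • a f := fun z f => by
    have := (fiberGraph fun _ => A).smul_mem z (h2 f)
    rw [Prod.smul_mk] at this
    exact fiber_unique (h2 (z • f)) this
  let X : N →ₗ[ℂ] L2 H :=
    { toFun := fun f => f' f + a f
      map_add' := fun f g => by
        rw [hw (f + g), hw f, hw g, hadd, Submodule.coe_add]
        simp only [map_sub, map_add, map_smul]
        module
      map_smul' := fun z f => by
        rw [hw (z • f), hw f, hsmul, Submodule.coe_smul, RingHom.id_apply]
        simp only [map_sub, map_smul]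
        module }
  let Y : N →ₗ[ℂ] LinearMap.range (F : L2 H →ₗ[ℂ] L2 H) :=
    ((F : L2 H →ₗ[ℂ] L2 H).rangeRestrict).comp X
  refine Module.Finite.of_injective Y ?_
  rw [← LinearMap.ker_eq_bot, LinearMap.ker_eq_bot']
  intro f hY
  have e1 : F (X f) = 0 := congrArg Subtype.val hY
  have e2 : f.1 = V f.1 - (K - F) (X f) := by
    rw [sub_apply, e1, sub_zero]
    exact hf _ _ _ (h1 f) (h2 f) (h3 f)
  have e3 : ‖X f‖ ≤ c * ‖f.1‖ := by
    have := hc _ _ _ (h1 f) (h2 f)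
    rwa [h3 f, norm_zero, zero_add] at this
  have e4 : ‖f.1‖ ≤ 1 / 2 * ‖f.1‖ + 1 / 4 * ‖f.1‖ := by
    conv_lhs => rw [e2]
    refine (norm_sub_le _ _).trans (add_le_add ?_ ?_)
    · exact (V.le_opNorm _).trans (by gcongr)
    · refine ((K - F).le_opNorm _).trans ?_
      calc ‖K - F‖ * ‖X f‖ ≤ 1 / (4 * (c + 1)) * (c * ‖f.1‖) := by gcongr
        _ = c / (c + 1) * (1 / 4 * ‖f.1‖) := by field_simp
        _ ≤ 1 * (1 / 4 * ‖f.1‖) := by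
          gcongr
          rw [div_le_one (by positivity)]; linarith
        _ = _ := one_mul _
  have e5 : ‖f.1‖ ≤ 0 := by linarith [norm_nonneg f.1]
  exact Subtype.ext (norm_le_zero_iff.1 e5)

/-- If both limit operators are boundedly invertible, the model operator is Fredholm. -/
theorem RelCompactPath.isFredholm (h : RelCompactPath A C Cp)
    (hB : ∀ t, familyOp A B t = pertOp A (C t)) (h0 : (0 : ℂ) ∈ resolventSet A)
    (hp : (0 : ℂ) ∈ resolventSet (pertOp A Cp)) : IsFredholm (modelOp A B) := by
  obtain ⟨L, WL, hL⟩ := exists_isModelInverse_zero h.sa h0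
  obtain ⟨P, WP, hP⟩ := exists_isModelInverse h.sa h.relPert_limit hp
  -- The step must be so slow that φ'(P - L) and (P - L) φ' have norm at most 1/2.
  set ε := 1 / (2 * (‖P - L‖ + 1)) with hε
  obtain ⟨φ, φ', hd, hφ', hφ1, hφ2, hbot, htop⟩ := exists_slow_step (ε := ε) (by positivity)
  have hn : ‖mulL2 (realMul H φ')‖ ≤ ε :=
    norm_mulL2_le fun t => (norm_realMul_apply_le φ' t).trans (hφ' t)
  have hn' : ε * ‖P - L‖ ≤ 1 / 2 := by
    rw [hε, div_mul_eq_mul_div, div_le_div_iff₀ (by positivity) two_pos]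
    nlinarith [norm_nonneg (P - L)]
  have k1 := h.finApprox_cutBot hφ2 htop hL
  have k2 := h.finApprox_cutTop hφ1 hbot hP
  have k3 := h.finApprox_cutTop hφ1 hbot hL
  have hlow : IsLowerSemiFredholm (modelOp A B) :=
    lowerSemiFredholm_of_parametrix (dense_domain_modelOp h hB) (k1.add k2)
      (((ContinuousLinearMap.opNorm_comp_le _ _).trans (by gcongr)).trans hn')
      (h.parametrix hB hL hP hd)
  refine ⟨hlow.1, finiteDimensional_ker_iff.2 (h.finiteDimensional_kerOp hB
    (V := (P - L).comp (mulL2 (realMul H φ'))) ?_ ((k1.clm_comp L).add (k3.clm_comp P))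
    fun f f' a h1 h2 h3 => h.eq_of_mem_ker hL hP hd h1 h2 h3), hlow.2⟩
  refine ((ContinuousLinearMap.opNorm_comp_le _ _).trans ?_).trans hn'
  rw [mul_comm]
  gcongr

end Sufficiency

/-! ### Failure of the semi-Fredholm properties when a limit operator is not invertible. -/

section Necessity

open scoped BoundedContinuousFunction

variable {H : Type*} [NormedAddCommGroup H] [InnerProductSpace ℂ H] [CompleteSpace H]
variable {A : H →ₗ.[ℂ] H} {C : ℝ → H →L[ℂ] H} {Cp : H →L[ℂ] H} {B : ℝ → H →ₗ.[ℂ] H}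

theorem inner_fiberGraph (hA : IsSelfAdjoint A) {f a u b : L2 H}
    (h1 : (f, a) ∈ fiberGraph fun _ => A) (h2 : (u, b) ∈ fiberGraph fun _ => A) :
    ⟪a, u⟫_ℂ = ⟪f, b⟫_ℂ := by
  refine inner_eq_of_ae ?_
  filter_upwards [mem_fiberGraph_iff.1 h1, mem_fiberGraph_iff.1 h2] with t h1 h2
  exact isSymm_iff.1 (isSymm_of_isSelfAdjoint hA) _ _ _ _ h1 h2

/-- Only this inclusion, -d/dt + 𝐀 ⊆ D*, is needed, since it serves to evaluate D* on explicit
functions. -/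
theorem RelCompactPath.mem_graph_adjoint (h : RelCompactPath A C Cp)
    (hB : ∀ t, familyOp A B t = pertOp A (C t)) {f f' a : L2 H} (h1 : (f, f') ∈ ddtGraph H)
    (h2 : (f, a) ∈ fiberGraph fun _ => A) :
    (f, - f' + a + mulL2 h.bcf (a - Complex.I • f)) ∈ (modelOp A B)†.graph := by
  refine (mem_graph_adjoint_iff (T := modelOp A B) (dense_domain_modelOp h hB)).2
    fun u v huv => ?_
  obtain ⟨u', b, h3, h4, rfl⟩ := (mem_graph_modelOp h hB).1 huv
  have e1 := inner_ddt h3 h1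
  have e2 := inner_fiberGraph h.sa h4 h2
  have e3 : ⟪mulL2 h.bcf (b - Complex.I • u), f⟫_ℂ = ⟪u, mulL2 h.bcf (a - Complex.I • f)⟫_ℂ := by
    refine inner_eq_of_ae ?_
    filter_upwards [mem_fiberGraph_iff.1 h4, mem_fiberGraph_iff.1 h2,
      coeFn_mulL2 h.bcf (b - Complex.I • u), coeFn_mulL2 h.bcf (a - Complex.I • f),
      Lp.coeFn_sub b (Complex.I • u), Lp.coeFn_smul Complex.I u,
      Lp.coeFn_sub a (Complex.I • f), Lp.coeFn_smul Complex.I f]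
      with t k1 k2 k3 k4 k5 k6 k7 k8
    rw [k3, k4, k5, k7, Pi.sub_apply, Pi.sub_apply, k6, k8, Pi.smul_apply, Pi.smul_apply]
    exact h.symm t _ _ _ _ k1 k2
  simp only at e1
  rw [inner_add_left, inner_add_left, inner_add_right, inner_add_right, inner_neg_right, e1, e2, e3]

/-- Otherwise T is bounded below; being self-adjoint it then has trivial orthogonal complement of
the range, and is boundedly invertible. -/
theorem exists_approx_null {T : H →ₗ.[ℂ] H} (hT : IsSelfAdjoint T)
    (h0 : (0 : ℂ) ∉ resolventSet T) {ε : ℝ} (hε : 0 < ε) :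
    ∃ x y, (x, y) ∈ T.graph ∧ x ≠ 0 ∧ ‖y‖ ≤ ε * ‖x‖ := by
  by_contra! hne
  refine h0 ?_
  have hb : ∀ x y, (x, y) ∈ T.graph → ‖x‖ ≤ ε⁻¹ * ‖y‖ := by
    intro x y hxy
    by_cases hx : x = 0
    · rw [hx, norm_zero]; positivity
    · rw [inv_mul_eq_div, le_div_iff₀ hε, mul_comm]
      exact (hne x y hxy hx).le
  obtain ⟨R, hR, -⟩ := exists_isBoundedInverse hT.isClosed hb fun w hw => by
    have h1 : (w, 0) ∈ T.graph := (mem_graph_iff_of_isSelfAdjoint hT).2 fun u v huv => by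
      rw [hw u v huv, inner_zero_right]
    have h2 := hb _ _ h1
    rw [norm_zero, mul_zero] at h2
    exact norm_le_zero_iff.1 h2
  exact zero_mem_resolventSet_iff.2 ⟨R, isBoundedInverse_iff.1 hR⟩

/-- Bump functions whose derivative is small in the mean. -/
theorem exists_flat_bump {ε : ℝ} (hε : 0 < ε) : ∃ b b' : ℝ → ℝ, (∀ t, HasDerivAt b (b' t) t) ∧
    Continuous b' ∧ HasCompactSupport b ∧ HasCompactSupport b' ∧ 0 < ∫ t, b t ^ 2 ∧
    ∫ t, b' t ^ 2 ≤ ε ^ 2 * ∫ t, b t ^ 2 := by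
  obtain ⟨β, hρ, hβc, hβ1⟩ : ∃ β : ℝ → ℝ, ContDiff ℝ 1 β ∧ HasCompactSupport β ∧ β 0 = 1 := by
    let ρ : ContDiffBump (0 : ℝ) := ⟨1, 2, by norm_num, by norm_num⟩
    exact ⟨fun t => ρ t, ρ.contDiff, ρ.hasCompactSupport, ρ.one_of_mem_closedBall (by simp [ρ])⟩
  have hd : ∀ t, HasDerivAt β (deriv β t) t := fun t =>
    (hρ.differentiable (by simp)).differentiableAt.hasDerivAt
  have hd' : Continuous (deriv β) := hρ.continuous_deriv le_rfl
  set I₀ := ∫ t, β t ^ 2 with hI₀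
  set I₁ := ∫ t, deriv β t ^ 2 with hI₁
  have hpos : 0 < I₀ := by
    refine Continuous.integral_pos_of_hasCompactSupport_nonneg_nonzero (x := 0)
      (hρ.continuous.pow 2) ?_ (fun t => sq_nonneg _) ?_
    · exact hβc.comp_left (g := fun x : ℝ => x ^ 2) (by simp)
    · rw [hβ1]; norm_num
  have hI₁' : 0 ≤ I₁ := integral_nonneg fun t => sq_nonneg _
  -- Stretching by ℓ divides the ratio of the two integrals by ℓ².
  obtain ⟨ℓ, hℓ, hℓ1⟩ : ∃ ℓ : ℝ, 0 < ℓ ∧ I₁ ≤ ε ^ 2 * I₀ * ℓ ^ 2 := by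
    have hp : 0 < ε ^ 2 * I₀ := by positivity
    refine ⟨max 1 (I₁ / (ε ^ 2 * I₀)), lt_max_of_lt_left one_pos, ?_⟩
    set m := max 1 (I₁ / (ε ^ 2 * I₀)) with hm
    have h1 : I₁ ≤ ε ^ 2 * I₀ * m := by
      rw [← div_le_iff₀' hp]; exact le_max_right _ _
    have h2 : (1 : ℝ) ≤ m := le_max_left _ _
    refine h1.trans ?_
    gcongr
    nlinarith
  have hcs : ∀ {g : ℝ → ℝ}, HasCompactSupport g → HasCompactSupport fun t => g (t / ℓ) := by
    intro g hg
    simp only [div_eq_mul_inv]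
    exact hg.comp_homeomorph (Homeomorph.mulRight₀ ℓ⁻¹ (inv_ne_zero hℓ.ne'))
  refine ⟨fun t => β (t / ℓ), fun t => deriv β (t / ℓ) * ℓ⁻¹, fun t => ?_, ?_, hcs hβc, ?_, ?_, ?_⟩
  · have h1 : HasDerivAt (fun t : ℝ => t / ℓ) ℓ⁻¹ t := by
      simpa using (hasDerivAt_id t).div_const ℓ
    exact (hd (t / ℓ)).comp t h1
  · exact (hd'.comp (continuous_id.div_const ℓ)).mul continuous_const
  · exact (hcs hβc.deriv).mul_right
  · have := Measure.integral_comp_div (fun t => β t ^ 2) ℓ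
    rw [this, abs_of_pos hℓ, smul_eq_mul]
    positivity
  · have h1 := Measure.integral_comp_div (fun t => β t ^ 2) ℓ
    have h2 := Measure.integral_comp_div (fun t => deriv β t ^ 2) ℓ
    simp only [mul_pow, integral_mul_const]
    rw [h1, h2, abs_of_pos hℓ, smul_eq_mul, smul_eq_mul, ← hI₀, ← hI₁]
    calc ℓ * I₁ * ℓ⁻¹ ^ 2 = I₁ / ℓ := by field_simp
      _ ≤ ε ^ 2 * I₀ * ℓ ^ 2 / ℓ := by gcongr
      _ = _ := by field_simp

theorem norm_tensor_sq {φ : ℝ → ℝ} (hφ : Continuous φ) (hc : HasCompactSupport φ) (x : H) :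
    ‖(memLp_tensor hφ hc x).toLp‖ ^ 2 = (∫ t, φ t ^ 2) * ‖x‖ ^ 2 := by
  have h1 : ∫ t, φ t • (memLp_tensor hφ hc x).toLp _ t = (∫ t, φ t ^ 2) • x := by
    rw [← integral_smul_const]
    refine integral_congr_ae ?_
    filter_upwards [(memLp_tensor hφ hc x).coeFn_toLp] with t ht
    rw [ht, smul_smul, sq]
  have h2 := inner_tensor hφ hc x (memLp_tensor hφ hc x).toLp
  rw [h1, inner_self_eq_norm_sq_to_K, ← Complex.coe_smul, inner_smul_right,
    inner_self_eq_norm_sq_to_K] at h2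
  apply Complex.ofReal_injective
  push_cast
  exact h2

theorem norm_tensor {φ : ℝ → ℝ} (hφ : Continuous φ) (hc : HasCompactSupport φ) (x : H) :
    ‖(memLp_tensor hφ hc x).toLp‖ = Real.sqrt (∫ t, φ t ^ 2) * ‖x‖ := by
  rw [← Real.sqrt_sq (norm_nonneg _), norm_tensor_sq hφ hc, Real.sqrt_mul (integral_nonneg fun t =>
    sq_nonneg _), Real.sqrt_sq (norm_nonneg _)]

/-- A filter at infinity which is stable under bounded perturbations of the variable. -/
def IsUnboundedEnd (l : Filter ℝ) : Prop :=
  l ≤ cocompact ℝ ∧ ∀ (R : ℝ) (p : ℝ → Prop), (∀ᶠ t in l, p t) →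
    ∀ᶠ s in l, ∀ t, |t - s| ≤ R → p t

theorem isUnboundedEnd_atTop : IsUnboundedEnd (atTop : Filter ℝ) := by
  refine ⟨by rw [cocompact_eq_atBot_atTop]; exact le_sup_right, fun R p hp => ?_⟩
  obtain ⟨a, ha⟩ := eventually_atTop.1 hp
  filter_upwards [eventually_ge_atTop (a + R)] with s hs t ht
  exact ha t (by linarith [(abs_le.1 ht).1])

theorem isUnboundedEnd_atBot : IsUnboundedEnd (atBot : Filter ℝ) := by
  refine ⟨by rw [cocompact_eq_atBot_atTop]; exact le_sup_left, fun R p hp => ?_⟩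
  obtain ⟨a, ha⟩ := eventually_atBot.1 hp
  filter_upwards [eventually_le_atBot (a - R)] with s hs t ht
  exact ha t (by linarith [(abs_le.1 ht).2])

/-- Functions escaping to infinity tend weakly to zero. -/
theorem tendsto_inner_of_escape {l : Filter ℝ} (hl : IsUnboundedEnd l) {F : ℝ → L2 H} {M R : ℝ}
    (hM : ∀ s, ‖F s‖ ≤ M) (hR : ∀ s, ∀ᵐ t, R < |t - s| → F s t = 0) (e : L2 H) {ε : ℝ}
    (hε : 0 < ε) : ∀ᶠ s in l, ‖⟪e, F s⟫_ℂ‖ ≤ ε := by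
  have hM0 : 0 ≤ M := (norm_nonneg _).trans (hM 0)
  -- Up to an error ε / (M + 1), the vector e has compact support, which F s eventually leaves.
  obtain ⟨g, hg, h1, -, hgm⟩ := (Lp.memLp e).exists_hasCompactSupport_eLpNorm_sub_le (by norm_num)
    (ε := ENNReal.ofReal (ε / (M + 1))) (by rw [ENNReal.ofReal_ne_zero_iff]; positivity)
  have h2 : ‖e - hgm.toLp‖ ≤ ε / (M + 1) := by
    have h3 : e - hgm.toLp = ((Lp.memLp e).sub hgm).toLp := by
      rw [MemLp.toLp_sub (Lp.memLp e) hgm, Lp.toLp_coeFn]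
    rw [h3, Lp.norm_toLp]
    exact ENNReal.toReal_le_of_le_ofReal (by positivity) h1
  have h3 : ∀ᶠ t in l, g t = 0 := hl.1 (by
    filter_upwards [hg.isCompact.compl_mem_cocompact] with t ht
    exact image_eq_zero_of_notMem_tsupport ht)
  filter_upwards [hl.2 R _ h3] with s hs
  have h4 : ⟪hgm.toLp, F s⟫_ℂ = 0 := by
    rw [L2.inner_def]
    refine integral_eq_zero_of_ae ?_
    filter_upwards [hgm.coeFn_toLp, hR s] with t k1 k2
    rw [k1, Pi.zero_apply]
    by_cases ht : |t - s| ≤ R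
    · rw [hs t ht, inner_zero_left]
    · rw [k2 (not_le.1 ht), inner_zero_right]
  have h5 : ⟪e, F s⟫_ℂ = ⟪e - hgm.toLp, F s⟫_ℂ := by rw [inner_sub_left, h4, sub_zero]
  rw [h5]
  refine (norm_inner_le_norm _ _).trans ?_
  calc _ ≤ ε / (M + 1) * M := by gcongr; exact hM s
    _ ≤ ε := by
      rw [div_mul_eq_mul_div, div_le_iff₀ (by positivity)]
      nlinarith

/-- The test functions are b(t - s) x, with x an approximate null vector of the limit operator and s
far out. One third of ε each is spent on b', on the limit operator at x, and on C(t) - D over the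
support of the bump. -/
theorem RelCompactPath.not_semiFredholm (h : RelCompactPath A C Cp)
    (hB : ∀ t, familyOp A B t = pertOp A (C t)) {l : Filter ℝ} [l.NeBot] (hl : IsUnboundedEnd l)
    {D : H →L[ℂ] H} (hD : RelPert A D) (hlim : Tendsto C l (𝓝 D))
    (h0 : (0 : ℂ) ∉ resolventSet (pertOp A D)) :
    ¬ IsUpperSemiFredholm (modelOp A B) ∧ ¬ IsLowerSemiFredholm (modelOp A B) := by
  refine not_semiFredholm_of_approx (dense_domain_modelOp h hB) (isClosed_modelOp h hB)
    fun ε hε m e => ?_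
  have hε3 : 0 < ε / 3 := by positivity
  obtain ⟨x, y, hxy, hx, hyx⟩ := exists_approx_null (hD.isSelfAdjoint h.sa) h0 hε3
  obtain ⟨a₀, ha₀, rfl⟩ := mem_graph_pertOp.1 hxy
  obtain ⟨b, b', hd, hb', hbc, hbc', hpos, hle⟩ := exists_flat_bump hε3
  have hb : Continuous b := continuous_iff_continuousAt.2 fun t => (hd t).continuousAt
  have hshift : ∀ s : ℝ, Continuous fun t : ℝ => t - s := fun s => continuous_id.sub continuous_const
  have hcs : ∀ {g : ℝ → ℝ}, HasCompactSupport g → ∀ s, HasCompactSupport fun t => g (t - s) :=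
    fun hg s => hg.comp_homeomorph (Homeomorph.subRight s)
  have hd' : ∀ s t, HasDerivAt (fun t => b (t - s)) (b' (t - s)) t := fun s t =>
    (hd (t - s)).comp_sub_const t s
  let F : H → ℝ → L2 H := fun z s => (memLp_tensor (hb.comp (hshift s)) (hcs hbc s) z).toLp
  let F' : ℝ → L2 H := fun s => (memLp_tensor (hb'.comp (hshift s)) (hcs hbc' s) x).toLp
  set β := Real.sqrt (∫ t, b t ^ 2) with hβ
  have hβ0 : 0 < β := Real.sqrt_pos.2 hpos
  have hF : ∀ z s, ‖F z s‖ = β * ‖z‖ := by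
    intro z s
    rw [norm_tensor (hb.comp (hshift s)) (hcs hbc s)]
    have := integral_sub_right_eq_self (μ := volume) (fun t => b t ^ 2) s
    simp only [Function.comp_def] at this ⊢
    rw [this]
  have hF' : ∀ s, ‖F' s‖ ≤ ε / 3 * (β * ‖x‖) := by
    intro s
    rw [norm_tensor (hb'.comp (hshift s)) (hcs hbc' s)]
    have := integral_sub_right_eq_self (μ := volume) (fun t => b' t ^ 2) s
    simp only [Function.comp_def] at this ⊢
    rw [this, ← mul_assoc]
    gcongr
    rw [hβ]
    calc _ ≤ Real.sqrt ((ε / 3) ^ 2 * ∫ t, b t ^ 2) := Real.sqrt_le_sqrt hle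
      _ = _ := by rw [Real.sqrt_mul (sq_nonneg _), Real.sqrt_sq hε3.le]
  have hFae : ∀ z s, ∀ᵐ t, F z s t = b (t - s) • z := fun z s => MemLp.coeFn_toLp _
  obtain ⟨R, hR⟩ := hbc.isCompact.isBounded.subset_closedBall 0
  have hz : ∀ s t, R < |t - s| → b (t - s) = 0 := by
    intro s t ht
    by_contra h
    have := hR (subset_tsupport b h)
    rw [Metric.mem_closedBall, dist_zero_right, Real.norm_eq_abs] at this
    linarith
  have hnx : 0 < ‖x‖ := norm_pos_iff.2 hx
  set w := a₀ - Complex.I • x with hw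
  -- Chosen so that η ‖w‖ ≤ (ε / 3) ‖x‖, where w = (A - i) x is the vector to which C(t) - D is
  -- applied.
  set η := ε / 3 * ‖x‖ / (‖w‖ + 1) with hη
  have hη0 : 0 < η := by positivity
  have hev1 : ∀ᶠ s in l, ∀ t, |t - s| ≤ R → ‖C t - D‖ ≤ η := by
    refine hl.2 R _ ?_
    have := (tendsto_iff_norm_sub_tendsto_zero.1 hlim).eventually (gt_mem_nhds hη0)
    exact this.mono fun t ht => ht.le
  have hev2 : ∀ᶠ s in l, ∀ j, ‖⟪e j, F x s⟫_ℂ‖ ≤ ε * (β * ‖x‖) :=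
    eventually_all.2 fun j => tendsto_inner_of_escape hl (fun s => (hF x s).le) (R := R)
      (fun s => by
        filter_upwards [hFae x s] with t ht h1
        rw [ht, hz s t h1, zero_smul]) (e j) (by positivity)
  obtain ⟨s, hs1, hs2⟩ := (hev1.and hev2).exists
  have m1 : (F x s, F' s) ∈ ddtGraph H :=
    tensor_mem_ddtGraph (hd' s) (hb'.comp (hshift s)) (hcs hbc s) (hcs hbc' s)
      (hb.comp (hshift s)) x
  have m2 : (F x s, F a₀ s) ∈ fiberGraph fun _ => A :=
    tensor_mem_fiberGraph (hb.comp (hshift s)) (hcs hbc s) ha₀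
  set q := F a₀ s + mulL2 h.bcf (F a₀ s - Complex.I • F x s) with hq
  have hqn : ‖q‖ ≤ 2 * (ε / 3) * (β * ‖x‖) := by
    have h1 : ‖q - F (a₀ + D w) s‖ ≤ η * ‖F w s‖ := by
      refine Lp.norm_le_mul_norm_of_ae_le_mul ?_
      filter_upwards [hFae x s, hFae a₀ s, hFae w s, hFae (a₀ + D w) s,
        coeFn_mulL2 h.bcf (F a₀ s - Complex.I • F x s), Lp.coeFn_sub (F a₀ s) (Complex.I • F x s),
        Lp.coeFn_smul Complex.I (F x s), Lp.coeFn_sub q (F (a₀ + D w) s),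
        Lp.coeFn_add (F a₀ s) (mulL2 h.bcf (F a₀ s - Complex.I • F x s))]
        with t k1 k2 k3 k4 k5 k6 k7 k8 k9
      have k10 : b (t - s) • a₀ - Complex.I • (b (t - s) • x) = b (t - s) • w := by
        rw [hw, smul_sub, smul_comm]
      have k11 : (q - F (a₀ + D w) s) t = b (t - s) • ((C t - D) w) := by
        rw [k8, Pi.sub_apply, hq, k9, Pi.add_apply, k5, k6, Pi.sub_apply, k7, Pi.smul_apply, k1, k2,
          k4, k10, h.bcf_apply, ← Complex.coe_smul, ← Complex.coe_smul, ← Complex.coe_smul,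
          ← Complex.coe_smul, map_smul, sub_apply]
        module
      rw [k11, k3, norm_smul, norm_smul]
      by_cases ht : |t - s| ≤ R
      · calc _ ≤ ‖b (t - s)‖ * (η * ‖w‖) := by
              gcongr
              exact (ContinuousLinearMap.le_opNorm _ _).trans (by gcongr; exact hs1 t ht)
          _ = _ := by ring
      · rw [hz s t (not_le.1 ht)]; simp
    have h2 : η * ‖F w s‖ ≤ ε / 3 * (β * ‖x‖) := by
      rw [hF, hη]
      calc ε / 3 * ‖x‖ / (‖w‖ + 1) * (β * ‖w‖) = ε / 3 * (β * ‖x‖) * (‖w‖ / (‖w‖ + 1)) := by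
            field_simp
        _ ≤ ε / 3 * (β * ‖x‖) * 1 := by
            gcongr
            rw [div_le_one (by positivity)]; linarith
        _ = _ := mul_one _
    have h3 : ‖F (a₀ + D w) s‖ ≤ ε / 3 * (β * ‖x‖) := by
      rw [hF]
      calc β * ‖a₀ + D w‖ ≤ β * (ε / 3 * ‖x‖) := by gcongr
        _ = _ := by ring
    have h4 := norm_add_le (q - F (a₀ + D w) s) (F (a₀ + D w) s)
    rw [sub_add_cancel] at h4
    linarith
  refine ⟨F x s, F' s + F a₀ s + mulL2 h.bcf (F a₀ s - Complex.I • F x s),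
    - F' s + F a₀ s + mulL2 h.bcf (F a₀ s - Complex.I • F x s), ?_,
    (mem_graph_modelOp h hB).2 ⟨_, _, m1, m2, rfl⟩, h.mem_graph_adjoint hB m1 m2, ?_, ?_, ?_⟩
  · rw [← norm_pos_iff, hF]; positivity
  · rw [add_assoc, ← hq, hF]
    refine (norm_add_le _ _).trans ?_
    linarith [hF' s]
  · rw [add_assoc, ← hq, hF]
    refine (norm_add_le _ _).trans ?_
    rw [norm_neg]
    linarith [hF' s]
  · rw [hF]; exact hs2

end Necessity

end ModelOperator

end

/-! ### The main theorem, with A₊ = A₋ + C₊ (A₋ - i). -/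

theorem theoremt2p6 {H : Type*} [NormedAddCommGroup H] [InnerProductSpace ℂ H] [CompleteSpace H]
    [TopologicalSpace.SeparableSpace H]
    (A : H →ₗ.[ℂ] H) (B B' : ℝ → H →ₗ.[ℂ] H)
    (hyp : ModelOperator.RelTraceClassPath A B B') :
    -- the operators `A(t)` are self-adjoint with domain `dom A₋`
    (∀ t, IsSelfAdjoint (ModelOperator.familyOp A B t) ∧
      (ModelOperator.familyOp A B t).domain = A.domain) ∧
    -- the operator `D` has domain `dom (d/dt) ∩ dom 𝐀₋`, is densely defined and closed
    (ModelOperator.modelOp A B).domain =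
      (ModelOperator.ddt H).domain ⊓ (ModelOperator.fiberOp fun _ => A).domain ∧
    Dense ((ModelOperator.modelOp A B).domain : Set (ModelOperator.L2 H)) ∧
    (ModelOperator.modelOp A B).IsClosed ∧
    -- `A₋` and `A₊` are the norm resolvent limits of `A(t)` as `t → ∓∞`
    (∀ z : ℂ, z.im ≠ 0 →
      Tendsto (fun t => ModelOperator.resolventOp (ModelOperator.familyOp A B t) z) atBot
        (𝓝 (ModelOperator.resolventOp A z))) ∧
    ∃ Ap : H →ₗ.[ℂ] H, IsSelfAdjoint Ap ∧ Ap.domain = A.domain ∧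
      (∀ z : ℂ, z.im ≠ 0 →
        Tendsto (fun t => ModelOperator.resolventOp (ModelOperator.familyOp A B t) z) atTop
          (𝓝 (ModelOperator.resolventOp Ap z))) ∧
      (ModelOperator.IsFredholm (ModelOperator.modelOp A B) ↔
        (0 : ℂ) ∈ ModelOperator.resolventSet Ap ∩ ModelOperator.resolventSet A) ∧
      ((0 : ℂ) ∈ ModelOperator.spectrum Ap ∨ (0 : ℂ) ∈ ModelOperator.spectrum A →
        ¬ ModelOperator.IsUpperSemiFredholm (ModelOperator.modelOp A B) ∧
        ¬ ModelOperator.IsLowerSemiFredholm (ModelOperator.modelOp A B)) := by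
  obtain ⟨C, Cp, h, hB⟩ := hyp.exists_relCompactPath
  have hp := h.relPert_limit
  have hT := hp.isSelfAdjoint h.sa
  refine ⟨fun t => ⟨?_, ?_⟩, ModelOperator.domain_modelOp h hB,
    ModelOperator.dense_domain_modelOp h hB, ModelOperator.isClosed_modelOp h hB, fun z hz => ?_,
    ModelOperator.pertOp A Cp, hT, rfl, fun z hz => ?_, ⟨fun hF => ?_, fun h0 => ?_⟩, fun h0 => ?_⟩
  · rw [hB]
    exact (h.relPert t).isSelfAdjoint h.sa
  · rw [hB]
    rfl
  · have := ModelOperator.tendsto_resolventOp_pertOp h.sa h.relPert ModelOperator.relPert_zero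
      h.bot hz
    rw [ModelOperator.pertOp_zero] at this
    simpa only [hB] using this
  · simpa only [hB] using ModelOperator.tendsto_resolventOp_pertOp h.sa h.relPert hp h.top hz
  -- Fredholm operators are upper-semi-Fredholm, so necessity follows from the failure result at
  -- each end; at -∞ the limit perturbation is 0.
  · have hu : ModelOperator.IsUpperSemiFredholm (ModelOperator.modelOp A B) := ⟨hF.1, hF.2.1⟩
    constructor
    · by_contra h0
      exact (h.not_semiFredholm hB ModelOperator.isUnboundedEnd_atTop hp h.top h0).1 hu
    · by_contra h0
      exact (h.not_semiFredholm hB ModelOperator.isUnboundedEnd_atBot ModelOperator.relPert_zero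
        h.bot (by rwa [ModelOperator.pertOp_zero])).1 hu
  · exact h.isFredholm hB h0.2 h0.1
  · rcases h0 with h0 | h0
    · exact h.not_semiFredholm hB ModelOperator.isUnboundedEnd_atTop hp h.top h0
    · exact h.not_semiFredholm hB ModelOperator.isUnboundedEnd_atBot ModelOperator.relPert_zero
        h.bot (by rw [ModelOperator.pertOp_zero]; exact h0)
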